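/- Let $n\ge 2$ be an integer, $\gamma\in(0,1)$, and let $\alpha,\beta\in\mathbb R$ satisfy $$-2\gamma<\alpha<\frac{n-2\gamma}{2},\qquad \alpha\le\beta<\alpha+\gamma .$$ Put $p=\dfrac{2n}{n-2\gamma+2(\beta-\alpha)}$ and $\nu=\dfrac{n-2\gamma}{2}-\alpha$, and let $$\kappa=\mathrm{P.V.}\int_{\mathbb R^n}\frac{1-|\zeta|^{-\nu}}{|e_1-\zeta|^{n+2\gamma}\,|\zeta|^{\alpha}}\,d\zeta,\qquad e_1=(1,0,\dots,0).$$ Let $\mathcal C=\mathbb R\times\mathbb S^{n-1}$ be the cylinder with coordinates $(t,\theta)$ and measure $d\mu=dt\,d\theta$, and let $$K(t,\tilde t,\theta,\tilde\theta)=\frac{e^{-\frac{n+2\gamma}{2}|t-\tilde t|}}{\left(1+e^{-2|t-\tilde t|}-2e^{-|t-\tilde t|}\langle\theta,\tilde\theta\rangle\right)^{\frac{n+2\gamma}{2}}} .$$ Let $\tilde D^\gamma(\mathcal C)$ be the space of real-valued $v\in L^2(\mathcal C)$ with $$\int_{\mathcal C}\int_{\mathcal C}K(t,\tilde t,\theta,\tilde\theta)\,(v(t,\theta)-v(\tilde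 t,\tilde\theta))^2\,d\mu\,d\tilde\mu<\infty,$$ and let $\tilde D^\gamma_r$ be the subspace of those $v$ that are independent of $\theta$ (functions of $t$ only). Then every $v\in\tilde D^\gamma_r$ belongs to $L^p(\mathcal C)$, and the functional $$F_{\alpha,\beta}(v)=\frac{\displaystyle\int_{\mathcal C}\int_{\mathcal C}K(t,\tilde t,\theta,\tilde\theta)\,(v(t,\theta)-v(\tilde t,\tilde\theta))^2\,d\mu\,d\tilde\mu+2\kappa\int_{\mathcal C}v^2\,d\mu}{\left(\displaystyle\int_{\mathcal C}|v|^p\,d\mu\right)^{2/p}}$$ attains its infimum over $\tilde D^\gamma_r\setminus\{0\}$: there is $v_*\in\tilde D^\gamma_r\setminus\{0\}$ with $F_{\alpha,\beta}(v_*)\le F_{\alpha,\beta}(w)$ for all $w\in\tilde D^\gamma_r\setminus\{0\}$. -/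

import Mathlib

open MeasureTheory Filter Topology

noncomputable section

namespace FracCKN

/-- Euclidean space `ℝⁿ`. -/
abbrev Eucl (n : ℕ) : Type := EuclideanSpace ℝ (Fin n)

/-- The unit sphere `𝕊ⁿ⁻¹` of `ℝⁿ`. -/
abbrev Sph (n : ℕ) : Type := Metric.sphere (0 : Eucl n) 1

/-- The cylinder `𝒞 = ℝ × 𝕊ⁿ⁻¹`, with points `z = (t, θ)`. -/
abbrev Cyl (n : ℕ) : Type := ℝ × Sph n

/-- The measure `dμ = dt dθ` on the cylinder: Lebesgue measure times the surface measure of the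
unit sphere. -/
def cylMeasure (n : ℕ) : Measure (Cyl n) :=
  (volume : Measure ℝ).prod (volume : Measure (Eucl n)).toSphere

/-- The kernel
`K(t, t', θ, θ') = exp (-(n+2γ)/2 |t-t'|)
  / (1 + exp (-2|t-t'|) - 2 exp (-|t-t'|) ⟨θ, θ'⟩) ^ ((n+2γ)/2)`. -/
def kernel (n : ℕ) (γ : ℝ) (z z' : Cyl n) : ℝ :=
  Real.exp (-(((n : ℝ) + 2 * γ) / 2) * |z.1 - z'.1|) /
    (1 + Real.exp (-2 * |z.1 - z'.1|)
      - 2 * Real.exp (-|z.1 - z'.1|) * inner ℝ (z.2 : Eucl n) (z'.2 : Eucl n))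
      ^ (((n : ℝ) + 2 * γ) / 2)

/-- The first coordinate vector `e₁ = (1, 0, …, 0)` of `ℝⁿ`. -/
def e₁ (n : ℕ) : Eucl n := WithLp.toLp 2 fun i : Fin n => if (i : ℕ) = 0 then (1 : ℝ) else 0

/-- The exponent `ν = (n - 2γ)/2 - α`. -/
def nu (n : ℕ) (γ α : ℝ) : ℝ := ((n : ℝ) - 2 * γ) / 2 - α

/-- The constant
`κ = P.V. ∫_{ℝⁿ} (1 - |ζ|^{-ν}) / (|e₁ - ζ|^{n+2γ} |ζ|^α) dζ`,
the principal value being the limit, as `ε → 0⁺`, of the integrals over the complement of the ball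
of radius `ε` about the singular point `e₁`. -/
def kappa (n : ℕ) (γ α : ℝ) : ℝ :=
  limUnder (𝓝[>] (0 : ℝ)) fun ε : ℝ =>
    ∫ ζ in {ζ : Eucl n | ε < ‖e₁ n - ζ‖},
      (1 - ‖ζ‖ ^ (-nu n γ α)) / (‖e₁ n - ζ‖ ^ ((n : ℝ) + 2 * γ) * ‖ζ‖ ^ α)

/-- The exponent `p = 2n / (n - 2γ + 2(β - α))`. -/
def pExp (n : ℕ) (γ α β : ℝ) : ℝ := 2 * (n : ℝ) / ((n : ℝ) - 2 * γ + 2 * (β - α))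

/-- The integrand `K(z, z') (v(z) - v(z'))²` of the double integral in the energy. -/
def energyDensity (n : ℕ) (γ : ℝ) (v : Cyl n → ℝ) (q : Cyl n × Cyl n) : ℝ :=
  kernel n γ q.1 q.2 * (v q.1 - v q.2) ^ 2

/-- The functional
`F(v) = (∬ K(z, z') (v(z) - v(z'))² dμ dμ' + 2κ ∫ v² dμ) / (∫ |v|^p dμ)^{2/p}`. -/
def F (n : ℕ) (γ α β : ℝ) (v : Cyl n → ℝ) : ℝ :=
  ((∫ q, energyDensity n γ v q ∂((cylMeasure n).prod (cylMeasure n)))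
      + 2 * kappa n γ α * ∫ z, v z ^ 2 ∂(cylMeasure n)) /
    (∫ z, |v z| ^ pExp n γ α β ∂(cylMeasure n)) ^ (2 / pExp n γ α β)

/-- The space of all `v ∈ L²(𝒞)` with `∬ K(z, z') (v(z) - v(z'))² dμ dμ' < ∞`. -/
def Dspace (n : ℕ) (γ : ℝ) : Set (Lp ℝ 2 (cylMeasure n)) :=
  {v | Integrable (energyDensity n γ v) ((cylMeasure n).prod (cylMeasure n))}

/-- The radially symmetric elements of `Dspace`: those that do not depend on `θ`, that is, agree
almost everywhere with a function of `t` only. -/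
def DspaceRad (n : ℕ) (γ : ℝ) : Set (Lp ℝ 2 (cylMeasure n)) :=
  {v | v ∈ Dspace n γ ∧
    ∃ f : ℝ → ℝ, Measurable f ∧ ∀ᵐ z ∂(cylMeasure n), v z = f z.1}

end FracCKN

end

noncomputable section

namespace FracCKN

open ProbabilityTheory
open scoped ENNReal NNReal

/-! For a function `f` of `t` alone, integrating `K` over both spheres turns the double integral
into a translation-invariant form `∬ k(t - s) |f(t) - f(s)|²` on the line, with `k = radKernel`.
Since `k(τ) ≥ c h^(-1-2γ)` for `0 < |τ| ≤ h ≤ 1`, this form together with the `L²` norm controls the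
`H^γ` norm on `ℝ`. The exponent satisfies `p > 2` because `β < α + γ`, and `1/2 - 1/p = (γ - (β -
α))/n < γ` because `n ≥ 2`. The embedding into `L^p` is therefore subcritical in dimension one, even
for `β = α`, and translations are the only loss of compactness.

The energy is coercive because `κ > 0`. In logarithmic polar coordinates the integrand of `κ` is
`(e^(νt) - 1) K`, and the inversion of `ℝⁿ` is the reflection `t ↦ -t`, which preserves `K`.
Averaging the two gives `κ = ∫ (cosh (νt) - 1) K`, which is positive (`kappa_pos`). It is finite
because `γ < 1` tames the pole and `ν < (n + 2γ)/2`, that is `α > -2γ`, tames infinity. Inversion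
also distorts the truncation of the principal value, and the distortion disappears in the limit
(`tendsto_setIntegral_sub`).

The Sobolev inequality and local compactness both come from averages over dyadic cells: a fractional
Poincaré inequality (`lintegral_sub_cellAvg_le`) bounds the oscillation at each scale, and the
scales sum as a geometric series (`eLpNorm'_sub_cellAvg_le`). The same bound excludes vanishing: a
function of bounded energy and unit `L^p` norm has mass bounded below on some unit cell
(`exists_local_mass`).

Let `m` be the infimum of the energy under `∫ |f|^p = 1`. A translated minimizing sequence `h_j`
converges almost everywhere to some `g ≠ 0`. With `θ = ∫ |g|^p`, the Brezis–Lieb lemma splits both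
quantities, so `m ≥ E(g) + m (1 - θ)^(2/p)`. Subadditivity of `x ↦ x^(2/p)` yields `E(g) ≤ m
θ^(2/p)`, so `g` minimizes the quotient (`exists_minimizer`). -/

/-! ### The Brezis–Lieb lemma for integrals in `ℝ≥0∞` -/

/-- Fatou's lemma for a difference `g j = w j - u j` of functions with convergent integrals. -/
theorem lintegral_add_le_of_tendsto {X : Type*} [MeasurableSpace X] {μ : Measure X}
    {g : ℕ → X → ℝ≥0∞} {g' : X → ℝ≥0∞} {u w : ℕ → ℝ≥0∞} {U W : ℝ≥0∞}
    (hg : ∀ j, AEMeasurable (g j) μ) (hlim : ∀ᵐ x ∂μ, Tendsto (fun j => g j x) atTop (𝓝 (g' x)))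
    (hsum : ∀ j, ∫⁻ x, g j x ∂μ + u j = w j) (hu : Tendsto u atTop (𝓝 U))
    (hw : Tendsto w atTop (𝓝 W)) : ∫⁻ x, g' x ∂μ + U ≤ W := by
  -- Compactness of `[0, ∞]` gives a limit `G` of the integrals, and `G + U = W` follows by adding
  -- limits. Nothing is subtracted, so no finiteness is needed.
  obtain ⟨G, φ, hφ, hG⟩ := CompactSpace.tendsto_subseq (fun j => ∫⁻ x, g j x ∂μ)
  have h1 : G + U = W := by
    refine tendsto_nhds_unique ?_ (hw.comp hφ.tendsto_atTop)
    have := hG.add (hu.comp hφ.tendsto_atTop)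
    refine this.congr fun j => ?_
    simp [← hsum]
  rw [← h1]
  gcongr
  calc ∫⁻ x, g' x ∂μ = ∫⁻ x, liminf (fun j => g (φ j) x) atTop ∂μ := by
        refine lintegral_congr_ae ?_
        filter_upwards [hlim] with x hx
        exact (hx.comp hφ.tendsto_atTop).liminf_eq.symm
    _ ≤ liminf (fun j => ∫⁻ x, g (φ j) x ∂μ) atTop := lintegral_liminf_le' fun j => hg _
    _ = G := hG.liminf_eq

/-- `‖x + y‖^p ≤ (1 + δ) ‖x‖^p + C ‖y‖^p`. -/
theorem exists_enorm_add_rpow_le {p : ℝ} (hp : 1 ≤ p) {δ : ℝ≥0} (hδ : 0 < δ) :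
    ∃ C : ℝ≥0, 1 ≤ C ∧ ∀ x y : ℝ,
      ‖x + y‖ₑ ^ p ≤ (1 + δ : ℝ≥0) * ‖x‖ₑ ^ p + C * ‖y‖ₑ ^ p := by
  have hcont : ContinuousAt (fun w : ℝ≥0 => w ^ (1 - p)) 1 :=
    NNReal.continuousAt_rpow_const (Or.inl one_ne_zero)
  have hev : ∀ᶠ w : ℝ≥0 in 𝓝 1, w ^ (1 - p) < 1 + δ := by
    refine hcont.eventually_lt continuousAt_const ?_
    simpa using hδ
  have hev2 : ∀ᶠ w : ℝ≥0 in 𝓝[<] 1, w ^ (1 - p) < 1 + δ ∧ 0 < w ∧ w < 1 := by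
    filter_upwards [nhdsWithin_le_nhds hev, self_mem_nhdsWithin,
      nhdsWithin_le_nhds (lt_mem_nhds (zero_lt_one : (0 : ℝ≥0) < 1))] with w h1 h2 h3
    exact ⟨h1, h3, h2⟩
  have : (𝓝[<] (1 : ℝ≥0)).NeBot := nhdsLT_neBot_of_exists_lt ⟨0, zero_lt_one⟩
  obtain ⟨w, hw1, hw0, hwlt⟩ := hev2.exists
  have hv0 : 0 < 1 - w := tsub_pos_of_lt hwlt
  have hsum : w + (1 - w) = 1 := add_tsub_cancel_of_le hwlt.le
  -- Convexity is applied to `x + y = w (x/w) + (1 - w) (y/(1 - w))`, with `w < 1` so near `1` that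
  -- `w^(1-p) < 1 + δ`. The lower bound `1 ≤ C` later makes `C ‖b‖^p - ‖b‖^p` a true difference.
  refine ⟨max 1 ((1 - w) ^ (1 - p)), le_max_left _ _, fun x y => ?_⟩
  have key : ∀ w' : ℝ≥0, 0 < w' → ∀ z : ℝ≥0, w' * (w'⁻¹ * z) ^ p = w' ^ (1 - p) * z ^ p := by
    intro w' hw' z
    rw [NNReal.mul_rpow, ← mul_assoc, NNReal.rpow_sub hw'.ne', NNReal.inv_rpow]
    simp [div_eq_mul_inv]
  have main : ‖x + y‖₊ ^ p ≤ (1 + δ) * ‖x‖₊ ^ p + max 1 ((1 - w) ^ (1 - p)) * ‖y‖₊ ^ p := by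
    calc ‖x + y‖₊ ^ p ≤ (‖x‖₊ + ‖y‖₊) ^ p := by gcongr; exact nnnorm_add_le _ _
      _ = (w * (w⁻¹ * ‖x‖₊) + (1 - w) * ((1 - w)⁻¹ * ‖y‖₊)) ^ p := by
          rw [mul_inv_cancel_left₀ hw0.ne', mul_inv_cancel_left₀ hv0.ne']
      _ ≤ w * (w⁻¹ * ‖x‖₊) ^ p + (1 - w) * ((1 - w)⁻¹ * ‖y‖₊) ^ p :=
          NNReal.rpow_arith_mean_le_arith_mean2_rpow _ _ _ _ hsum hp
      _ = w ^ (1 - p) * ‖x‖₊ ^ p + (1 - w) ^ (1 - p) * ‖y‖₊ ^ p := by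
          rw [key w hw0, key _ hv0]
      _ ≤ _ := by gcongr; exact le_max_right _ _
  have h0 : 0 ≤ p := by linarith
  simp only [enorm_eq_nnnorm]
  rw [← ENNReal.coe_rpow_of_nonneg _ h0, ← ENNReal.coe_rpow_of_nonneg _ h0,
    ← ENNReal.coe_rpow_of_nonneg _ h0]
  exact_mod_cast main

theorem le_of_forall_one_add_mul_le {a b c : ℝ≥0∞} (hb : b ≠ ∞)
    (h : ∀ δ : ℝ≥0, 0 < δ → a ≤ (1 + δ : ℝ≥0) * b + c) : a ≤ b + c := by
  have ht : Tendsto (fun δ : ℝ≥0 => ((1 + δ : ℝ≥0) : ℝ≥0∞) * b + c) (𝓝[>] 0)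
      (𝓝 (((1 + 0 : ℝ≥0) : ℝ≥0∞) * b + c)) := by
    refine Tendsto.mono_left ?_ nhdsWithin_le_nhds
    refine Tendsto.add (ENNReal.Tendsto.mul_const ?_ (Or.inr hb)) tendsto_const_nhds
    exact ENNReal.tendsto_coe.2 (by
      exact (continuous_const.add continuous_id).tendsto (0 : ℝ≥0))
  have : a ≤ ((1 + 0 : ℝ≥0) : ℝ≥0∞) * b + c :=
    ge_of_tendsto ht (by filter_upwards [self_mem_nhdsWithin] with δ hδ using h δ hδ)
  simpa using this

/-- **Brezis–Lieb lemma**. -/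
theorem brezis_lieb {X : Type*} [MeasurableSpace X] {μ : Measure X} {p : ℝ} (hp : 1 ≤ p)
    {a : ℕ → X → ℝ} {b : X → ℝ} {L : ℝ≥0∞} (ha : ∀ j, Measurable (a j)) (hb : Measurable b)
    (hlim : ∀ᵐ x ∂μ, Tendsto (fun j => a j x) atTop (𝓝 (b x)))
    (hL : Tendsto (fun j => ∫⁻ x, ‖a j x‖ₑ ^ p ∂μ) atTop (𝓝 L)) (hLtop : L ≠ ∞) :
    ∫⁻ x, ‖b x‖ₑ ^ p ∂μ ≤ L ∧
    Tendsto (fun j => ∫⁻ x, ‖a j x - b x‖ₑ ^ p ∂μ) atTop (𝓝 (L - ∫⁻ x, ‖b x‖ₑ ^ p ∂μ)) := by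
  have hp0 : 0 < p := by linarith
  have hcont : Continuous fun x : ℝ => ‖x‖ₑ ^ p :=
    (ENNReal.continuous_rpow_const).comp continuous_enorm
  have hfin : ∀ x : ℝ, ‖x‖ₑ ^ p ≠ ∞ := fun x =>
    ENNReal.rpow_ne_top_of_nonneg hp0.le enorm_ne_top
  have hma : ∀ j, Measurable fun x => ‖a j x‖ₑ ^ p := fun j => hcont.measurable.comp (ha j)
  have hmb : Measurable fun x => ‖b x‖ₑ ^ p := hcont.measurable.comp hb
  have hmd : ∀ j, Measurable fun x => ‖a j x - b x‖ₑ ^ p := fun j =>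
    hcont.measurable.comp ((ha j).sub hb)
  set B := ∫⁻ x, ‖b x‖ₑ ^ p ∂μ with hB
  have hBL : B ≤ L := by
    have := lintegral_add_le_of_tendsto (μ := μ) (g := fun j x => ‖a j x‖ₑ ^ p)
      (g' := fun x => ‖b x‖ₑ ^ p) (u := fun _ => 0) (U := 0) (W := L)
      (w := fun j => ∫⁻ x, ‖a j x‖ₑ ^ p ∂μ)
      (fun j => (hma j).aemeasurable)
      (by filter_upwards [hlim] with x hx using (hcont.tendsto _).comp hx) (by simp)
      tendsto_const_nhds hL
    simpa using this
  have hBtop : B ≠ ∞ := ne_top_of_le_ne_top hLtop hBL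
  refine ⟨hBL, tendsto_of_subseq_tendsto fun ns hns => ?_⟩
  obtain ⟨d, φ, hφ, hd⟩ :=
    CompactSpace.tendsto_subseq (fun j => ∫⁻ x, ‖a (ns j) x - b x‖ₑ ^ p ∂μ)
  refine ⟨φ, ?_⟩
  have hns' : Tendsto (fun j => ns (φ j)) atTop atTop := hns.comp hφ.tendsto_atTop
  have hL' := hL.comp hns'
  suffices h : d = L - B by rw [← h]; exact hd
  -- Fatou for `(1 + δ)|a|^p + C|b|^p - |a - b|^p`, which is nonnegative and tends to `(1 + δ)|b|^p
  -- + C|b|^p`; letting `δ → 0` gives `B + d ≤ L`.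
  have hup : ∀ δ : ℝ≥0, 0 < δ → (1 + δ : ℝ≥0) * B + d ≤ (1 + δ : ℝ≥0) * L := by
    intro δ hδ
    obtain ⟨C, hC1, hC⟩ := exists_enorm_add_rpow_le hp hδ
    have := lintegral_add_le_of_tendsto (μ := μ)
      (g := fun j x => ((1 + δ : ℝ≥0) * ‖a (ns (φ j)) x‖ₑ ^ p + C * ‖b x‖ₑ ^ p)
        - ‖a (ns (φ j)) x - b x‖ₑ ^ p)
      (g' := fun x => ((1 + δ : ℝ≥0) * ‖b x‖ₑ ^ p + C * ‖b x‖ₑ ^ p))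
      (u := fun j => ∫⁻ x, ‖a (ns (φ j)) x - b x‖ₑ ^ p ∂μ) (U := d)
      (w := fun j => (1 + δ : ℝ≥0) * ∫⁻ x, ‖a (ns (φ j)) x‖ₑ ^ p ∂μ + C * B)
      (W := (1 + δ : ℝ≥0) * L + C * B)
      (fun j => ((((hma _).const_mul _).add (hmb.const_mul _)).sub (hmd _)).aemeasurable)
      ?_ ?_ hd ?_
    · rw [lintegral_add_left (hmb.const_mul _), lintegral_const_mul _ hmb,
        lintegral_const_mul _ hmb, ← hB, add_right_comm] at this
      exact (ENNReal.add_le_add_iff_right (ENNReal.mul_ne_top ENNReal.coe_ne_top hBtop)).1 this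
    · filter_upwards [hlim] with x hx
      have hx' := hx.comp hns'
      have h1 : Tendsto (fun j => ‖a (ns (φ j)) x‖ₑ ^ p) atTop (𝓝 (‖b x‖ₑ ^ p)) :=
        (hcont.tendsto _).comp hx'
      have h2 : Tendsto (fun j => ‖a (ns (φ j)) x - b x‖ₑ ^ p) atTop (𝓝 0) := by
        have := (hcont.tendsto _).comp (hx'.sub_const (b x))
        simpa [Function.comp_def, hp0] using this
      have h3 := ENNReal.Tendsto.sub ((ENNReal.Tendsto.const_mul h1
        (Or.inr (ENNReal.coe_ne_top (r := 1 + δ)))).add_const (C * ‖b x‖ₑ ^ p)) h2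
        (Or.inr ENNReal.zero_ne_top)
      simpa using h3
    · intro j
      rw [← lintegral_add_right _ (hmd _), hB, ← lintegral_const_mul _ hmb,
        ← lintegral_const_mul _ (hma _), ← lintegral_add_left ((hma _).const_mul _)]
      refine lintegral_congr fun x => tsub_add_cancel_of_le ?_
      have := hC (a (ns (φ j)) x) (- b x)
      simpa [sub_eq_add_neg] using this
    · exact (ENNReal.Tendsto.const_mul hL' (Or.inr ENNReal.coe_ne_top)).add_const _
  have hdtop : d ≠ ∞ := by
    refine ne_top_of_le_ne_top (ENNReal.mul_ne_top (ENNReal.coe_ne_top (r := 1 + 1)) hLtop)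
      (le_trans le_add_self (hup 1 one_pos))
  -- The roles of `a` and `a - b` are exchanged: `(1 + δ)|a - b|^p + C|b|^p - |a|^p` tends to `(C -
  -- 1)|b|^p`, and `δ → 0` gives `L ≤ d + B`.
  have hlow : ∀ δ : ℝ≥0, 0 < δ → L ≤ (1 + δ : ℝ≥0) * d + B := by
    intro δ hδ
    obtain ⟨C, hC1, hC⟩ := exists_enorm_add_rpow_le hp hδ
    have := lintegral_add_le_of_tendsto (μ := μ)
      (g := fun j x => ((1 + δ : ℝ≥0) * ‖a (ns (φ j)) x - b x‖ₑ ^ p + C * ‖b x‖ₑ ^ p)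
        - ‖a (ns (φ j)) x‖ₑ ^ p)
      (g' := fun x => C * ‖b x‖ₑ ^ p - ‖b x‖ₑ ^ p)
      (u := fun j => ∫⁻ x, ‖a (ns (φ j)) x‖ₑ ^ p ∂μ) (U := L)
      (w := fun j => (1 + δ : ℝ≥0) * ∫⁻ x, ‖a (ns (φ j)) x - b x‖ₑ ^ p ∂μ + C * B)
      (W := (1 + δ : ℝ≥0) * d + C * B)
      (fun j => ((((hmd _).const_mul _).add (hmb.const_mul _)).sub (hma _)).aemeasurable)
      ?_ ?_ hL' ?_
    · have h4 : ∫⁻ x, (C * ‖b x‖ₑ ^ p - ‖b x‖ₑ ^ p) ∂μ + B = C * B := by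
        rw [hB, ← lintegral_add_right _ hmb, ← lintegral_const_mul _ hmb]
        refine lintegral_congr fun x => tsub_add_cancel_of_le ?_
        exact le_mul_of_one_le_left (by simp) (by exact_mod_cast hC1)
      have h5 : C * B + L ≤ C * B + ((1 + δ : ℝ≥0) * d + B) := by
        calc C * B + L = (∫⁻ x, (C * ‖b x‖ₑ ^ p - ‖b x‖ₑ ^ p) ∂μ + L) + B := by
              rw [← h4]; ring
          _ ≤ ((1 + δ : ℝ≥0) * d + C * B) + B := by gcongr
          _ = _ := by ring
      exact (ENNReal.add_le_add_iff_left (ENNReal.mul_ne_top ENNReal.coe_ne_top hBtop)).1 h5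
    · filter_upwards [hlim] with x hx
      have hx' := hx.comp hns'
      have h1 : Tendsto (fun j => ‖a (ns (φ j)) x‖ₑ ^ p) atTop (𝓝 (‖b x‖ₑ ^ p)) :=
        (hcont.tendsto _).comp hx'
      have h2 : Tendsto (fun j => ‖a (ns (φ j)) x - b x‖ₑ ^ p) atTop (𝓝 0) := by
        have := (hcont.tendsto _).comp (hx'.sub_const (b x))
        simpa [Function.comp_def, hp0] using this
      have h3 := ENNReal.Tendsto.sub ((ENNReal.Tendsto.const_mul h2
        (Or.inr (ENNReal.coe_ne_top (r := 1 + δ)))).add_const (C * ‖b x‖ₑ ^ p)) h1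
        (Or.inr (hfin _))
      simpa using h3
    · intro j
      rw [← lintegral_add_right _ (hma _), hB, ← lintegral_const_mul _ hmb,
        ← lintegral_const_mul _ (hmd _), ← lintegral_add_left ((hmd _).const_mul _)]
      refine lintegral_congr fun x => tsub_add_cancel_of_le ?_
      have := hC (a (ns (φ j)) x - b x) (b x)
      simpa using this
    · exact (ENNReal.Tendsto.const_mul hd (Or.inr ENNReal.coe_ne_top)).add_const _
  have h1 : L ≤ d + B := le_of_forall_one_add_mul_le hdtop hlow
  have h2 : B + d ≤ L := by
    have := le_of_forall_one_add_mul_le (a := B + d) (b := L) (c := 0) hLtop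
      (fun δ hδ => by
        refine le_trans ?_ ((hup δ hδ).trans (by simp))
        gcongr
        exact le_mul_of_one_le_left (by simp) (by exact_mod_cast (by simp : (1 : ℝ≥0) ≤ 1 + δ)))
    simpa using this
  refine ENNReal.eq_sub_of_add_eq hBtop (le_antisymm ?_ h1)
  rwa [add_comm]

/-! ### Averages over cells and the fractional Poincaré inequality -/

/-- The quadratic form `∬ k(t - s) |f(t) - f(s)|² dt ds`. -/
def gagliardo (k : ℝ → ℝ≥0∞) (f : ℝ → ℝ) : ℝ≥0∞ :=
  ∫⁻ q : ℝ × ℝ, k (q.1 - q.2) * ‖f q.1 - f q.2‖ₑ ^ (2 : ℝ)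

/-- `k` is at least as singular at the origin as `c |τ|^{-1-2γ}`. -/
def IsSingular (k : ℝ → ℝ≥0∞) (γ : ℝ) (c : ℝ≥0∞) : Prop :=
  ∀ h : ℝ, 0 < h → h ≤ 1 → ∀ τ : ℝ, τ ≠ 0 → |τ| ≤ h → c * ENNReal.ofReal (h ^ (-(1 + 2 * γ))) ≤ k τ

/-- The cells `[i/N, (i+1)/N)`. -/
def cell (N : ℝ) (i : ℤ) : Set ℝ := {s | ⌊N * s⌋ = i}

/-- The average of `f` over the cell of mesh `1/N` that contains `t`. -/
def cellAvg (N : ℝ) (f : ℝ → ℝ) (t : ℝ) : ℝ := N * ∫ s in cell N ⌊N * t⌋, f s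

theorem cell_eq_Ico {N : ℝ} (hN : 0 < N) (i : ℤ) : cell N i = Set.Ico (i / N) ((i + 1) / N) := by
  ext s
  simp only [cell, Set.mem_ofPred_eq, Int.floor_eq_iff, Set.mem_Ico, div_le_iff₀ hN, lt_div_iff₀ hN,
    mul_comm]

theorem measurableSet_cell (N : ℝ) (i : ℤ) : MeasurableSet (cell N i) :=
  (Int.measurable_floor.comp (measurable_const_mul N)) (measurableSet_singleton i)

theorem volume_cell {N : ℝ} (hN : 0 < N) (i : ℤ) : volume (cell N i) = (ENNReal.ofReal N)⁻¹ := by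
  rw [cell_eq_Ico hN, Real.volume_Ico, ← ENNReal.ofReal_inv_of_pos hN]
  congr 1
  field_simp
  ring

theorem mem_cell_comm {N : ℝ} {s t : ℝ} : s ∈ cell N ⌊N * t⌋ ↔ t ∈ cell N ⌊N * s⌋ := by
  simp [cell, eq_comm]

theorem measurable_cellAvg (N : ℝ) (f : ℝ → ℝ) : Measurable (cellAvg N f) :=
  (measurable_from_top (f := fun i : ℤ => N * ∫ s in cell N i, f s)).comp
    (Int.measurable_floor.comp (measurable_const_mul N))

/-- The Cauchy–Schwarz inequality against the constant function `1`. -/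
theorem enorm_integral_rpow_two_le {X : Type*} [MeasurableSpace X] (μ : Measure X) {g : X → ℝ}
    (hg : AEMeasurable g μ) :
    ‖∫ x, g x ∂μ‖ₑ ^ (2 : ℝ) ≤ μ Set.univ * ∫⁻ x, ‖g x‖ₑ ^ (2 : ℝ) ∂μ := by
  have h1 := ENNReal.lintegral_mul_le_Lp_mul_Lq μ Real.HolderConjugate.two_two
    (f := fun _ => 1) (g := fun x => ‖g x‖ₑ) aemeasurable_const hg.enorm
  simp only [Pi.mul_apply, one_mul, ENNReal.one_rpow, lintegral_const] at h1
  calc ‖∫ x, g x ∂μ‖ₑ ^ (2 : ℝ) ≤ (∫⁻ x, ‖g x‖ₑ ∂μ) ^ (2 : ℝ) := by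
        gcongr; exact enorm_integral_le_lintegral_enorm _
    _ ≤ (μ Set.univ ^ (1 / 2 : ℝ) * (∫⁻ x, ‖g x‖ₑ ^ (2 : ℝ) ∂μ) ^ (1 / 2 : ℝ)) ^ (2 : ℝ) := by
        gcongr
    _ = _ := by
        rw [ENNReal.mul_rpow_of_nonneg _ _ (by norm_num), ← ENNReal.rpow_mul, ← ENNReal.rpow_mul]
        norm_num

/-- Cauchy–Schwarz on a cell of length `1/N`: the factor `N²` from the average meets the factor
`1/N` from the length. -/
theorem enorm_cellAvg_rpow_two_le {N : ℝ} (hN : 0 < N) {g : ℝ → ℝ} (hg : Measurable g) (t : ℝ) :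
    ‖cellAvg N g t‖ₑ ^ (2 : ℝ) ≤
      ENNReal.ofReal N * ∫⁻ s in cell N ⌊N * t⌋, ‖g s‖ₑ ^ (2 : ℝ) := by
  have hN' : ENNReal.ofReal N ≠ 0 := by simpa using hN
  have h := enorm_integral_rpow_two_le (volume.restrict (cell N ⌊N * t⌋)) hg.aemeasurable
  rw [Measure.restrict_apply_univ, volume_cell hN] at h
  rw [cellAvg, enorm_mul, ENNReal.mul_rpow_of_nonneg _ _ (by norm_num), Real.enorm_of_nonneg hN.le]
  calc _ ≤ ENNReal.ofReal N ^ (2 : ℝ) * ((ENNReal.ofReal N)⁻¹ *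
        ∫⁻ s in cell N ⌊N * t⌋, ‖g s‖ₑ ^ (2 : ℝ)) := by gcongr
    _ = _ := by
        rw [← mul_assoc]
        congr 1
        rw [ENNReal.rpow_two, sq, mul_assoc, ENNReal.mul_inv_cancel hN' ENNReal.ofReal_ne_top, mul_one]

theorem integrableOn_cell {N : ℝ} (hN : 0 < N) {f : ℝ → ℝ} (hf : Measurable f)
    (hf2 : ∫⁻ t, ‖f t‖ₑ ^ (2 : ℝ) ≠ ∞) (i : ℤ) : IntegrableOn f (cell N i) := by
  have hm : MemLp f 2 volume := by
    refine ⟨hf.aestronglyMeasurable, ?_⟩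
    rw [eLpNorm_eq_lintegral_rpow_enorm_toReal (by norm_num) (by norm_num)]
    exact ENNReal.rpow_lt_top_of_nonneg (by norm_num) (by simpa using hf2)
  have : IsFiniteMeasure (volume.restrict (cell N i)) := ⟨by
    rw [Measure.restrict_apply_univ, volume_cell hN]; simpa using hN⟩
  exact (hm.restrict _).integrable (by norm_num)

theorem cellAvg_const_sub {N : ℝ} (hN : 0 < N) {f : ℝ → ℝ} (hf : Measurable f)
    (hf2 : ∫⁻ t, ‖f t‖ₑ ^ (2 : ℝ) ≠ ∞) (a t : ℝ) :
    cellAvg N (fun s => a - f s) t = a - cellAvg N f t := by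
  have hv : volume.real (cell N ⌊N * t⌋) = N⁻¹ := by
    rw [measureReal_def, volume_cell hN, ← ENNReal.ofReal_inv_of_pos hN,
      ENNReal.toReal_ofReal (by positivity)]
  have hc : IntegrableOn (fun _ => a) (cell N ⌊N * t⌋) := by
    refine integrableOn_const ?_
    rw [volume_cell hN]; simpa using hN
  unfold cellAvg
  rw [integral_sub hc (integrableOn_cell hN hf hf2 _), mul_sub, setIntegral_const, hv]
  simp [hN.ne']

/-- The Poincaré inequality summed over the cells of mesh `1/N`. -/
theorem lintegral_sub_cellAvg_le {k : ℝ → ℝ≥0∞} {γ : ℝ} {c : ℝ≥0∞} (hk : IsSingular k γ c)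
    (hkm : Measurable k) {N : ℝ} (hN : 1 ≤ N) {f : ℝ → ℝ} (hf : Measurable f)
    (hf2 : ∫⁻ t, ‖f t‖ₑ ^ (2 : ℝ) ≠ ∞) :
    c * ∫⁻ t, ‖f t - cellAvg N f t‖ₑ ^ (2 : ℝ) ≤
      ENNReal.ofReal (N ^ (-(2 * γ))) * gagliardo k f := by
  have hN0 : 0 < N := by linarith
  have hN' : ENNReal.ofReal N ≠ 0 := by simpa using hN0
  have hmeas : Measurable fun q : ℝ × ℝ => k (q.1 - q.2) * ‖f q.1 - f q.2‖ₑ ^ (2 : ℝ) := by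
    fun_prop
  have hpt : ∀ t, c * ‖f t - cellAvg N f t‖ₑ ^ (2 : ℝ) ≤
      ENNReal.ofReal (N ^ (-(2 * γ))) * ∫⁻ s, k (t - s) * ‖f t - f s‖ₑ ^ (2 : ℝ) := by
    intro t
    rw [← cellAvg_const_sub hN0 hf hf2]
    have h1 := enorm_cellAvg_rpow_two_le hN0 (g := fun s => f t - f s) (hf.const_sub _) t
    -- Two points of one cell are less than `1/N` apart, where `k` is at least `c N^(1+2γ)`. Taking
    -- this factor out of the averaging factor `N` leaves `N^(-2γ)`.
    have hpow : ENNReal.ofReal N = ENNReal.ofReal (N ^ (-(2 * γ))) *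
        ENNReal.ofReal (N⁻¹ ^ (-(1 + 2 * γ))) := by
      rw [← ENNReal.ofReal_mul (by positivity), Real.inv_rpow hN0.le, Real.rpow_neg hN0.le (1 + _),
        inv_inv, ← Real.rpow_add hN0]
      norm_num
    calc c * ‖cellAvg N (fun s => f t - f s) t‖ₑ ^ (2 : ℝ)
        ≤ c * (ENNReal.ofReal N * ∫⁻ s in cell N ⌊N * t⌋, ‖f t - f s‖ₑ ^ (2 : ℝ)) := by gcongr
      _ = ENNReal.ofReal (N ^ (-(2 * γ))) * ∫⁻ s in cell N ⌊N * t⌋,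
            c * ENNReal.ofReal (N⁻¹ ^ (-(1 + 2 * γ))) * ‖f t - f s‖ₑ ^ (2 : ℝ) := by
          rw [lintegral_const_mul _ (by fun_prop), hpow]
          ring
      _ ≤ ENNReal.ofReal (N ^ (-(2 * γ))) * ∫⁻ s in cell N ⌊N * t⌋,
            k (t - s) * ‖f t - f s‖ₑ ^ (2 : ℝ) := by
          refine mul_le_mul_right ?_ _
          refine setLIntegral_mono' (measurableSet_cell _ _) fun s hs => ?_
          rcases eq_or_ne s t with rfl | hst
          · simp
          · gcongr
            refine hk _ (by positivity) (inv_le_one_of_one_le₀ hN) _ (sub_ne_zero.2 hst.symm) ?_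
            have hs' : ⌊N * s⌋ = ⌊N * t⌋ := hs
            have h2 := Int.abs_sub_lt_one_of_floor_eq_floor hs'
            rw [← mul_sub, abs_mul, abs_of_pos hN0] at h2
            rw [abs_sub_comm, ← one_div, le_div_iff₀ hN0]
            linarith
      _ ≤ _ := mul_le_mul_right (setLIntegral_le_lintegral _ _) _
  rw [gagliardo, Measure.volume_eq_prod, lintegral_prod _ hmeas.aemeasurable,
    ← lintegral_const_mul _ hmeas.lintegral_prod_right',
    ← lintegral_const_mul _ (by have := measurable_cellAvg N f; fun_prop)]
  exact lintegral_mono hpt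

/-- Lying in a common cell is a symmetric relation, so after Tonelli each `s` is counted over the
`t` of its own cell, whose length `1/N` cancels `N`. -/
theorem lintegral_lintegral_cell {N : ℝ} (hN : 0 < N) {g : ℝ → ℝ≥0∞} (hg : Measurable g) :
    ∫⁻ t, ENNReal.ofReal N * ∫⁻ s in cell N ⌊N * t⌋, g s = ∫⁻ s, g s := by
  have hN' : ENNReal.ofReal N ≠ 0 := by simpa using hN
  have hset : MeasurableSet {q : ℝ × ℝ | ⌊N * q.2⌋ = ⌊N * q.1⌋} :=
    measurableSet_eq_fun (by fun_prop) (by fun_prop)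
  have hmeas : Measurable fun q : ℝ × ℝ => (cell N ⌊N * q.1⌋).indicator g q.2 := by
    have : (fun q : ℝ × ℝ => (cell N ⌊N * q.1⌋).indicator g q.2) =
        {q : ℝ × ℝ | ⌊N * q.2⌋ = ⌊N * q.1⌋}.indicator fun q => g q.2 := by
      ext q; classical simp only [Set.indicator, cell, Set.mem_ofPred_eq]; congr
    rw [this]
    exact (hg.comp measurable_snd).indicator hset
  simp_rw [← lintegral_indicator (measurableSet_cell _ _)]
  rw [lintegral_const_mul _ hmeas.lintegral_prod_right', lintegral_lintegral_swap hmeas.aemeasurable]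
  have : ∀ s, ∫⁻ t, (cell N ⌊N * t⌋).indicator g s = (ENNReal.ofReal N)⁻¹ * g s := by
    intro s
    rw [← volume_cell hN ⌊N * s⌋, mul_comm, ← setLIntegral_const,
      ← lintegral_indicator (measurableSet_cell _ _)]
    refine lintegral_congr fun t => ?_
    classical simp only [Set.indicator, mem_cell_comm (s := s) (t := t)]
  simp_rw [this]
  rw [lintegral_const_mul _ hg, ← mul_assoc, ENNReal.mul_inv_cancel hN' ENNReal.ofReal_ne_top,
    one_mul]

theorem lintegral_cellAvg_le {N : ℝ} (hN : 0 < N) {g : ℝ → ℝ} (hg : Measurable g) :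
    ∫⁻ t, ‖cellAvg N g t‖ₑ ^ (2 : ℝ) ≤ ∫⁻ t, ‖g t‖ₑ ^ (2 : ℝ) := by
  rw [← lintegral_lintegral_cell hN (g := fun t => ‖g t‖ₑ ^ (2 : ℝ)) (by fun_prop)]
  exact lintegral_mono fun t => enorm_cellAvg_rpow_two_le hN hg t

/-- Dyadic meshes are nested: the coarse index is the integer quotient of the fine index by `2 ^ (l
- m)`. -/
theorem cell_two_pow_subset {m l : ℕ} (hml : m ≤ l) (t : ℝ) :
    cell (2 ^ l) ⌊(2 : ℝ) ^ l * t⌋ ⊆ cell (2 ^ m) ⌊(2 : ℝ) ^ m * t⌋ := by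
  obtain ⟨j, rfl⟩ := Nat.exists_eq_add_of_le hml
  have key : ∀ s : ℝ, ⌊(2 : ℝ) ^ m * s⌋ = ⌊(2 : ℝ) ^ (m + j) * s⌋ / ((2 ^ j : ℕ) : ℤ) := by
    intro s
    rw [← Int.floor_div_natCast]
    congr 1
    push_cast
    rw [pow_add]
    field_simp
  intro s hs
  have hs' : ⌊(2 : ℝ) ^ (m + j) * s⌋ = ⌊(2 : ℝ) ^ (m + j) * t⌋ := hs
  change ⌊(2 : ℝ) ^ m * s⌋ = ⌊(2 : ℝ) ^ m * t⌋
  rw [key, key, hs']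

/-- Averages over finer cells of the oscillation on the coarser cells. -/
theorem cellAvg_sub_cellAvg {m l : ℕ} (hml : m ≤ l) {f : ℝ → ℝ} (hf : Measurable f)
    (hf2 : ∫⁻ t, ‖f t‖ₑ ^ (2 : ℝ) ≠ ∞) (t : ℝ) :
    cellAvg (2 ^ l) (fun s => f s - cellAvg (2 ^ m) f s) t =
      cellAvg (2 ^ l) f t - cellAvg (2 ^ m) f t := by
  have h1 : cellAvg (2 ^ l) (fun s => f s - cellAvg (2 ^ m) f s) t =
      cellAvg (2 ^ l) (fun s => f s - cellAvg (2 ^ m) f t) t := by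
    unfold cellAvg
    congr 1
    refine setIntegral_congr_fun (measurableSet_cell _ _) fun s hs => ?_
    have : ⌊(2 : ℝ) ^ m * s⌋ = ⌊(2 : ℝ) ^ m * t⌋ := cell_two_pow_subset hml t hs
    simp only [this]
  have h2 := cellAvg_const_sub (N := 2 ^ l) (by positivity) hf hf2 (cellAvg (2 ^ m) f t) t
  have h3 : ∀ g : ℝ → ℝ, cellAvg (2 ^ l) (fun s => - g s) t = - cellAvg (2 ^ l) g t := by
    intro g
    simp [cellAvg, integral_neg]
  rw [h1, ← neg_sub (cellAvg (2 ^ m) f t), ← h2, ← h3]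
  simp

/-! ### The subcritical Sobolev inequality by dyadic chaining -/

section

/-- Interpolation between `L^∞` and `L²`: `|g|^p = |g|^(p-2) |g|²`, with the first factor at most
`A^((p-2)/2)`. -/
theorem lintegral_rpow_le_of_sup_le {X : Type*} [MeasurableSpace X] {μ : Measure X} {g : X → ℝ}
    {p : ℝ} (hp : 2 < p) {A B : ℝ≥0∞} (hA : ∀ x, ‖g x‖ₑ ^ (2 : ℝ) ≤ A)
    (hg : AEMeasurable g μ) (hB : ∫⁻ x, ‖g x‖ₑ ^ (2 : ℝ) ∂μ ≤ B) :
    ∫⁻ x, ‖g x‖ₑ ^ p ∂μ ≤ A ^ ((p - 2) / 2) * B := by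
  calc ∫⁻ x, ‖g x‖ₑ ^ p ∂μ ≤ ∫⁻ x, A ^ ((p - 2) / 2) * ‖g x‖ₑ ^ (2 : ℝ) ∂μ := by
        refine lintegral_mono fun x => ?_
        have : ‖g x‖ₑ ^ p = (‖g x‖ₑ ^ (2 : ℝ)) ^ ((p - 2) / 2) * ‖g x‖ₑ ^ (2 : ℝ) := by
          rw [← ENNReal.rpow_mul, ← ENNReal.rpow_add_of_nonneg _ _ (by linarith) (by norm_num)]
          congr 1; ring
        simp only [this]
        gcongr
        exact hA x
    _ = A ^ ((p - 2) / 2) * ∫⁻ x, ‖g x‖ₑ ^ (2 : ℝ) ∂μ :=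
        lintegral_const_mul'' _ (hg.enorm.pow_const _)
    _ ≤ _ := by gcongr

theorem ofReal_two_pow_rpow (m : ℕ) (x : ℝ) :
    ENNReal.ofReal (((2 : ℝ) ^ m) ^ x) = (2 : ℝ≥0∞) ^ (m * x) := by
  rw [← ENNReal.ofReal_rpow_of_pos (by positivity), ENNReal.ofReal_pow (by norm_num),
    ← ENNReal.rpow_natCast, ← ENNReal.rpow_mul]
  simp

variable {k : ℝ → ℝ≥0∞} {γ : ℝ} {c : ℝ≥0∞}

theorem lintegral_sub_cellAvg_two_pow_le (hk : IsSingular k γ c) (hc0 : c ≠ 0) (hc : c ≠ ∞)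
    (hkm : Measurable k) {f : ℝ → ℝ} (hf : Measurable f)
    (hf2 : ∫⁻ t, ‖f t‖ₑ ^ (2 : ℝ) ≠ ∞) (m : ℕ) :
    ∫⁻ t, ‖f t - cellAvg (2 ^ m) f t‖ₑ ^ (2 : ℝ) ≤
      (2 : ℝ≥0∞) ^ (m * (-(2 * γ))) * (c⁻¹ * gagliardo k f) := by
  have h := lintegral_sub_cellAvg_le hk hkm (N := 2 ^ m) (one_le_pow₀ (by norm_num)) hf hf2
  rw [ofReal_two_pow_rpow] at h
  rw [mul_left_comm, ← ENNReal.div_eq_inv_mul, ENNReal.le_div_iff_mul_le (Or.inl hc0) (Or.inl hc),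
    mul_comm]
  exact h

/-- The increment is the fine average of the oscillation on coarse cells. By Poincaré its `L²` norm
is of order `2^(-mγ)`; its supremum is larger by a factor `2^((m+1)/2)` at most. Interpolation gives
the rate `2^(m(1/2 - 1/p - γ))`, which decays exactly in the subcritical range. -/
theorem eLpNorm'_cellAvg_succ_sub_le (hk : IsSingular k γ c) (hc0 : c ≠ 0) (hc : c ≠ ∞)
    (hkm : Measurable k) {f : ℝ → ℝ} (hf : Measurable f)
    (hf2 : ∫⁻ t, ‖f t‖ₑ ^ (2 : ℝ) ≠ ∞) {p : ℝ} (hp : 2 < p) (m : ℕ) :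
    eLpNorm' (fun t => cellAvg (2 ^ (m + 1)) f t - cellAvg (2 ^ m) f t) p volume ≤
      2 ^ (1 / 2 - 1 / p) * ((2 : ℝ≥0∞) ^ (1 / 2 - 1 / p - γ)) ^ m *
        (c⁻¹ * gagliardo k f) ^ (1 / 2 : ℝ) := by
  set R := c⁻¹ * gagliardo k f with hR
  have hp0 : 0 < p := by linarith
  have hmc := measurable_cellAvg (2 ^ m) f
  have hfm : Measurable fun s => f s - cellAvg (2 ^ m) f s := hf.sub hmc
  have h0 := lintegral_sub_cellAvg_two_pow_le hk hc0 hc hkm hf hf2 m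
  rw [← hR] at h0
  have hN : (0 : ℝ) < 2 ^ (m + 1) := by positivity
  have hN' : ENNReal.ofReal (2 ^ (m + 1)) = (2 : ℝ≥0∞) ^ ((m : ℝ) + 1) := by
    have := ofReal_two_pow_rpow (m + 1) 1
    simpa using this
  simp_rw [← cellAvg_sub_cellAvg (Nat.le_succ m) hf hf2]
  set D := cellAvg (2 ^ (m + 1)) (fun s => f s - cellAvg (2 ^ m) f s) with hD
  have hA : ∀ t, ‖D t‖ₑ ^ (2 : ℝ) ≤
      (2 : ℝ≥0∞) ^ ((m : ℝ) + 1) * (2 ^ (m * (-(2 * γ))) * R) := by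
    intro t
    refine (enorm_cellAvg_rpow_two_le hN hfm t).trans ?_
    rw [hN']
    gcongr
    exact (setLIntegral_le_lintegral _ _).trans h0
  have hB : ∫⁻ t, ‖D t‖ₑ ^ (2 : ℝ) ≤ 2 ^ (m * (-(2 * γ))) * R :=
    (lintegral_cellAvg_le hN hfm).trans h0
  have h1 := lintegral_rpow_le_of_sup_le hp hA (measurable_cellAvg _ _).aemeasurable hB
  have h20 : (2 : ℝ≥0∞) ≠ 0 := by norm_num
  have h2t : (2 : ℝ≥0∞) ≠ ∞ := by norm_num
  rw [eLpNorm']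
  calc _ ≤ (((2 : ℝ≥0∞) ^ ((m : ℝ) + 1) * (2 ^ (m * (-(2 * γ))) * R)) ^ ((p - 2) / 2) *
        (2 ^ (m * (-(2 * γ))) * R)) ^ (1 / p) := by gcongr
    _ = (2 ^ (((m : ℝ) + 1) * (1 / 2 - 1 / p)) * 2 ^ (-(m * γ))) * R ^ (1 / 2 : ℝ) := by
      have hp2 : 0 ≤ (p - 2) / 2 := by linarith
      have hp1 : 0 ≤ 1 / p := by positivity
      have e1 : ∀ x y z : ℝ≥0∞, (x * (y * z)) ^ ((p - 2) / 2) * (y * z) =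
          x ^ ((p - 2) / 2) * ((y ^ (p / 2)) * (z ^ (p / 2))) := by
        intro x y z
        rw [ENNReal.mul_rpow_of_nonneg _ _ hp2, mul_assoc]
        congr 1
        rw [← ENNReal.mul_rpow_of_nonneg _ _ (by positivity)]
        have : p / 2 = (p - 2) / 2 + 1 := by ring
        rw [this, ENNReal.rpow_add_of_nonneg _ _ hp2 (by norm_num), ENNReal.rpow_one]
      rw [e1, ENNReal.mul_rpow_of_nonneg _ _ hp1, ENNReal.mul_rpow_of_nonneg _ _ hp1, ← mul_assoc]
      simp_rw [← ENNReal.rpow_mul]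
      refine congrArg₂ (· * ·) (congrArg₂ (· * ·) ?_ ?_) ?_ <;> congr 1 <;> field_simp
    _ = _ := by
      congr 1
      rw [← ENNReal.rpow_natCast, ← ENNReal.rpow_mul, ← ENNReal.rpow_add _ _ h20 h2t,
        ← ENNReal.rpow_add _ _ h20 h2t]
      congr 1
      ring

/-- Minkowski's inequality on the telescoping sum, then the full geometric series. In `ℝ≥0∞` the
factor `(1 - r)⁻¹` is `∞` for `r ≥ 1`, so the summation is valid for every ratio. -/
theorem eLpNorm'_cellAvg_add_sub_le (hk : IsSingular k γ c) (hc0 : c ≠ 0) (hc : c ≠ ∞)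
    (hkm : Measurable k) {f : ℝ → ℝ} (hf : Measurable f)
    (hf2 : ∫⁻ t, ‖f t‖ₑ ^ (2 : ℝ) ≠ ∞) {p : ℝ} (hp : 2 < p) (m j : ℕ) :
    eLpNorm' (fun t => cellAvg (2 ^ (m + j)) f t - cellAvg (2 ^ m) f t) p volume ≤
      2 ^ (1 / 2 - 1 / p) * ((2 : ℝ≥0∞) ^ (1 / 2 - 1 / p - γ)) ^ m *
        (1 - (2 : ℝ≥0∞) ^ (1 / 2 - 1 / p - γ))⁻¹ * (c⁻¹ * gagliardo k f) ^ (1 / 2 : ℝ) := by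
  set R := c⁻¹ * gagliardo k f
  set r := (2 : ℝ≥0∞) ^ (1 / 2 - 1 / p - γ) with hr
  have hp0 : 0 < p := by linarith
  have h : eLpNorm' (fun t => cellAvg (2 ^ (m + j)) f t - cellAvg (2 ^ m) f t) p volume ≤
      ∑ i ∈ Finset.range j, 2 ^ (1 / 2 - 1 / p) * r ^ (m + i) * R ^ (1 / 2 : ℝ) := by
    induction j with
    | zero => simp [eLpNorm', hp0]
    | succ j ih =>
      rw [Finset.sum_range_succ]
      have e : (fun t => cellAvg (2 ^ (m + (j + 1))) f t - cellAvg (2 ^ m) f t) =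
          (fun t => cellAvg (2 ^ (m + j)) f t - cellAvg (2 ^ m) f t) +
          (fun t => cellAvg (2 ^ (m + j + 1)) f t - cellAvg (2 ^ (m + j)) f t) := by
        ext t; simp [add_assoc]
      rw [e]
      refine (eLpNorm'_add_le ?_ ?_ (by linarith)).trans (add_le_add ih
        (eLpNorm'_cellAvg_succ_sub_le hk hc0 hc hkm hf hf2 hp (m + j))) <;>
      exact ((measurable_cellAvg _ _).sub (measurable_cellAvg _ _)).aestronglyMeasurable
  refine h.trans ?_
  have e : ∀ i, (2 : ℝ≥0∞) ^ (1 / 2 - 1 / p) * r ^ (m + i) * R ^ (1 / 2 : ℝ) =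
      (2 ^ (1 / 2 - 1 / p) * r ^ m * R ^ (1 / 2 : ℝ)) * r ^ i := fun i => by
    rw [pow_add]; ring
  simp_rw [e]
  rw [← Finset.mul_sum, mul_right_comm _ (1 - r)⁻¹]
  gcongr
  rw [← ENNReal.tsum_geometric]
  exact ENNReal.sum_le_tsum _

theorem tendsto_two_rpow_neg {x : ℝ} (hx : 0 < x) :
    Tendsto (fun m : ℕ => (2 : ℝ≥0∞) ^ (m * (-x))) atTop (𝓝 0) := by
  have h1 : (2 : ℝ≥0∞) ^ (-x) < 1 := ENNReal.rpow_lt_one_of_one_lt_of_neg (by norm_num) (by linarith)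
  refine (ENNReal.tendsto_pow_atTop_nhds_zero_of_lt_one h1).congr fun m => ?_
  rw [← ENNReal.rpow_natCast, ← ENNReal.rpow_mul, mul_comm]

theorem exists_seq_tendsto_ae_of_lintegral {X : Type*} [MeasurableSpace X] {μ : Measure X}
    {g : ℕ → X → ℝ} {f : X → ℝ} (hg : ∀ j, Measurable (g j)) (hf : Measurable f)
    (h : Tendsto (fun j => ∫⁻ x, ‖f x - g j x‖ₑ ^ (2 : ℝ) ∂μ) atTop (𝓝 0)) :
    ∃ φ : ℕ → ℕ, StrictMono φ ∧ ∀ᵐ x ∂μ, Tendsto (fun j => g (φ j) x) atTop (𝓝 (f x)) := by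
  refine TendstoInMeasure.exists_seq_tendsto_ae (tendstoInMeasure_of_tendsto_eLpNorm (p := 2)
    (by norm_num) (fun j => (hg j).aestronglyMeasurable) hf.aestronglyMeasurable ?_)
  have h2 : ∀ j, eLpNorm (g j - f) 2 μ = (∫⁻ x, ‖f x - g j x‖ₑ ^ (2 : ℝ) ∂μ) ^ (1 / 2 : ℝ) := by
    intro j
    rw [eLpNorm_eq_lintegral_rpow_enorm_toReal (by norm_num) (by norm_num)]
    simp only [ENNReal.toReal_ofNat, Pi.sub_apply]
    congr 2
    ext x
    rw [enorm_sub_rev]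
  simp_rw [h2]
  have := h.ennrpow_const (1 / 2)
  simpa using this

theorem tendsto_lintegral_sub_cellAvg (hγ : 0 < γ) (hk : IsSingular k γ c) (hc0 : c ≠ 0)
    (hc : c ≠ ∞) (hkm : Measurable k) {f : ℝ → ℝ} (hf : Measurable f)
    (hf2 : ∫⁻ t, ‖f t‖ₑ ^ (2 : ℝ) ≠ ∞) (hE : gagliardo k f ≠ ∞) :
    Tendsto (fun m : ℕ => ∫⁻ t, ‖f t - cellAvg (2 ^ m) f t‖ₑ ^ (2 : ℝ)) atTop (𝓝 0) := by
  have hR : c⁻¹ * gagliardo k f ≠ ∞ := ENNReal.mul_ne_top (by simpa using hc0) hE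
  refine tendsto_of_tendsto_of_tendsto_of_le_of_le tendsto_const_nhds ?_ (fun _ => zero_le)
    (fun m => lintegral_sub_cellAvg_two_pow_le hk hc0 hc hkm hf hf2 m)
  have := ENNReal.Tendsto.mul_const (tendsto_two_rpow_neg (x := 2 * γ) (by linarith))
    (Or.inr hR)
  simpa using this

/-- The fractional Sobolev inequality for the oscillation on cells, in the subcritical range. -/
theorem eLpNorm'_sub_cellAvg_le (hγ : 0 < γ) (hk : IsSingular k γ c) (hc0 : c ≠ 0) (hc : c ≠ ∞)
    (hkm : Measurable k) {f : ℝ → ℝ} (hf : Measurable f)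
    (hf2 : ∫⁻ t, ‖f t‖ₑ ^ (2 : ℝ) ≠ ∞) (hE : gagliardo k f ≠ ∞) {p : ℝ} (hp : 2 < p) (m : ℕ) :
    eLpNorm' (fun t => f t - cellAvg (2 ^ m) f t) p volume ≤
      2 ^ (1 / 2 - 1 / p) * ((2 : ℝ≥0∞) ^ (1 / 2 - 1 / p - γ)) ^ m *
        (1 - (2 : ℝ≥0∞) ^ (1 / 2 - 1 / p - γ))⁻¹ * (c⁻¹ * gagliardo k f) ^ (1 / 2 : ℝ) := by
  -- The bound on differences of averages is uniform in the finer scale. The averages converge to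
  -- `f` in `L²`, hence almost everywhere along a subsequence, and lower semicontinuity of the `L^p`
  -- norm passes to the limit.
  obtain ⟨φ, hφ, hae⟩ := exists_seq_tendsto_ae_of_lintegral
    (fun m : ℕ => measurable_cellAvg (2 ^ m) f) hf
    (tendsto_lintegral_sub_cellAvg hγ hk hc0 hc hkm hf hf2 hE)
  have hφm : ∀ j, m ≤ φ (m + j) := fun j => (Nat.le_add_right m j).trans (hφ.id_le _)
  refine (Lp.eLpNorm'_lim_le_liminf_eLpNorm' (f := fun j t =>
    cellAvg (2 ^ φ (m + j)) f t - cellAvg (2 ^ m) f t) (by linarith) (fun j =>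
    ((measurable_cellAvg _ _).sub (measurable_cellAvg _ _)).aestronglyMeasurable) ?_).trans ?_
  · filter_upwards [hae] with t ht
    have : Tendsto (fun j => m + j) atTop atTop :=
      tendsto_atTop_mono (fun j => Nat.le_add_left j m) tendsto_id
    exact (ht.comp this).sub_const _
  · refine liminf_le_of_frequently_le' (Frequently.of_forall fun j => ?_)
    obtain ⟨i, hi⟩ := Nat.exists_eq_add_of_le (hφm j)
    rw [hi]
    exact eLpNorm'_cellAvg_add_sub_le hk hc0 hc hkm hf hf2 hp m i

/-- The cell averages are controlled by the largest local mass. -/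
theorem lintegral_cellAvg_rpow_le {f : ℝ → ℝ} (hf : Measurable f) {p : ℝ} (hp : 2 < p) {S : ℝ≥0∞}
    (hS : ∀ i : ℤ, ∫⁻ t in cell 1 i, ‖f t‖ₑ ^ (2 : ℝ) ≤ S) (m : ℕ) :
    ∫⁻ t, ‖cellAvg (2 ^ m) f t‖ₑ ^ p ≤
      (2 ^ m * S) ^ ((p - 2) / 2) * ∫⁻ t, ‖f t‖ₑ ^ (2 : ℝ) := by
  have hN : (0 : ℝ) < 2 ^ m := by positivity
  refine lintegral_rpow_le_of_sup_le hp (fun t => ?_) (measurable_cellAvg _ _).aemeasurable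
    (lintegral_cellAvg_le hN hf)
  refine (enorm_cellAvg_rpow_two_le hN hf t).trans ?_
  rw [ENNReal.ofReal_pow (by norm_num), ENNReal.ofReal_ofNat]
  gcongr
  refine (lintegral_mono_set ?_).trans (hS ⌊t⌋)
  have := cell_two_pow_subset (Nat.zero_le m) t
  simpa using this

end

/-! ### Local compactness of sequences of bounded energy -/

section

/-- The standard Gaussian serves as a finite measure below Lebesgue measure with the same null sets:
convergence in its `L²` space replaces local `L²` convergence, and constants are integrable
dominating functions. -/
theorem gaussianReal_le_volume : gaussianReal 0 1 ≤ volume := by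
  rw [gaussianReal_of_var_ne_zero _ one_ne_zero]
  calc volume.withDensity (gaussianPDF 0 1) ≤ volume.withDensity 1 := by
        refine withDensity_mono (Eventually.of_forall fun x => ?_)
        simp only [gaussianPDF, Pi.one_apply, ENNReal.ofReal_le_one, gaussianPDFReal]
        refine mul_le_one₀ (inv_le_one_of_one_le₀ ?_) (Real.exp_pos _).le (Real.exp_le_one_iff.2 ?_)
        · rw [Real.one_le_sqrt]
          simp only [NNReal.coe_one, mul_one]
          nlinarith [Real.pi_gt_three]
        · have : 0 ≤ (x - 0) ^ 2 / (2 * ((1 : ℝ≥0) : ℝ)) := by positivity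
          rw [neg_div]
          linarith
    _ = volume := withDensity_one

variable {k : ℝ → ℝ≥0∞} {γ : ℝ} {c : ℝ≥0∞}

theorem abs_le_toReal_of_enorm_rpow_two_le {x : ℝ} {A : ℝ≥0∞} (hA : A ≠ ∞)
    (h : ‖x‖ₑ ^ (2 : ℝ) ≤ A) : |x| ≤ (A ^ (1 / 2 : ℝ)).toReal := by
  have h1 : ‖x‖ₑ ≤ A ^ (1 / 2 : ℝ) := by
    have := ENNReal.rpow_le_rpow h (z := 1 / 2) (by norm_num)
    rw [← ENNReal.rpow_mul] at this
    simpa using this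
  have := ENNReal.toReal_mono (ENNReal.rpow_ne_top_of_nonneg (by norm_num) hA) h1
  simpa using this

/-- The cell averages of a bounded sequence converge along a subsequence. -/
theorem exists_subseq_cellAvg_tendsto {f : ℕ → ℝ → ℝ} (hf : ∀ j, Measurable (f j)) {M : ℝ≥0∞}
    (hM : M ≠ ∞) (hf2 : ∀ j, ∫⁻ t, ‖f j t‖ₑ ^ (2 : ℝ) ≤ M) :
    ∃ φ : ℕ → ℕ, StrictMono φ ∧ ∀ m : ℕ, ∃ l : ℝ → ℝ, Measurable l ∧
      (∀ t, Tendsto (fun j => cellAvg (2 ^ m) (f (φ j)) t) atTop (𝓝 (l t))) ∧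
      Tendsto (fun j => ∫⁻ t, ‖cellAvg (2 ^ m) (f (φ j)) t - l t‖ₑ ^ (2 : ℝ) ∂gaussianReal 0 1)
        atTop (𝓝 0) := by
  set r : ℕ → ℝ := fun m => ((2 ^ m * M) ^ (1 / 2 : ℝ)).toReal with hr
  set x : ℕ → ℕ × ℤ → ℝ := fun j q => 2 ^ q.1 * ∫ s in cell (2 ^ q.1) q.2, f j s with hx
  have hbd : ∀ j q, x j q ∈ Set.Icc (-(r q.1)) (r q.1) := by
    intro j q
    have hN : (0 : ℝ) < 2 ^ q.1 := by positivity
    have hq : ⌊(2 : ℝ) ^ q.1 * (q.2 / 2 ^ q.1)⌋ = q.2 := by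
      rw [mul_div_cancel₀ _ hN.ne']; simp
    have h1 := enorm_cellAvg_rpow_two_le hN (hf j) (q.2 / 2 ^ q.1)
    rw [cellAvg, hq] at h1
    refine abs_le.1 (abs_le_toReal_of_enorm_rpow_two_le (ENNReal.mul_ne_top (by simp) hM) ?_)
    refine h1.trans ?_
    rw [ENNReal.ofReal_pow (by norm_num), ENNReal.ofReal_ofNat]
    gcongr
    exact (setLIntegral_le_lintegral _ _).trans (hf2 j)
  -- The averages on all cells of all dyadic scales form a point in a countable product of compact
  -- intervals, so a single subsequence serves every scale.
  obtain ⟨y, -, φ, hφ, hy⟩ := (isCompact_univ_pi fun q : ℕ × ℤ =>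
    (isCompact_Icc (a := -(r q.1)) (b := r q.1))).tendsto_subseq (x := x) (fun j q _ => hbd j q)
  refine ⟨φ, hφ, fun m => ⟨fun t => y (m, ⌊(2 : ℝ) ^ m * t⌋), ?_, ?_, ?_⟩⟩
  · exact (measurable_from_top (f := fun i : ℤ => y (m, i))).comp
      (Int.measurable_floor.comp (measurable_const_mul _))
  · intro t
    exact (tendsto_pi_nhds.1 hy) (m, ⌊(2 : ℝ) ^ m * t⌋)
  · have hlim : ∀ t, Tendsto (fun j => cellAvg (2 ^ m) (f (φ j)) t) atTop
        (𝓝 (y (m, ⌊(2 : ℝ) ^ m * t⌋))) := fun t => (tendsto_pi_nhds.1 hy) (m, ⌊(2 : ℝ) ^ m * t⌋)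
    have hyb : ∀ i, |y (m, i)| ≤ r m := fun i => abs_le.2
      (isClosed_Icc.mem_of_tendsto ((tendsto_pi_nhds.1 hy) (m, i))
        (Eventually.of_forall fun j => hbd (φ j) (m, i)))
    have hl : Measurable fun t : ℝ => y (m, ⌊(2 : ℝ) ^ m * t⌋) :=
      (measurable_from_top (f := fun i : ℤ => y (m, i))).comp
        (Int.measurable_floor.comp (measurable_const_mul _))
    have := tendsto_lintegral_of_dominated_convergence (μ := gaussianReal 0 1)
      (F := fun j t => ‖cellAvg (2 ^ m) (f (φ j)) t - y (m, ⌊(2 : ℝ) ^ m * t⌋)‖ₑ ^ (2 : ℝ))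
      (f := fun _ => 0) (fun _ => ENNReal.ofReal (2 * r m) ^ (2 : ℝ))
      (fun j => by have := measurable_cellAvg (2 ^ m) (f (φ j)); fun_prop) ?_ ?_ ?_
    · simpa using this
    · intro j
      refine Eventually.of_forall fun t => ?_
      dsimp only
      gcongr
      rw [← ofReal_norm]
      refine ENNReal.ofReal_le_ofReal ?_
      have h1 := abs_le.2 (hbd (φ j) (m, ⌊(2 : ℝ) ^ m * t⌋))
      calc _ ≤ |cellAvg (2 ^ m) (f (φ j)) t| + |y (m, ⌊(2 : ℝ) ^ m * t⌋)| := norm_sub_le _ _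
        _ ≤ r m + r m := add_le_add h1 (hyb _)
        _ = _ := by ring
    · rw [lintegral_const]
      simp [ENNReal.mul_eq_top]
    · refine Eventually.of_forall fun t => ?_
      have h1 := (hlim t).sub_const (y (m, ⌊(2 : ℝ) ^ m * t⌋))
      rw [sub_self] at h1
      have h2 := (h1.enorm).ennrpow_const 2
      simpa using h2

theorem eLpNorm_two_eq {X : Type*} [MeasurableSpace X] {μ : Measure X} (g : X → ℝ) :
    eLpNorm g 2 μ = (∫⁻ x, ‖g x‖ₑ ^ (2 : ℝ) ∂μ) ^ (1 / 2 : ℝ) := by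
  rw [eLpNorm_eq_lintegral_rpow_enorm_toReal (by norm_num) (by norm_num)]
  simp

/-- Sequences bounded in energy are locally precompact. -/
theorem exists_subseq_tendsto_ae (hγ : 0 < γ) (hk : IsSingular k γ c) (hc0 : c ≠ 0) (hc : c ≠ ∞)
    (hkm : Measurable k) {f : ℕ → ℝ → ℝ} (hf : ∀ j, Measurable (f j)) {M : ℝ≥0∞}
    (hM : M ≠ ∞) (hf2 : ∀ j, ∫⁻ t, ‖f j t‖ₑ ^ (2 : ℝ) ≤ M) (hE : ∀ j, gagliardo k (f j) ≤ M) :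
    ∃ φ : ℕ → ℕ, StrictMono φ ∧ ∃ g : ℝ → ℝ, Measurable g ∧
      (∀ᵐ t, Tendsto (fun j => f (φ j) t) atTop (𝓝 (g t))) ∧
      Tendsto (fun j => ∫⁻ t, ‖f (φ j) t - g t‖ₑ ^ (2 : ℝ) ∂gaussianReal 0 1) atTop (𝓝 0) := by
  obtain ⟨φ, hφ, hl⟩ := exists_subseq_cellAvg_tendsto hf hM hf2
  set ν := gaussianReal 0 1 with hν
  have hmem : ∀ j, MemLp (f (φ j)) 2 ν := by
    intro j
    refine ⟨(hf _).aestronglyMeasurable, ?_⟩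
    rw [eLpNorm_two_eq]
    refine ENNReal.rpow_lt_top_of_nonneg (by norm_num) (ne_top_of_le_ne_top hM ?_)
    exact (lintegral_mono' gaussianReal_le_volume le_rfl).trans (hf2 _)
  -- At a fixed fine scale the averages approximate every `f j` uniformly in `j`, by Poincaré, and
  -- these averages converge; hence the sequence itself is Cauchy in the Gaussian `L²` space.
  have hcauchy : CauchySeq fun j => (hmem j).toLp (f (φ j)) := by
    rw [EMetric.cauchySeq_iff]
    intro ε hε
    have hε4 : 0 < ε / 4 := ENNReal.div_pos hε.ne' (by norm_num)
    -- uniform approximation by cell averages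
    obtain ⟨m, hm⟩ : ∃ m : ℕ, ∀ j, eLpNorm (f j - cellAvg (2 ^ m) (f j)) 2 ν < ε / 4 := by
      have h1 : Tendsto (fun m : ℕ => ((2 : ℝ≥0∞) ^ (m * (-(2 * γ))) * (c⁻¹ * M)) ^ (1 / 2 : ℝ))
          atTop (𝓝 0) := by
        have := (ENNReal.Tendsto.mul_const (tendsto_two_rpow_neg (x := 2 * γ) (by linarith))
          (Or.inr (ENNReal.mul_ne_top (ENNReal.inv_ne_top.2 hc0) hM))).ennrpow_const (1 / 2)
        simpa using this
      obtain ⟨m, hm⟩ := (h1.eventually_lt_const hε4).exists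
      refine ⟨m, fun j => lt_of_le_of_lt ?_ hm⟩
      rw [eLpNorm_two_eq]
      gcongr
      refine (lintegral_mono' gaussianReal_le_volume le_rfl).trans ?_
      refine (lintegral_sub_cellAvg_two_pow_le hk hc0 hc hkm (hf j)
        (ne_top_of_le_ne_top hM (hf2 j)) m).trans ?_
      gcongr
      exact hE j
    obtain ⟨l, hlm, -, hl⟩ := hl m
    have h2 : Tendsto (fun j => eLpNorm (cellAvg (2 ^ m) (f (φ j)) - l) 2 ν) atTop (𝓝 0) := by
      simp_rw [eLpNorm_two_eq]
      have := hl.ennrpow_const (1 / 2)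
      simpa using this
    obtain ⟨J, hJ⟩ := eventually_atTop.1 (h2.eventually_lt_const hε4)
    have hclose : ∀ i ≥ J, eLpNorm (f (φ i) - l) 2 ν < ε / 2 := by
      intro i hi
      have hmc := measurable_cellAvg (2 ^ m) (f (φ i))
      calc eLpNorm (f (φ i) - l) 2 ν
          = eLpNorm ((f (φ i) - cellAvg (2 ^ m) (f (φ i))) + (cellAvg (2 ^ m) (f (φ i)) - l)) 2 ν := by
            rw [sub_add_sub_cancel]
        _ ≤ eLpNorm (f (φ i) - cellAvg (2 ^ m) (f (φ i))) 2 ν +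
              eLpNorm (cellAvg (2 ^ m) (f (φ i)) - l) 2 ν :=
            eLpNorm_add_le ((hf _).sub hmc).aestronglyMeasurable
              (hmc.sub hlm).aestronglyMeasurable (by norm_num)
        _ < ε / 4 + ε / 4 := ENNReal.add_lt_add (hm _) (hJ i hi)
        _ = ε / 2 := by
            rw [← two_mul, ← mul_div_assoc, mul_comm, show (4 : ℝ≥0∞) = 2 * 2 by norm_num,
              ENNReal.mul_div_mul_right _ _ (by norm_num) (by norm_num)]
    refine ⟨J, fun i hi j hj => ?_⟩
    rw [Lp.edist_toLp_toLp]
    calc eLpNorm (f (φ i) - f (φ j)) 2 ν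
        = eLpNorm ((f (φ i) - l) - (f (φ j) - l)) 2 ν := by rw [sub_sub_sub_cancel_right]
      _ ≤ eLpNorm (f (φ i) - l) 2 ν + eLpNorm (f (φ j) - l) 2 ν :=
          eLpNorm_sub_le ((hf _).sub hlm).aestronglyMeasurable
            ((hf _).sub hlm).aestronglyMeasurable (by norm_num)
      _ < ε / 2 + ε / 2 := ENNReal.add_lt_add (hclose i hi) (hclose j hj)
      _ = ε := ENNReal.add_halves ε
  obtain ⟨G, hG⟩ := cauchySeq_tendsto_of_complete hcauchy
  have hGm : Measurable G := (Lp.stronglyMeasurable G).measurable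
  have h3 : Tendsto (fun j => ∫⁻ t, ‖f (φ j) t - G t‖ₑ ^ (2 : ℝ) ∂ν) atTop (𝓝 0) := by
    have h4 : Tendsto (fun j => eLpNorm (f (φ j) - (G : ℝ → ℝ)) 2 ν) atTop (𝓝 0) := by
      have := (Lp.tendsto_Lp_iff_tendsto_eLpNorm' _ _).1 hG
      refine this.congr fun j => eLpNorm_congr_ae ?_
      filter_upwards [(hmem j).coeFn_toLp] with t ht
      simp [ht]
    have := h4.ennrpow_const 2
    simp_rw [eLpNorm_two_eq, ← ENNReal.rpow_mul] at this
    simpa using this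
  obtain ⟨ψ, hψ, hae⟩ := exists_seq_tendsto_ae_of_lintegral (μ := ν) (g := fun j => f (φ j))
    (f := G) (fun j => hf _) hGm (h3.congr fun j => by simp_rw [enorm_sub_rev])
  refine ⟨φ ∘ ψ, hφ.comp hψ, G, hGm, ?_, h3.comp hψ.tendsto_atTop⟩
  exact (gaussianReal_absolutelyContinuous' 0 one_ne_zero).ae_le hae

end

/-! ### Existence of a minimizer on the line -/

section

/-- The integral `∫ |f|^p` over the line. -/
def lpPow (p : ℝ) (f : ℝ → ℝ) : ℝ≥0∞ := ∫⁻ t, ‖f t‖ₑ ^ p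

/-- The energy `∬ k(t - s) |f(t) - f(s)|² dt ds + Λ ∫ f²`. -/
def energy (k : ℝ → ℝ≥0∞) (Λ : ℝ≥0∞) (f : ℝ → ℝ) : ℝ≥0∞ := gagliardo k f + Λ * lpPow 2 f

variable {k : ℝ → ℝ≥0∞} {γ : ℝ} {c Λ : ℝ≥0∞} {p : ℝ}

theorem eLpNorm'_eq_lpPow (f : ℝ → ℝ) : eLpNorm' f p volume = lpPow p f ^ (1 / p) := rfl

theorem lpPow_const_mul (hp : 0 ≤ p) (r : ℝ) (f : ℝ → ℝ) :
    lpPow p (fun t => r * f t) = ‖r‖ₑ ^ p * lpPow p f := by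
  simp_rw [lpPow, enorm_mul, ENNReal.mul_rpow_of_nonneg _ _ hp]
  rw [lintegral_const_mul' _ _ (ENNReal.rpow_ne_top_of_nonneg hp enorm_ne_top)]

theorem gagliardo_const_mul (r : ℝ) (f : ℝ → ℝ) :
    gagliardo k (fun t => r * f t) = ‖r‖ₑ ^ (2 : ℝ) * gagliardo k f := by
  simp_rw [gagliardo, ← mul_sub, enorm_mul, ENNReal.mul_rpow_of_nonneg _ _ zero_le_two]
  rw [← lintegral_const_mul' _ _ (ENNReal.rpow_ne_top_of_nonneg zero_le_two enorm_ne_top)]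
  refine lintegral_congr fun q => ?_
  ring

theorem energy_const_mul (r : ℝ) (f : ℝ → ℝ) :
    energy k Λ (fun t => r * f t) = ‖r‖ₑ ^ (2 : ℝ) * energy k Λ f := by
  rw [energy, energy, gagliardo_const_mul, lpPow_const_mul zero_le_two]
  ring

theorem lpPow_comp_add (f : ℝ → ℝ) (a : ℝ) : lpPow p (fun t => f (t + a)) = lpPow p f :=
  lintegral_add_right_eq_self (fun t => ‖f t‖ₑ ^ p) a

theorem gagliardo_comp_add (f : ℝ → ℝ) (a : ℝ) :
    gagliardo k (fun t => f (t + a)) = gagliardo k f := by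
  have := lintegral_add_right_eq_self (μ := (volume : Measure (ℝ × ℝ)))
    (fun q : ℝ × ℝ => k (q.1 - q.2) * ‖f q.1 - f q.2‖ₑ ^ (2 : ℝ)) (a, a)
  simpa [gagliardo] using this

theorem energy_comp_add (f : ℝ → ℝ) (a : ℝ) :
    energy k Λ (fun t => f (t + a)) = energy k Λ f := by
  rw [energy, energy, gagliardo_comp_add, lpPow_comp_add]

/-- As the squared `L²` norm of the difference function for the measure `k(t - s) dt ds`, the form
falls under the Brezis–Lieb lemma. -/
theorem gagliardo_eq_withDensity (hkm : Measurable k) {f : ℝ → ℝ} (hf : Measurable f) :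
    gagliardo k f = ∫⁻ q : ℝ × ℝ, ‖f q.1 - f q.2‖ₑ ^ (2 : ℝ)
      ∂(volume.withDensity fun q : ℝ × ℝ => k (q.1 - q.2)) := by
  rw [lintegral_withDensity_eq_lintegral_mul _ (by fun_prop) (by fun_prop)]
  rfl

theorem two_rpow_lt_one (hp : 1 / 2 - 1 / p < γ) : (2 : ℝ≥0∞) ^ (1 / 2 - 1 / p - γ) < 1 :=
  ENNReal.rpow_lt_one_of_one_lt_of_neg (by norm_num) (by linarith)

theorem eLpNorm'_le_add_cellAvg (hp : 2 < p) {f : ℝ → ℝ} (hf : Measurable f) (N : ℝ) :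
    eLpNorm' f p volume ≤ eLpNorm' (fun t => f t - cellAvg N f t) p volume +
      eLpNorm' (cellAvg N f) p volume := by
  have hm := measurable_cellAvg N f
  refine le_trans (le_of_eq ?_) (eLpNorm'_add_le (hf.sub hm).aestronglyMeasurable
    hm.aestronglyMeasurable (by linarith))
  congr 1
  ext t
  simp

/-- The subcritical Sobolev embedding on the line. -/
theorem lpPow_ne_top (hγ : 0 < γ) (hk : IsSingular k γ c) (hc0 : c ≠ 0) (hc : c ≠ ∞)
    (hkm : Measurable k) (hp : 2 < p) (hpγ : 1 / 2 - 1 / p < γ) {f : ℝ → ℝ} (hf : Measurable f)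
    (hf2 : lpPow 2 f ≠ ∞) (hE : gagliardo k f ≠ ∞) : lpPow p f ≠ ∞ := by
  have hp0 : 0 < p := by linarith
  have h1 := eLpNorm'_sub_cellAvg_le hγ hk hc0 hc hkm hf hf2 hE hp 0
  have h2 := lintegral_cellAvg_rpow_le hf hp (S := lpPow 2 f)
    (fun i => setLIntegral_le_lintegral _ _) 0
  have h3 : eLpNorm' f p volume ≠ ∞ := by
    refine ne_top_of_le_ne_top (ENNReal.add_ne_top.2 ⟨?_, ?_⟩)
      (eLpNorm'_le_add_cellAvg hp hf (2 ^ 0))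
    · refine ne_top_of_le_ne_top ?_ h1
      refine ENNReal.mul_ne_top (ENNReal.mul_ne_top (by simp) ?_) ?_
      · exact ENNReal.inv_ne_top.2 (tsub_pos_of_lt (two_rpow_lt_one hpγ)).ne'
      · exact ENNReal.rpow_ne_top_of_nonneg (by norm_num)
          (ENNReal.mul_ne_top (ENNReal.inv_ne_top.2 hc0) hE)
    · refine ENNReal.rpow_ne_top_of_nonneg (by positivity) (ne_top_of_le_ne_top ?_ h2)
      refine ENNReal.mul_ne_top (ENNReal.rpow_ne_top_of_nonneg (by linarith) ?_) hf2
      simpa using hf2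
  rw [eLpNorm'_eq_lpPow] at h3
  intro h
  rw [h, ENNReal.top_rpow_of_pos (by positivity)] at h3
  exact h3 rfl

/-- A sequence bounded in energy and not vanishing in `L^p` has local mass bounded below. -/
theorem exists_local_mass (hγ : 0 < γ) (hk : IsSingular k γ c) (hc0 : c ≠ 0) (hc : c ≠ ∞)
    (hkm : Measurable k) (hp : 2 < p) (hpγ : 1 / 2 - 1 / p < γ) {M : ℝ≥0∞} (hM : M ≠ ∞) :
    ∃ δ : ℝ≥0∞, 0 < δ ∧ ∀ f : ℝ → ℝ, Measurable f → lpPow 2 f ≤ M → gagliardo k f ≤ M →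
      lpPow p f = 1 → ∃ i : ℤ, δ < ∫⁻ t in cell 1 i, ‖f t‖ₑ ^ (2 : ℝ) := by
  have hp0 : 0 < p := by linarith
  set r := (2 : ℝ≥0∞) ^ (1 / 2 - 1 / p - γ) with hr
  have hr1 : r < 1 := two_rpow_lt_one hpγ
  -- A scale is fixed at which the oscillation contributes less than `1/2` to the `L^p` norm of
  -- every function bounded by `M`.
  obtain ⟨m, hm⟩ : ∃ m : ℕ,
      2 ^ (1 / 2 - 1 / p) * r ^ m * (1 - r)⁻¹ * (c⁻¹ * M) ^ (1 / 2 : ℝ) < 1 / 2 := by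
    have h1 : Tendsto (fun m : ℕ =>
        r ^ m * (2 ^ (1 / 2 - 1 / p) * (1 - r)⁻¹ * (c⁻¹ * M) ^ (1 / 2 : ℝ))) atTop (𝓝 0) := by
      have := ENNReal.Tendsto.mul_const (ENNReal.tendsto_pow_atTop_nhds_zero_of_lt_one hr1)
        (b := 2 ^ (1 / 2 - 1 / p) * (1 - r)⁻¹ * (c⁻¹ * M) ^ (1 / 2 : ℝ)) (Or.inr ?_)
      · simpa using this
      · refine ENNReal.mul_ne_top (ENNReal.mul_ne_top (by simp) ?_) ?_
        · exact ENNReal.inv_ne_top.2 (tsub_pos_of_lt hr1).ne'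
        · exact ENNReal.rpow_ne_top_of_nonneg (by norm_num)
            (ENNReal.mul_ne_top (ENNReal.inv_ne_top.2 hc0) hM)
    obtain ⟨m, hm⟩ := (h1.eventually_lt_const (u := 1 / 2) (by norm_num)).exists
    refine ⟨m, lt_of_le_of_lt (le_of_eq ?_) hm⟩
    ring
  -- At that scale the averages also contribute less than `1/2` once every unit cell carries mass at
  -- most `1/n`. So `δ = 1/n` works: otherwise the `L^p` norm would be below `1`.
  obtain ⟨n, hn⟩ : ∃ n : ℕ, ((2 ^ m * (n : ℝ≥0∞)⁻¹) ^ ((p - 2) / 2) * M) ^ (1 / p) < 1 / 2 := by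
    have h1 : Tendsto (fun n : ℕ => ((2 ^ m * (n : ℝ≥0∞)⁻¹) ^ ((p - 2) / 2) * M) ^ (1 / p)) atTop
        (𝓝 (((2 ^ m * 0) ^ ((p - 2) / 2) * M) ^ (1 / p))) := by
      refine (ENNReal.Tendsto.mul_const ?_ (Or.inr hM)).ennrpow_const _
      exact (ENNReal.Tendsto.const_mul ENNReal.tendsto_inv_nat_nhds_zero
        (Or.inr (by simp))).ennrpow_const _
    refine (h1.eventually_lt_const ?_).exists
    rw [mul_zero, ENNReal.zero_rpow_of_pos (by linarith), zero_mul,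
      ENNReal.zero_rpow_of_pos (by positivity)]
    norm_num
  refine ⟨(n : ℝ≥0∞)⁻¹, by simp, fun f hf hf2 hE hfp => ?_⟩
  by_contra! hcon
  have h1 := eLpNorm'_sub_cellAvg_le hγ hk hc0 hc hkm hf (ne_top_of_le_ne_top hM hf2)
    (ne_top_of_le_ne_top hM hE) hp m
  have h2 := lintegral_cellAvg_rpow_le hf hp hcon m
  have h3 : eLpNorm' f p volume < 1 / 2 + 1 / 2 := by
    refine (eLpNorm'_le_add_cellAvg hp hf (2 ^ m)).trans_lt (ENNReal.add_lt_add ?_ ?_)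
    · refine lt_of_le_of_lt (h1.trans ?_) hm
      gcongr
    · refine lt_of_le_of_lt ?_ hn
      refine ENNReal.rpow_le_rpow (h2.trans ?_) (by positivity)
      gcongr
      exact hf2
  rw [eLpNorm'_eq_lpPow, hfp, ENNReal.one_rpow, ENNReal.add_halves] at h3
  exact lt_irrefl _ h3

/-- On `[0, 1)` the Gaussian density is at least its value at `1`. This carries the lower bound on
mass in the unit cell over to the Gaussian `L²` limit. -/
theorem exists_setLIntegral_cell_le_gaussianReal :
    ∃ C : ℝ≥0∞, C ≠ ∞ ∧ ∀ F : ℝ → ℝ≥0∞, Measurable F →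
      ∫⁻ t in cell 1 0, F t ≤ C * ∫⁻ t, F t ∂gaussianReal 0 1 := by
  have hpos := gaussianPDF_pos 0 (one_ne_zero (α := ℝ≥0)) 1
  refine ⟨(gaussianPDF 0 1 1)⁻¹, ENNReal.inv_ne_top.2 hpos.ne', fun F hF => ?_⟩
  rw [gaussianReal_of_var_ne_zero _ one_ne_zero,
    lintegral_withDensity_eq_lintegral_mul _ (measurable_gaussianPDF 0 1) hF,
    ← lintegral_const_mul _ ((measurable_gaussianPDF 0 1).mul hF)]
  refine le_trans ?_ (setLIntegral_le_lintegral (cell 1 0) _)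
  refine setLIntegral_mono' (measurableSet_cell _ _) fun t ht => ?_
  rw [cell_eq_Ico one_pos] at ht
  have ht' : 0 ≤ t ∧ t < 1 := by simpa using ht
  have hle : gaussianPDF 0 1 1 ≤ gaussianPDF 0 1 t := by
    refine ENNReal.ofReal_le_ofReal ?_
    unfold gaussianPDFReal
    gcongr
    · linarith
    · linarith
  rw [Pi.mul_apply, ← mul_assoc]
  refine le_mul_of_one_le_left zero_le ?_
  rw [← ENNReal.inv_mul_cancel hpos.ne' (by simp [gaussianPDF])]
  gcongr

theorem lpPow_eq_zero_iff (hp : 0 < p) {f : ℝ → ℝ} (hf : Measurable f) :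
    lpPow p f = 0 ↔ f =ᵐ[volume] 0 := by
  rw [lpPow, lintegral_eq_zero_iff (by fun_prop)]
  refine ⟨fun h => ?_, fun h => ?_⟩ <;> filter_upwards [h] with t ht
  · simpa [hp, hp.not_gt] using ht
  · simp [ht, hp]

/-- The infimum of the energy over the functions with `∫ |f|^p = 1`. -/
def minEnergy (k : ℝ → ℝ≥0∞) (Λ : ℝ≥0∞) (p : ℝ) : ℝ≥0∞ :=
  sInf (energy k Λ '' {f | Measurable f ∧ lpPow p f = 1})

theorem exists_normalize (hp : 0 < p) {f : ℝ → ℝ} (h0 : lpPow p f ≠ 0)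
    (htop : lpPow p f ≠ ∞) :
    ∃ r : ℝ, lpPow p (fun t => r * f t) = 1 ∧ ‖r‖ₑ ^ (2 : ℝ) * lpPow p f ^ (2 / p) = 1 := by
  have hx : 0 < (lpPow p f).toReal := ENNReal.toReal_pos h0 htop
  have hr : ‖(lpPow p f).toReal ^ (-(1 / p))‖ₑ = lpPow p f ^ (-(1 / p)) := by
    rw [Real.enorm_of_nonneg (by positivity), ← ENNReal.ofReal_rpow_of_pos hx,
      ENNReal.ofReal_toReal htop]
  refine ⟨(lpPow p f).toReal ^ (-(1 / p)), ?_, ?_⟩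
  · rw [lpPow_const_mul hp.le, hr, ← ENNReal.rpow_mul]
    have : -(1 / p) * p = -1 := by field_simp
    rw [this, ENNReal.rpow_neg_one, ENNReal.inv_mul_cancel h0 htop]
  · rw [hr, ← ENNReal.rpow_mul, ← ENNReal.rpow_add _ _ h0 htop]
    have : -(1 / p) * 2 + 2 / p = 0 := by ring
    rw [this, ENNReal.rpow_zero]

/-- Both sides are homogeneous of degree two, so `f` may be normalized in `L^p`; when the energy is
finite, the Sobolev embedding makes the norm finite. -/
theorem minEnergy_mul_le (hγ : 0 < γ) (hk : IsSingular k γ c) (hc0 : c ≠ 0) (hc : c ≠ ∞)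
    (hkm : Measurable k) (hp : 2 < p) (hpγ : 1 / 2 - 1 / p < γ) (hΛ0 : Λ ≠ 0) {f : ℝ → ℝ}
    (hf : Measurable f) : minEnergy k Λ p * lpPow p f ^ (2 / p) ≤ energy k Λ f := by
  have hp0 : 0 < p := by linarith
  rcases eq_or_ne (energy k Λ f) ∞ with hE | hE
  · rw [hE]; exact le_top
  have hE' := ENNReal.add_ne_top.1 hE
  have htop : lpPow p f ≠ ∞ := lpPow_ne_top hγ hk hc0 hc hkm hp hpγ hf
    (fun h => hE'.2 (by rw [h]; exact ENNReal.mul_top hΛ0)) hE'.1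
  rcases eq_or_ne (lpPow p f) 0 with h0 | h0
  · rw [h0, ENNReal.zero_rpow_of_pos (by positivity), mul_zero]
    exact zero_le
  obtain ⟨r, hr1, hr2⟩ := exists_normalize hp0 h0 htop
  calc minEnergy k Λ p * lpPow p f ^ (2 / p)
      ≤ energy k Λ (fun t => r * f t) * lpPow p f ^ (2 / p) := by
        gcongr
        exact sInf_le ⟨_, ⟨hf.const_mul r, hr1⟩, rfl⟩
    _ = energy k Λ f * (‖r‖ₑ ^ (2 : ℝ) * lpPow p f ^ (2 / p)) := by
        rw [energy_const_mul]; ring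
    _ = _ := by rw [hr2, mul_one]

/-- Splitting of the energy along a sequence that converges almost everywhere. -/
theorem energy_sub_tendsto (hkm : Measurable k) (hΛ : Λ ≠ ∞) {h : ℕ → ℝ → ℝ} {g : ℝ → ℝ}
    (hh : ∀ j, Measurable (h j)) (hg : Measurable g)
    (hae : ∀ᵐ t, Tendsto (fun j => h j t) atTop (𝓝 (g t))) {e l : ℝ≥0∞} (he : e ≠ ∞) (hl : l ≠ ∞)
    (hte : Tendsto (fun j => gagliardo k (h j)) atTop (𝓝 e))
    (htl : Tendsto (fun j => lpPow 2 (h j)) atTop (𝓝 l)) :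
    ∃ d, d + energy k Λ g = e + Λ * l ∧
      Tendsto (fun j => energy k Λ (fun t => h j t - g t)) atTop (𝓝 d) := by
  obtain ⟨h1, h2⟩ := brezis_lieb one_le_two hh hg hae htl hl
  change lpPow 2 g ≤ l at h1
  have hae2 : ∀ᵐ q : ℝ × ℝ ∂(volume.withDensity fun q : ℝ × ℝ => k (q.1 - q.2)),
      Tendsto (fun j => h j q.1 - h j q.2) atTop (𝓝 (g q.1 - g q.2)) := by
    refine (withDensity_absolutelyContinuous _ _).ae_le ?_
    have ha := (Measure.quasiMeasurePreserving_fst (μ := (volume : Measure ℝ))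
      (ν := (volume : Measure ℝ))).ae hae
    have hb := (Measure.quasiMeasurePreserving_snd (μ := (volume : Measure ℝ))
      (ν := (volume : Measure ℝ))).ae hae
    rw [Measure.volume_eq_prod]
    filter_upwards [ha, hb] with q hq1 hq2 using hq1.sub hq2
  have hte' := hte
  simp_rw [fun j => gagliardo_eq_withDensity hkm (hh j)] at hte'
  -- Brezis–Lieb on `ℝ²` for the differences `h j t - h j s`, with respect to the weighted measure.
  obtain ⟨h3, h4⟩ := brezis_lieb one_le_two
    (a := fun j (q : ℝ × ℝ) => h j q.1 - h j q.2) (b := fun q : ℝ × ℝ => g q.1 - g q.2)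
    (fun j => by have := hh j; fun_prop) (by fun_prop) hae2 hte' he
  rw [← gagliardo_eq_withDensity hkm hg] at h3 h4
  refine ⟨(e - gagliardo k g) + Λ * (l - lpPow 2 g), ?_, ?_⟩
  · calc _ = (e - gagliardo k g + gagliardo k g) + Λ * (l - lpPow 2 g + lpPow 2 g) := by
          rw [energy]; ring
      _ = _ := by rw [tsub_add_cancel_of_le h3, tsub_add_cancel_of_le h1]
  · refine Tendsto.add (h4.congr fun j => ?_) (ENNReal.Tendsto.const_mul h2 (Or.inr hΛ))
    rw [gagliardo_eq_withDensity hkm (f := fun t => h j t - g t) ((hh j).sub hg)]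
    refine lintegral_congr fun q => ?_
    congr 2
    ring

/-- A minimizing sequence can be translated so that it converges to a nonzero limit. -/
theorem exists_minimizing_seq (hγ : 0 < γ) (hk : IsSingular k γ c) (hc0 : c ≠ 0) (hc : c ≠ ∞)
    (hkm : Measurable k) (hp : 2 < p) (hpγ : 1 / 2 - 1 / p < γ) (hΛ0 : Λ ≠ 0) (hΛ : Λ ≠ ∞)
    (hm : minEnergy k Λ p ≠ ∞) :
    ∃ (h : ℕ → ℝ → ℝ) (g : ℝ → ℝ) (e l : ℝ≥0∞), (∀ j, Measurable (h j)) ∧ Measurable g ∧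
      (∀ j, lpPow p (h j) = 1) ∧ (∀ᵐ t, Tendsto (fun j => h j t) atTop (𝓝 (g t))) ∧
      e ≠ ∞ ∧ l ≠ ∞ ∧ Tendsto (fun j => gagliardo k (h j)) atTop (𝓝 e) ∧
      Tendsto (fun j => lpPow 2 (h j)) atTop (𝓝 l) ∧ e + Λ * l = minEnergy k Λ p ∧
      lpPow 2 g ≠ 0 := by
  have hne : (energy k Λ '' {f | Measurable f ∧ lpPow p f = 1}).Nonempty := by
    by_contra! hcon
    rw [minEnergy, hcon, sInf_empty] at hm
    exact hm rfl
  obtain ⟨u, -, hu, humem⟩ := exists_seq_tendsto_sInf hne (OrderBot.bddBelow _)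
  choose f0 hf0 hf0u using humem
  obtain ⟨J, hJ⟩ := eventually_atTop.1 (hu.eventually_lt_const
    (ENNReal.lt_add_right hm one_ne_zero))
  set M1 := minEnergy k Λ p + 1 with hM1
  have hM1top : M1 ≠ ∞ := ENNReal.add_ne_top.2 ⟨hm, ENNReal.one_ne_top⟩
  set M := M1 + Λ⁻¹ * M1 with hMdef
  have hM : M ≠ ∞ := ENNReal.add_ne_top.2
    ⟨hM1top, ENNReal.mul_ne_top (ENNReal.inv_ne_top.2 hΛ0) hM1top⟩
  have hen : ∀ j, energy k Λ (f0 (j + J)) ≤ M1 := fun j => by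
    rw [hf0u]; exact (hJ _ (Nat.le_add_left _ _)).le
  have hgM : ∀ j, gagliardo k (f0 (j + J)) ≤ M := fun j =>
    le_self_add.trans ((hen j).trans le_self_add)
  have hlM : ∀ j, lpPow 2 (f0 (j + J)) ≤ M := fun j => by
    have h1 : Λ * lpPow 2 (f0 (j + J)) ≤ M1 := le_add_self.trans (hen j)
    calc lpPow 2 (f0 (j + J)) = Λ⁻¹ * (Λ * lpPow 2 (f0 (j + J))) := by
          rw [← mul_assoc, ENNReal.inv_mul_cancel hΛ0 hΛ, one_mul]
      _ ≤ Λ⁻¹ * M1 := by gcongr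
      _ ≤ M := le_add_self
  obtain ⟨δ, hδ, hmass⟩ := exists_local_mass hγ hk hc0 hc hkm hp hpγ hM
  choose i hi using fun j => hmass _ (hf0 (j + J)).1 (hlM j) (hgM j) (hf0 (j + J)).2
  -- Translation by the integer `i j` brings the cell carrying mass above `δ` to `[0, 1)`, without
  -- changing any of the integrals.
  set h1 : ℕ → ℝ → ℝ := fun j t => f0 (j + J) (t + i j) with hh1
  have h1m : ∀ j, Measurable (h1 j) := fun j => (hf0 _).1.comp (measurable_add_const _)
  have h1l : ∀ j, lpPow 2 (h1 j) ≤ M := fun j => (lpPow_comp_add _ _).trans_le (hlM j)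
  have h1g : ∀ j, gagliardo k (h1 j) ≤ M := fun j => (gagliardo_comp_add _ _).trans_le (hgM j)
  have h1mass : ∀ j, δ < ∫⁻ t in cell 1 0, ‖h1 j t‖ₑ ^ (2 : ℝ) := by
    intro j
    refine lt_of_lt_of_eq (hi j) ?_
    rw [← lintegral_indicator (measurableSet_cell _ _), ← lintegral_indicator (measurableSet_cell _ _),
      ← lintegral_add_right_eq_self _ (i j : ℝ)]
    refine lintegral_congr fun t => ?_
    have : t + i j ∈ cell 1 (i j) ↔ t ∈ cell 1 0 := by
      simp [cell]
    by_cases ht : t ∈ cell 1 0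
    · rw [Set.indicator_of_mem ht, Set.indicator_of_mem (this.2 ht)]
    · rw [Set.indicator_of_notMem ht, Set.indicator_of_notMem (fun h => ht (this.1 h))]
  obtain ⟨φ, hφ, g, hg, hae, hL2⟩ := exists_subseq_tendsto_ae hγ hk hc0 hc hkm h1m hM h1l h1g
  -- The two parts of the energy must converge separately for Brezis–Lieb; a further subsequence
  -- does this by compactness of `[0, ∞]²`.
  obtain ⟨⟨e, l⟩, ψ, hψ, hel⟩ := CompactSpace.tendsto_subseq
    (fun j => (gagliardo k (h1 (φ j)), lpPow 2 (h1 (φ j))))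
  have hte : Tendsto (fun j => gagliardo k (h1 (φ (ψ j)))) atTop (𝓝 e) :=
    (continuous_fst.tendsto _).comp hel
  have htl : Tendsto (fun j => lpPow 2 (h1 (φ (ψ j)))) atTop (𝓝 l) :=
    (continuous_snd.tendsto _).comp hel
  refine ⟨fun j => h1 (φ (ψ j)), g, e, l, fun j => h1m _, hg, fun j => ?_, ?_, ?_, ?_, hte, htl,
    ?_, ?_⟩
  · exact (lpPow_comp_add _ _).trans (hf0 _).2
  · filter_upwards [hae] with t ht using ht.comp hψ.tendsto_atTop
  · exact ne_top_of_le_ne_top hM (le_of_tendsto hte (Eventually.of_forall fun j => h1g _))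
  · exact ne_top_of_le_ne_top hM (le_of_tendsto htl (Eventually.of_forall fun j => h1l _))
  · refine tendsto_nhds_unique (hte.add (ENNReal.Tendsto.const_mul htl (Or.inr hΛ))) ?_
    have h5 : Tendsto (fun j => φ (ψ j) + J) atTop atTop :=
      tendsto_atTop_mono (fun j => Nat.le_add_right _ J)
        (hφ.tendsto_atTop.comp hψ.tendsto_atTop)
    refine (hu.comp h5).congr fun j => ?_
    rw [Function.comp_apply, ← hf0u]
    exact (energy_comp_add _ _).symm
  -- If `g` vanished, Gaussian `L²` convergence would drive the mass on `[0, 1)` to zero, against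
  -- the lower bound `δ`.
  · intro h0
    obtain ⟨C, hC, hCF⟩ := exists_setLIntegral_cell_le_gaussianReal
    have hg0 : g =ᵐ[gaussianReal 0 1] 0 :=
      (gaussianReal_absolutelyContinuous 0 one_ne_zero).ae_le
        ((lpPow_eq_zero_iff two_pos hg).1 h0)
    have h6 : Tendsto (fun j => C * ∫⁻ t, ‖h1 (φ j) t‖ₑ ^ (2 : ℝ) ∂gaussianReal 0 1) atTop
        (𝓝 (C * 0)) := by
      refine ENNReal.Tendsto.const_mul (hL2.congr fun j => lintegral_congr_ae ?_) (Or.inr hC)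
      filter_upwards [hg0] with t ht
      simp [ht]
    rw [mul_zero] at h6
    obtain ⟨j, hj⟩ := (h6.eventually_lt_const hδ).exists
    have h7 := hCF (fun t => ‖h1 (φ j) t‖ₑ ^ (2 : ℝ)) (by have := h1m (φ j); fun_prop)
    exact lt_irrefl _ ((h1mass (φ j)).trans_le (h7.trans hj.le))

/-- Existence of a minimizer of `energy f / (∫ |f|^p)^{2/p}` on the line. -/
theorem exists_minimizer (hγ : 0 < γ) (hk : IsSingular k γ c) (hc0 : c ≠ 0) (hc : c ≠ ∞)
    (hkm : Measurable k) (hp : 2 < p) (hpγ : 1 / 2 - 1 / p < γ) (hΛ0 : Λ ≠ 0) (hΛ : Λ ≠ ∞)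
    (hex : ∃ f, Measurable f ∧ lpPow 2 f ≠ 0 ∧ energy k Λ f ≠ ∞) :
    ∃ f, Measurable f ∧ lpPow 2 f ≠ 0 ∧ energy k Λ f ≠ ∞ ∧
      ∀ g, Measurable g → energy k Λ f * lpPow p g ^ (2 / p) ≤
        energy k Λ g * lpPow p f ^ (2 / p) := by
  have hp0 : 0 < p := by linarith
  have hle := fun {f : ℝ → ℝ} (hf : Measurable f) =>
    minEnergy_mul_le (Λ := Λ) hγ hk hc0 hc hkm hp hpγ hΛ0 hf
  set m := minEnergy k Λ p with hmdef
  have hm : m ≠ ∞ := by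
    obtain ⟨f, hf, hf0, hfE⟩ := hex
    have h0 : lpPow p f ^ (2 / p) ≠ 0 := by
      rw [Ne, ENNReal.rpow_eq_zero_iff_of_pos (by positivity), lpPow_eq_zero_iff hp0 hf,
        ← lpPow_eq_zero_iff two_pos hf]
      exact hf0
    intro h
    refine hfE (top_le_iff.1 ?_)
    have := hle hf
    rwa [h, ENNReal.top_mul h0] at this
  obtain ⟨h, g, e, l, hh, hg, hnorm, hae, he, hl, hte, htl, hel, hg0⟩ :=
    exists_minimizing_seq hγ hk hc0 hc hkm hp hpγ hΛ0 hΛ hm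
  obtain ⟨d, hd, htd⟩ := energy_sub_tendsto hkm hΛ hh hg hae he hl hte htl
  rw [hel, ← hmdef] at hd
  obtain ⟨hθ1, hθ⟩ := brezis_lieb (L := 1) (p := p) (by linarith) hh hg hae
    (by simp_rw [lpPow] at hnorm; simp [hnorm]) ENNReal.one_ne_top
  change lpPow p g ≤ 1 at hθ1
  change Tendsto (fun j => lpPow p fun t => h j t - g t) atTop (𝓝 (1 - lpPow p g)) at hθ
  set θ := lpPow p g with hθdef
  have hs0 : 0 < 2 / p := by positivity
  have hs1 : 2 / p ≤ 1 := by rw [div_le_one hp0]; exact hp.le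
  -- The remainders `h j - g` have `L^p` mass tending to `1 - θ` and energy tending to `d`; the
  -- homogeneous inequality applies to each of them.
  have hdm : m * (1 - θ) ^ (2 / p) ≤ d := by
    refine le_of_tendsto_of_tendsto' (ENNReal.Tendsto.const_mul (hθ.ennrpow_const _) (Or.inr hm))
      htd fun j => hle ((hh j).sub hg)
  have hgE : energy k Λ g ≠ ∞ := ne_top_of_le_ne_top hm (le_add_self.trans hd.le)
  have hfin : m * (1 - θ) ^ (2 / p) ≠ ∞ :=
    ENNReal.mul_ne_top hm (ENNReal.rpow_ne_top_of_nonneg hs0.le (by simp))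
  -- Cancel the finite quantity `m (1 - θ)^(2/p)`, using `1 ≤ (1 - θ)^(2/p) + θ^(2/p)`. The value of
  -- `θ` is not needed, since only the quotient matters.
  have hkey : energy k Λ g ≤ m * θ ^ (2 / p) := by
    refine (ENNReal.add_le_add_iff_left hfin).1 ?_
    calc m * (1 - θ) ^ (2 / p) + energy k Λ g ≤ d + energy k Λ g := by gcongr
      _ = m * ((1 - θ) + θ) ^ (2 / p) := by
          rw [hd, tsub_add_cancel_of_le hθ1, ENNReal.one_rpow, mul_one]
      _ ≤ m * ((1 - θ) ^ (2 / p) + θ ^ (2 / p)) := by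
          gcongr
          exact ENNReal.rpow_add_le_add_rpow _ _ hs0.le hs1
      _ = _ := by rw [mul_add]
  refine ⟨g, hg, hg0, hgE, fun g' hg' => ?_⟩
  calc energy k Λ g * lpPow p g' ^ (2 / p) ≤ m * θ ^ (2 / p) * lpPow p g' ^ (2 / p) := by gcongr
    _ = m * lpPow p g' ^ (2 / p) * θ ^ (2 / p) := by ring
    _ ≤ _ := by gcongr; exact hle hg'

end

/-! ### Logarithmic polar coordinates and estimates of the kernel -/

/-- Logarithmic polar coordinates `(t, θ) ↦ e^t θ`. -/
def logPolar (n : ℕ) (z : Cyl n) : Eucl n := Real.exp z.1 • (z.2 : Eucl n)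

theorem continuous_logPolar (n : ℕ) : Continuous (logPolar n) := by
  unfold logPolar
  fun_prop

theorem lintegral_Ioi_eq_lintegral_exp (g : ℝ → ℝ≥0∞) :
    ∫⁻ r in Set.Ioi 0, g r = ∫⁻ t, ENNReal.ofReal (Real.exp t) * g (Real.exp t) := by
  have := lintegral_image_eq_lintegral_abs_deriv_mul MeasurableSet.univ
    (fun x _ => (Real.hasDerivAt_exp x).hasDerivWithinAt) Real.exp_injective.injOn g
  simpa [Set.image_univ, Real.range_exp] using this

instance (n : ℕ) : SFinite (cylMeasure n) := by
  unfold cylMeasure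
  infer_instance

/-- Polar coordinates with `r = e^t`, under which `r^(n-1) dr = e^(nt) dt`. -/
theorem lintegral_logPolar {n : ℕ} (hn : 1 ≤ n) {F : Eucl n → ℝ≥0∞} (hF : Measurable F) :
    ∫⁻ z, ENNReal.ofReal (Real.exp (n * z.1)) * F (logPolar n z) ∂cylMeasure n = ∫⁻ x, F x := by
  have hmp := (volume : Measure (Eucl n)).measurePreserving_homeomorphUnitSphereProd
  have hdim : Module.finrank ℝ (Eucl n) = n := by simp
  have : Nontrivial (Eucl n) := Module.nontrivial_of_finrank_pos (R := ℝ) (by rw [hdim]; omega)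
  rw [hdim] at hmp
  have h1 : ∫⁻ x, F x = ∫⁻ q : Sph n × Set.Ioi (0 : ℝ), F (q.2.1 • q.1.1)
      ∂((volume : Measure (Eucl n)).toSphere.prod (Measure.volumeIoiPow (n - 1))) := by
    have hme := (homeomorphUnitSphereProd (Eucl n)).measurableEmbedding
    rw [← hmp.lintegral_comp_emb hme]
    have : ∀ a : ({0}ᶜ : Set (Eucl n)),
        ((homeomorphUnitSphereProd (Eucl n) a).2.1 •
          (homeomorphUnitSphereProd (Eucl n) a).1.1) = (a : Eucl n) := by
      intro a
      have ha : ‖(a : Eucl n)‖ ≠ 0 := norm_ne_zero_iff.2 a.2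
      simp [smul_smul, ha]
    simp_rw [this]
    rw [lintegral_subtype_comap (measurableSet_singleton _).compl, restrict_compl_singleton]
  have hFm : Measurable fun q : Sph n × Set.Ioi (0 : ℝ) => F (q.2.1 • q.1.1) := by fun_prop
  rw [h1, lintegral_prod _ hFm.aemeasurable]
  have h2 : ∀ θ : Sph n, ∫⁻ r, F ((r : ℝ) • (θ : Eucl n)) ∂Measure.volumeIoiPow (n - 1) =
      ∫⁻ t, ENNReal.ofReal (Real.exp (n * t)) * F (Real.exp t • (θ : Eucl n)) := by
    intro θ
    rw [Measure.volumeIoiPow, lintegral_withDensity_eq_lintegral_mul _ (by fun_prop) (by fun_prop)]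
    have := lintegral_subtype_comap (μ := volume) (measurableSet_Ioi (a := (0 : ℝ)))
      (f := fun r => ENNReal.ofReal (r ^ (n - 1)) * F (r • (θ : Eucl n)))
    simp only [Pi.mul_apply]
    rw [this, lintegral_Ioi_eq_lintegral_exp]
    refine lintegral_congr fun t => ?_
    rw [← mul_assoc, ← ENNReal.ofReal_mul (Real.exp_pos _).le, ← Real.exp_nat_mul, ← Real.exp_add]
    congr 3
    rw [Nat.cast_sub hn]
    push_cast
    ring
  simp_rw [h2]
  have hm : Measurable fun z : Cyl n =>
      ENNReal.ofReal (Real.exp (n * z.1)) * F (Real.exp z.1 • (z.2 : Eucl n)) := by fun_prop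
  change ∫⁻ z : ℝ × Sph n, ENNReal.ofReal (Real.exp (n * z.1)) *
    F (Real.exp z.1 • (z.2 : Eucl n)) ∂(volume.prod (volume : Measure (Eucl n)).toSphere) = _
  rw [lintegral_prod_symm _ hm.aemeasurable]

/-- In pushforward form the change of variables also applies to Bochner integrals of functions of
variable sign, as needed for `κ`. -/
theorem map_logPolar {n : ℕ} (hn : 1 ≤ n) :
    ((cylMeasure n).withDensity fun z => ENNReal.ofReal (Real.exp (n * z.1))).map (logPolar n) =
      volume := by
  have hm := (continuous_logPolar n).measurable
  ext s hs
  rw [Measure.map_apply hm hs, withDensity_apply _ (hm hs), ← lintegral_indicator (hm hs),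
    ← lintegral_indicator_one hs, ← lintegral_logPolar hn (measurable_one.indicator hs)]
  refine lintegral_congr fun z => ?_
  by_cases hz : logPolar n z ∈ s
  · rw [Set.indicator_of_mem (show z ∈ logPolar n ⁻¹' s from hz), Set.indicator_of_mem hz]
    simp
  · rw [Set.indicator_of_notMem (show z ∉ logPolar n ⁻¹' s from hz), Set.indicator_of_notMem hz]
    simp

theorem integral_logPolar {n : ℕ} (hn : 1 ≤ n) {F : Eucl n → ℝ} (hF : Measurable F) :
    ∫ x, F x = ∫ z, Real.exp (n * z.1) * F (logPolar n z) ∂cylMeasure n := by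
  have hm := (continuous_logPolar n).measurable
  rw [← map_logPolar hn, integral_map hm.aemeasurable hF.aestronglyMeasurable,
    integral_withDensity_eq_integral_toReal_smul (by fun_prop)
      (Eventually.of_forall fun _ => ENNReal.ofReal_lt_top)]
  refine integral_congr_ae (Eventually.of_forall fun z => ?_)
  simp [ENNReal.toReal_ofReal (Real.exp_pos _).le]

theorem measurable_kernel (n : ℕ) (γ : ℝ) :
    Measurable fun q : Cyl n × Cyl n => kernel n γ q.1 q.2 := by
  unfold kernel
  fun_prop

theorem inner_sph_le_one {n : ℕ} (θ θ' : Sph n) : inner ℝ (θ : Eucl n) (θ' : Eucl n) ≤ 1 := by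
  have := real_inner_le_norm (θ : Eucl n) (θ' : Eucl n)
  simpa using this

theorem two_le_two_mul_cosh (t : ℝ) : 2 ≤ 2 * Real.cosh t := by
  linarith [Real.one_le_cosh t]

/-- Factoring `e^(-|t - t'|)` out of the base cancels the numerator; evenness and monotonicity in
`|t - t'|` become visible. -/
theorem kernel_eq {n : ℕ} {γ : ℝ} (z z' : Cyl n) :
    kernel n γ z z' = (2 * Real.cosh (z.1 - z'.1) - 2 * inner ℝ (z.2 : Eucl n) (z'.2 : Eucl n)) ^
      (-(((n : ℝ) + 2 * γ) / 2)) := by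
  have hw : 0 ≤ 2 * Real.cosh (z.1 - z'.1) - 2 * inner ℝ (z.2 : Eucl n) (z'.2 : Eucl n) := by
    linarith [inner_sph_le_one z.2 z'.2, two_le_two_mul_cosh (z.1 - z'.1)]
  have hb : 1 + Real.exp (-2 * |z.1 - z'.1|)
      - 2 * Real.exp (-|z.1 - z'.1|) * inner ℝ (z.2 : Eucl n) (z'.2 : Eucl n) =
      Real.exp (-|z.1 - z'.1|) *
        (2 * Real.cosh (z.1 - z'.1) - 2 * inner ℝ (z.2 : Eucl n) (z'.2 : Eucl n)) := by
    have h1 : Real.exp (-2 * |z.1 - z'.1|) = Real.exp (-|z.1 - z'.1|) * Real.exp (-|z.1 - z'.1|) := by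
      rw [← Real.exp_add]; ring_nf
    have h2 : Real.exp (-|z.1 - z'.1|) * Real.exp |z.1 - z'.1| = 1 := by
      rw [← Real.exp_add]; simp
    rw [← Real.cosh_abs, Real.cosh_eq, h1]
    linear_combination -h2
  rw [kernel, hb, Real.mul_rpow (Real.exp_pos _).le hw, ← Real.exp_mul, Real.rpow_neg hw]
  have h3 : -(((n : ℝ) + 2 * γ) / 2) * |z.1 - z'.1| = -|z.1 - z'.1| * (((n : ℝ) + 2 * γ) / 2) := by
    ring
  rw [h3, div_mul_eq_div_div, div_self (Real.exp_pos _).ne', one_div]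

theorem kernel_nonneg {n : ℕ} {γ : ℝ} (z z' : Cyl n) : 0 ≤ kernel n γ z z' := by
  rw [kernel_eq]
  refine Real.rpow_nonneg ?_ _
  linarith [inner_sph_le_one z.2 z'.2, two_le_two_mul_cosh (z.1 - z'.1)]

theorem kernel_eq_of_sub {n : ℕ} {γ : ℝ} (t t' : ℝ) (θ θ' : Sph n) :
    kernel n γ (t, θ) (t', θ') = kernel n γ (0, θ) (t - t', θ') := by
  simp only [kernel_eq]
  rw [zero_sub, Real.cosh_neg]

theorem kernel_neg {n : ℕ} {γ : ℝ} (t : ℝ) (θ θ' : Sph n) :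
    kernel n γ (0, θ) (-t, θ') = kernel n γ (0, θ) (t, θ') := by
  simp only [kernel_eq]
  rw [zero_sub, zero_sub, Real.cosh_neg]

theorem norm_sub_logPolar_sq {n : ℕ} (e : Sph n) (z : Cyl n) :
    ‖(e : Eucl n) - logPolar n z‖ ^ 2 =
      Real.exp z.1 * (2 * Real.cosh z.1 - 2 * inner ℝ (e : Eucl n) (z.2 : Eucl n)) := by
  rw [norm_sub_sq_real, logPolar, inner_smul_right, norm_smul]
  have h2 : Real.exp z.1 * Real.exp (-z.1) = 1 := by
    rw [← Real.exp_add]; simp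
  have h1 : ‖(e : Eucl n)‖ = 1 := by simp
  have h3 : ‖(z.2 : Eucl n)‖ = 1 := by simp
  rw [h1, h3, Real.cosh_eq, Real.norm_of_nonneg (Real.exp_pos _).le]
  linear_combination -h2

/-- By the law of cosines, `|e - x|² = e^t (2 cosh t - 2⟨e, θ⟩)`: up to a conformal factor the
kernel is `|e - x|^(-n-2γ)`. -/
theorem kernel_eq_logPolar {n : ℕ} {γ : ℝ} (e : Sph n) (z : Cyl n) :
    kernel n γ (0, e) z = Real.exp (((n : ℝ) + 2 * γ) / 2 * z.1) *
      ‖(e : Eucl n) - logPolar n z‖ ^ (-((n : ℝ) + 2 * γ)) := by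
  have hw : 0 ≤ 2 * Real.cosh z.1 - 2 * inner ℝ (e : Eucl n) (z.2 : Eucl n) := by
    linarith [inner_sph_le_one e z.2, two_le_two_mul_cosh z.1]
  have h1 : ‖(e : Eucl n) - logPolar n z‖ ^ (-((n : ℝ) + 2 * γ)) =
      (‖(e : Eucl n) - logPolar n z‖ ^ 2) ^ (-(((n : ℝ) + 2 * γ) / 2)) := by
    rw [← Real.rpow_natCast_mul (norm_nonneg _)]
    congr 1
    push_cast
    ring
  rw [kernel_eq, h1, norm_sub_logPolar_sq, Real.mul_rpow (Real.exp_pos _).le hw, ← Real.exp_mul,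
    ← mul_assoc, ← Real.exp_add]
  simp only [zero_sub, Real.cosh_neg]
  ring_nf
  simp

theorem norm_logPolar {n : ℕ} (z : Cyl n) : ‖logPolar n z‖ = Real.exp z.1 := by
  have h3 : ‖(z.2 : Eucl n)‖ = 1 := by simp
  rw [logPolar, norm_smul, h3, mul_one, Real.norm_of_nonneg (Real.exp_pos _).le]

theorem abs_one_sub_exp_le {n : ℕ} (e : Sph n) (z : Cyl n) :
    |1 - Real.exp z.1| ≤ ‖(e : Eucl n) - logPolar n z‖ := by
  have h := abs_norm_sub_norm_le (e : Eucl n) (logPolar n z)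
  rw [norm_logPolar] at h
  simpa using h

theorem abs_le_exp_mul_abs {t : ℝ} (ht : |t| ≤ 1) : |t| ≤ Real.exp 1 * |1 - Real.exp t| := by
  have he : 1 ≤ Real.exp 1 := Real.one_le_exp zero_le_one
  rcases le_total 0 t with h | h
  · have h1 := Real.add_one_le_exp t
    rw [abs_of_nonneg h, abs_of_nonpos (by linarith)]
    nlinarith
  · have h1 := Real.add_one_le_exp (-t)
    have h2 : Real.exp (-t) * Real.exp t = 1 := by rw [← Real.exp_add]; simp
    have h3 : Real.exp t ≤ 1 := Real.exp_le_one_iff.2 h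
    have h4 : Real.exp (-t) ≤ Real.exp 1 := Real.exp_le_exp.2 (by
      rw [abs_of_nonpos h] at ht; exact ht)
    rw [abs_of_nonpos h, abs_of_nonneg (by linarith)]
    calc -t ≤ Real.exp (-t) - 1 := by linarith
      _ = Real.exp (-t) * (1 - Real.exp t) := by rw [mul_sub, h2, mul_one]
      _ ≤ _ := by gcongr

/-- Exponential decay of the kernel. -/
theorem kernel_le_of_one_le_abs {n : ℕ} {γ : ℝ} (hγ : 0 < γ) (e : Sph n) {z : Cyl n}
    (hz : 1 ≤ |z.1|) :
    kernel n γ (0, e) z ≤ ((1 - Real.exp (-1)) ^ 2) ^ (-(((n : ℝ) + 2 * γ) / 2)) *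
      Real.exp (-(((n : ℝ) + 2 * γ) / 2) * |z.1|) := by
  have h1 : Real.exp (-1) < 1 := by simp
  have h0 : 0 < (1 - Real.exp (-1)) ^ 2 := by
    have : 0 < 1 - Real.exp (-1) := by linarith
    positivity
  have hE : Real.exp (-|z.1|) ≤ Real.exp (-1) := Real.exp_le_exp.2 (by linarith)
  have h2 : Real.exp |z.1| * Real.exp (-|z.1|) = 1 := by rw [← Real.exp_add]; simp
  have hlow : Real.exp |z.1| * (1 - Real.exp (-1)) ^ 2 ≤
      2 * Real.cosh (0 - z.1) - 2 * inner ℝ (e : Eucl n) (z.2 : Eucl n) := by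
    have h3 : 2 * Real.cosh (0 - z.1) - 2 = Real.exp |z.1| * (1 - Real.exp (-|z.1|)) ^ 2 := by
      rw [zero_sub, Real.cosh_neg, ← Real.cosh_abs, Real.cosh_eq]
      linear_combination (2 - Real.exp (-|z.1|)) * h2
    have h4 : (1 - Real.exp (-1)) ^ 2 ≤ (1 - Real.exp (-|z.1|)) ^ 2 := by
      have : 0 < 1 - Real.exp (-1) := by linarith
      gcongr
    have h5 := inner_sph_le_one e z.2
    have := mul_le_mul_of_nonneg_left h4 (Real.exp_pos |z.1|).le
    linarith
  have hb : -(((n : ℝ) + 2 * γ) / 2) ≤ 0 := by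
    have : (0 : ℝ) ≤ n := n.cast_nonneg
    linarith
  rw [kernel_eq]
  refine (Real.rpow_le_rpow_of_nonpos (by positivity) hlow hb).trans (le_of_eq ?_)
  rw [Real.mul_rpow (Real.exp_pos _).le h0.le, ← Real.exp_mul]
  ring_nf

theorem integrable_exp_neg_mul_abs {a : ℝ} (ha : 0 < a) :
    Integrable fun t : ℝ => Real.exp (-a * |t|) := by
  rw [← integrableOn_univ, ← Set.Iic_union_Ioi (a := (0 : ℝ)), integrableOn_union]
  constructor
  · refine (integrableOn_exp_mul_Iic ha 0).congr_fun (fun t ht => ?_) measurableSet_Iic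
    have : t ≤ 0 := ht
    simp only
    rw [abs_of_nonpos this, neg_mul_neg]
  · refine (exp_neg_integrableOn_Ioi 0 ha).congr_fun (fun t ht => ?_) measurableSet_Ioi
    have : 0 < t := ht
    simp only
    rw [abs_of_pos this]

theorem lintegral_ball_rpow_ne_top {n : ℕ} (hn : 1 ≤ n) {s : ℝ} (hs : -(n : ℝ) < s) (R : ℝ)
    (hR : 0 < R) :
    ∫⁻ x : Eucl n in Metric.ball 0 R, ENNReal.ofReal (‖x‖ ^ s) ≠ ∞ := by
  have hdim : Module.finrank ℝ (Eucl n) = n := by simp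
  have : Nontrivial (Eucl n) := Module.nontrivial_of_finrank_pos (R := ℝ) (by rw [hdim]; omega)
  have h : IntegrableOn (fun x : Eucl n => ‖x‖ ^ s) (Metric.ball 0 R) := by
    rw [integrableOn_fun_norm_addHaar volume (f := fun y => y ^ s), hdim]
    have h1 : (-1 : ℝ) < n - 1 + s := by linarith
    refine ((intervalIntegral.integrableOn_Ioo_rpow_iff hR).2 h1).congr_fun (fun y hy => ?_)
      measurableSet_Ioo
    simp only [smul_eq_mul]
    rw [Real.rpow_add hy.1, ← Real.rpow_natCast, Nat.cast_sub hn, Nat.cast_one]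
  have h2 := h.2.ne
  exact fun h3 => h2 (Eq.trans (lintegral_congr fun x => Real.enorm_of_nonneg (by positivity)) h3)

/-- Weighted integrability of the kernel, uniformly in the direction. -/
theorem exists_lintegral_kernel_le {n : ℕ} (hn : 1 ≤ n) {γ : ℝ} (hγ0 : 0 < γ) (hγ1 : γ < 1)
    {ν : ℝ} (hν0 : 0 ≤ ν) (hν : ν < ((n : ℝ) + 2 * γ) / 2) :
    ∃ C : ℝ≥0∞, C ≠ ∞ ∧ ∀ e : Sph n,
      ∫⁻ z, ENNReal.ofReal (min 1 (z.1 ^ 2) * Real.exp (ν * |z.1|) * kernel n γ (0, e) z)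
        ∂cylMeasure n ≤ C := by
  set b := ((n : ℝ) + 2 * γ) / 2 with hb
  have hb0 : 0 < b := by linarith
  set C1 := ((1 - Real.exp (-1)) ^ 2) ^ (-b) with hC1
  have hC1' : 0 ≤ C1 := by positivity
  set C2 := Real.exp ν * Real.exp 1 ^ 2 * Real.exp b * Real.exp n with hC2
  set F : Eucl n → ℝ≥0∞ := (Metric.ball (0 : Eucl n) 4).indicator
    fun x => ENNReal.ofReal (C2 * ‖x‖ ^ (2 - 2 * b)) with hF
  have hFm : Measurable F := (by fun_prop : Measurable fun x : Eucl n =>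
    ENNReal.ofReal (C2 * ‖x‖ ^ (2 - 2 * b))).indicator measurableSet_ball
  -- For `|t| ≥ 1` the decay rate `b` of the kernel beats `ν`. For `|t| < 1` one has `|t| ≤ e |e -
  -- x|` (with the number `e` as factor), so `t² K` is of order `|e - x|^(2-n-2γ)`, integrable near
  -- the pole since `γ < 1`. Translation invariance of Lebesgue measure makes the bound independent
  -- of the direction.
  have hpt : ∀ (e : Sph n) (z : Cyl n),
      ENNReal.ofReal (min 1 (z.1 ^ 2) * Real.exp (ν * |z.1|) * kernel n γ (0, e) z) ≤
      ENNReal.ofReal (C1 * Real.exp (-(b - ν) * |z.1|)) +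
        ENNReal.ofReal (Real.exp (n * z.1)) * F (e - logPolar n z) := by
    intro e z
    have hk0 := kernel_nonneg (γ := γ) (0, e) z
    rcases le_or_gt 1 |z.1| with hz | hz
    · refine le_add_right (ENNReal.ofReal_le_ofReal ?_)
      calc _ ≤ 1 * Real.exp (ν * |z.1|) * (C1 * Real.exp (-b * |z.1|)) := by
            gcongr
            · exact min_le_left _ _
            · exact kernel_le_of_one_le_abs hγ0 e hz
        _ = C1 * (Real.exp (ν * |z.1|) * Real.exp (-b * |z.1|)) := by ring
        _ = _ := by rw [← Real.exp_add]; ring_nf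
    · refine le_add_left ?_
      set d := ‖(e : Eucl n) - logPolar n z‖ with hd
      have hd4 : d < 4 := by
        have h1 : d ≤ 1 + Real.exp z.1 := by
          have := norm_sub_le (e : Eucl n) (logPolar n z)
          rw [norm_logPolar] at this
          simpa using this
        have h2 : Real.exp z.1 ≤ Real.exp 1 := Real.exp_le_exp.2 ((le_abs_self _).trans hz.le)
        linarith [Real.exp_one_lt_d9]
      have hmem : (e : Eucl n) - logPolar n z ∈ Metric.ball (0 : Eucl n) 4 := by
        simpa using hd4
      rw [hF, Set.indicator_of_mem hmem, ← ENNReal.ofReal_mul (Real.exp_pos _).le, ← hd]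
      refine ENNReal.ofReal_le_ofReal ?_
      have ht : |z.1| ≤ Real.exp 1 * d := (abs_le_exp_mul_abs hz.le).trans
        (mul_le_mul_of_nonneg_left (abs_one_sub_exp_le e z) (Real.exp_pos _).le)
      rcases eq_or_lt_of_le (norm_nonneg ((e : Eucl n) - logPolar n z)) with h0 | h0
      · rw [← hd] at h0
        have : z.1 = 0 := by
          rw [← h0, mul_zero] at ht
          exact abs_nonpos_iff.1 ht
        rw [this]
        simp only [ne_eq, OfNat.ofNat_ne_zero, not_false_eq_true, zero_pow, zero_le_one,
          inf_of_le_right, zero_mul]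
        positivity
      · rw [← hd] at h0
        have hk : kernel n γ (0, e) z ≤ Real.exp b * d ^ (-(2 * b)) := by
          rw [kernel_eq_logPolar, ← hd, ← hb, show (n : ℝ) + 2 * γ = 2 * b by rw [hb]; ring]
          gcongr
          have := (le_abs_self z.1).trans hz.le
          nlinarith
        have hsq : min 1 (z.1 ^ 2) ≤ Real.exp 1 ^ 2 * d ^ 2 := by
          refine (min_le_right _ _).trans ?_
          rw [← mul_pow, ← sq_abs]
          gcongr
        -- The Jacobian `e^(nt)` is at least `e^(-n)` here; the factor `exp n` in `C2` pays for it.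
        have hn1 : 1 ≤ Real.exp (n * z.1) * Real.exp n := by
          rw [← Real.exp_add]
          refine Real.one_le_exp ?_
          have h5 := (abs_lt.1 hz).1
          have h6 : (0 : ℝ) ≤ n := n.cast_nonneg
          nlinarith
        have hdp : d ^ (2 - 2 * b) = d ^ 2 * d ^ (-(2 * b)) := by
          rw [sub_eq_add_neg, Real.rpow_add h0]
          norm_num
        calc _ ≤ (Real.exp 1 ^ 2 * d ^ 2) * Real.exp ν * (Real.exp b * d ^ (-(2 * b))) := by
              gcongr
              nlinarith
          _ = 1 * (Real.exp ν * Real.exp 1 ^ 2 * Real.exp b * d ^ (2 - 2 * b)) := by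
              rw [hdp]; ring
          _ ≤ (Real.exp (n * z.1) * Real.exp n) *
                (Real.exp ν * Real.exp 1 ^ 2 * Real.exp b * d ^ (2 - 2 * b)) := by
              gcongr
          _ = _ := by rw [hC2]; ring
  refine ⟨∫⁻ z, ENNReal.ofReal (C1 * Real.exp (-(b - ν) * |z.1|)) ∂cylMeasure n + ∫⁻ x, F x,
    ENNReal.add_ne_top.2 ⟨?_, ?_⟩, fun e => ?_⟩
  · have hm : Measurable fun t : ℝ => ENNReal.ofReal (C1 * Real.exp (-(b - ν) * |t|)) := by fun_prop
    have h1 : ∫⁻ t : ℝ, ENNReal.ofReal (C1 * Real.exp (-(b - ν) * |t|)) ≠ ∞ := by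
      have := ((integrable_exp_neg_mul_abs (sub_pos.2 hν)).const_mul C1).2.ne
      exact fun h3 =>
        this (Eq.trans (lintegral_congr fun x => Real.enorm_of_nonneg (by positivity)) h3)
    change ∫⁻ z : ℝ × Sph n, ENNReal.ofReal (C1 * Real.exp (-(b - ν) * |z.1|))
      ∂(volume.prod (volume : Measure (Eucl n)).toSphere) ≠ ∞
    have h2 := lintegral_prod_mul (μ := (volume : Measure ℝ))
      (ν := (volume : Measure (Eucl n)).toSphere) (g := fun _ => 1) hm.aemeasurable
      aemeasurable_const
    simp only [mul_one, lintegral_const, one_mul] at h2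
    rw [h2]
    exact ENNReal.mul_ne_top h1 (measure_ne_top _ _)
  · rw [hF, lintegral_indicator measurableSet_ball]
    have hC20 : 0 ≤ C2 := by positivity
    simp_rw [ENNReal.ofReal_mul hC20]
    rw [lintegral_const_mul _ (by fun_prop)]
    refine ENNReal.mul_ne_top ENNReal.ofReal_ne_top (lintegral_ball_rpow_ne_top hn ?_ 4 (by norm_num))
    rw [hb]; linarith
  · refine (lintegral_mono (hpt e)).trans ?_
    rw [lintegral_add_left (by fun_prop), lintegral_logPolar hn (F := fun x => F (e - x))
      (hFm.comp (measurable_const.sub measurable_id)), lintegral_sub_left_eq_self]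

/-! ### The kernel of the energy on radial functions -/

/-- The kernel of the energy on functions of `t` only. -/
def radKernel (n : ℕ) (γ : ℝ) (t : ℝ) : ℝ≥0∞ :=
  ∫⁻ θ, ∫⁻ θ', ENNReal.ofReal (kernel n γ (0, θ) (t, θ'))
    ∂(volume : Measure (Eucl n)).toSphere ∂(volume : Measure (Eucl n)).toSphere

theorem measurable_radKernel (n : ℕ) (γ : ℝ) : Measurable (radKernel n γ) := by
  have hk := measurable_kernel n γ
  have h1 : Measurable fun q : (ℝ × Sph n) × Sph n =>
      ENNReal.ofReal (kernel n γ (0, q.1.2) (q.1.1, q.2)) :=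
    (hk.comp (f := fun q : (ℝ × Sph n) × Sph n =>
      (((0, q.1.2), (q.1.1, q.2)) : Cyl n × Cyl n)) (by fun_prop)).ennreal_ofReal
  exact (h1.lintegral_prod_right' (ν := (volume : Measure (Eucl n)).toSphere)).lintegral_prod_right'
    (ν := (volume : Measure (Eucl n)).toSphere)

/-- The value `t = 0` is excluded because on the diagonal the base is zero, and a negative real
power of zero is `0` in Lean. -/
theorem kernel_anti {n : ℕ} {γ : ℝ} (hγ : 0 < γ) {t s : ℝ} (ht : t ≠ 0) (hts : |t| ≤ |s|)
    (θ θ' : Sph n) : kernel n γ (0, θ) (s, θ') ≤ kernel n γ (0, θ) (t, θ') := by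
  have hb : -(((n : ℝ) + 2 * γ) / 2) ≤ 0 := by
    have : (0 : ℝ) ≤ n := n.cast_nonneg
    linarith
  have h1 : 1 < Real.cosh t := Real.one_lt_cosh.2 ht
  have h2 : Real.cosh t ≤ Real.cosh s := Real.cosh_le_cosh.2 hts
  have h3 := inner_sph_le_one θ θ'
  simp only [kernel_eq, zero_sub, Real.cosh_neg]
  exact Real.rpow_le_rpow_of_nonpos (by linarith) (by linarith) hb

theorem radKernel_anti {n : ℕ} {γ : ℝ} (hγ : 0 < γ) {t s : ℝ} (ht : t ≠ 0) (hts : |t| ≤ |s|) :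
    radKernel n γ s ≤ radKernel n γ t :=
  lintegral_mono fun θ => lintegral_mono fun θ' =>
    ENNReal.ofReal_le_ofReal (kernel_anti hγ ht hts θ θ')

theorem lintegral_mul_lintegral_lintegral {S : Type*} [MeasurableSpace S] {σ : Measure S}
    [SFinite σ] {K : S → ℝ → S → ℝ≥0∞} (hK : Measurable fun q : (S × ℝ) × S => K q.1.1 q.1.2 q.2)
    {g : ℝ → ℝ≥0∞} (hg : Measurable g) :
    ∫⁻ t, g t * ∫⁻ θ, ∫⁻ θ', K θ t θ' ∂σ ∂σ =
      ∫⁻ θ, ∫⁻ z, g z.1 * K θ z.1 z.2 ∂((volume : Measure ℝ).prod σ) ∂σ := by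
  have h2 : Measurable fun q : S × ℝ => ∫⁻ θ', K q.1 q.2 θ' ∂σ := hK.lintegral_prod_right'
  have h3 : ∀ θ, ∫⁻ z, g z.1 * K θ z.1 z.2 ∂((volume : Measure ℝ).prod σ) =
      ∫⁻ t, g t * ∫⁻ θ', K θ t θ' ∂σ := by
    intro θ
    have hm : Measurable fun z : ℝ × S => g z.1 * K θ z.1 z.2 :=
      (hg.comp measurable_fst).mul (hK.comp (f := fun z : ℝ × S => ((θ, z.1), z.2)) (by fun_prop))
    rw [lintegral_prod _ hm.aemeasurable]
    refine lintegral_congr fun t => lintegral_const_mul (g t) ?_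
    exact hK.comp (f := fun θ' : S => ((θ, t), θ')) (by fun_prop)
  simp_rw [h3]
  rw [lintegral_lintegral_swap]
  · refine lintegral_congr fun t => ?_
    rw [lintegral_const_mul]
    exact h2.comp (f := fun θ : S => (θ, t)) (by fun_prop)
  · exact ((hg.comp measurable_snd).mul h2).aemeasurable

theorem lintegral_mul_radKernel (n : ℕ) (γ : ℝ) {g : ℝ → ℝ≥0∞} (hg : Measurable g) :
    ∫⁻ t, g t * radKernel n γ t =
      ∫⁻ θ, ∫⁻ z, g z.1 * ENNReal.ofReal (kernel n γ (0, θ) z) ∂cylMeasure n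
        ∂(volume : Measure (Eucl n)).toSphere :=
  lintegral_mul_lintegral_lintegral
    (K := fun θ t θ' => ENNReal.ofReal (kernel n γ (0, θ) (t, θ')))
    ((measurable_kernel n γ).comp (f := fun q : (Sph n × ℝ) × Sph n =>
      (((0, q.1.1), (q.1.2, q.2)) : Cyl n × Cyl n)) (by fun_prop)).ennreal_ofReal hg

theorem exp_sub_one_le (x : ℝ) : Real.exp x - 1 ≤ x * Real.exp x := by
  have h1 := Real.add_one_le_exp (-x)
  have h2 : Real.exp x * Real.exp (-x) = 1 := by rw [← Real.exp_add]; simp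
  nlinarith [Real.exp_pos x]

/-- Lower bound for the mass of the kernel in a dyadic annulus. -/
theorem lintegral_kernel_annulus_ge {n : ℕ} (hn : 1 ≤ n) {γ : ℝ} (hγ : 0 < γ) {h : ℝ} (h0 : 0 < h)
    (h1 : h ≤ 1) (θ : Sph n) :
    ENNReal.ofReal (Real.exp (-(2 * n)) * (8 * h) ^ (-((n : ℝ) + 2 * γ)) * (h / 2) ^ n) *
        volume (Metric.ball (0 : Eucl n) 1) ≤
      ∫⁻ z, (Set.Ioo h (2 * h)).indicator 1 z.1 * ENNReal.ofReal (kernel n γ (0, θ) z)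
        ∂cylMeasure n := by
  have hdim : Module.finrank ℝ (Eucl n) = n := by simp
  have : Nontrivial (Eucl n) := Module.nontrivial_of_finrank_pos (R := ℝ) (by rw [hdim]; omega)
  set a := Real.exp (-(2 * n)) * (8 * h) ^ (-((n : ℝ) + 2 * γ)) with ha
  have ha0 : 0 ≤ a := by positivity
  -- The ball of radius `h/2` about `x0` lies in the shell `h < t < 2h`, since `e^(h/2) - 1 ≥ h/2`.
  -- It also lies within `8h` of `θ`: `e^(3h/2) - 1 ≤ (3h/2) · 5`, plus `h/2`.
  set x0 : Eucl n := Real.exp (3 / 2 * h) • (θ : Eucl n) with hx0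
  have hθ : ‖(θ : Eucl n)‖ = 1 := by simp
  have hx0n : ‖x0‖ = Real.exp (3 / 2 * h) := by
    rw [hx0, norm_smul, hθ, mul_one, Real.norm_of_nonneg (Real.exp_pos _).le]
  have hhalf := Real.add_one_le_exp (h / 2)
  have e1 : Real.exp (3 / 2 * h) = Real.exp h * Real.exp (h / 2) := by
    rw [← Real.exp_add]; ring_nf
  have e2 : Real.exp (2 * h) = Real.exp (3 / 2 * h) * Real.exp (h / 2) := by
    rw [← Real.exp_add]; ring_nf
  have e3 : 1 < Real.exp h := Real.one_lt_exp_iff.2 h0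
  have e4 : 1 < Real.exp (3 / 2 * h) := Real.one_lt_exp_iff.2 (by positivity)
  have hpt : ∀ z : Cyl n, ENNReal.ofReal (Real.exp (n * z.1)) *
      (Metric.ball x0 (h / 2)).indicator (fun _ => ENNReal.ofReal a) (logPolar n z) ≤
      (Set.Ioo h (2 * h)).indicator 1 z.1 * ENNReal.ofReal (kernel n γ (0, θ) z) := by
    intro z
    by_cases hz : logPolar n z ∈ Metric.ball x0 (h / 2)
    · rw [Set.indicator_of_mem hz, ← ENNReal.ofReal_mul (Real.exp_pos _).le]
      rw [mem_ball_iff_norm] at hz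
      have hr := (abs_norm_sub_norm_le (logPolar n z) x0).trans_lt hz
      rw [norm_logPolar, hx0n, abs_lt] at hr
      have hzmem : z.1 ∈ Set.Ioo h (2 * h) := by
        constructor
        · refine Real.exp_lt_exp.1 ?_
          nlinarith
        · refine Real.exp_lt_exp.1 ?_
          nlinarith
      rw [Set.indicator_of_mem hzmem, Pi.one_apply, one_mul]
      refine ENNReal.ofReal_le_ofReal ?_
      have hd0 : 0 < ‖(θ : Eucl n) - logPolar n z‖ := by
        refine lt_of_lt_of_le ?_ (abs_one_sub_exp_le θ z)
        rw [abs_pos]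
        have : 1 < Real.exp z.1 := Real.one_lt_exp_iff.2 (h0.trans hzmem.1)
        linarith
      have hd8 : ‖(θ : Eucl n) - logPolar n z‖ ≤ 8 * h := by
        have t1 : ‖(θ : Eucl n) - x0‖ = Real.exp (3 / 2 * h) - 1 := by
          have : (θ : Eucl n) - x0 = (1 - Real.exp (3 / 2 * h)) • (θ : Eucl n) := by
            rw [hx0, sub_smul, one_smul]
          rw [this, norm_smul, hθ, mul_one, Real.norm_eq_abs, abs_sub_comm, abs_of_nonneg]
          linarith [Real.add_one_le_exp (3 / 2 * h)]
        have t2 := exp_sub_one_le (3 / 2 * h)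
        have t3 : Real.exp (3 / 2 * h) ≤ 5 := by
          have : Real.exp (3 / 2 * h) ≤ Real.exp (3 / 2) := Real.exp_le_exp.2 (by linarith)
          refine this.trans ?_
          have t4 : Real.exp (3 / 2) ^ 2 = Real.exp 1 ^ 3 := by
            rw [← Real.exp_nat_mul, ← Real.exp_nat_mul]; norm_num
          have t5 : Real.exp 1 ^ 3 ≤ 2.7182818286 ^ 3 := by
            gcongr; exact Real.exp_one_lt_d9.le
          nlinarith [Real.exp_pos (3 / 2)]
        have t6 := norm_sub_le_norm_sub_add_norm_sub (θ : Eucl n) x0 (logPolar n z)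
        rw [t1, norm_sub_rev x0] at t6
        nlinarith
      have hs : -((n : ℝ) + 2 * γ) ≤ 0 := by
        have : (0 : ℝ) ≤ n := n.cast_nonneg
        linarith
      have hz0 : 0 < z.1 := h0.trans hzmem.1
      rw [kernel_eq_logPolar]
      calc Real.exp (n * z.1) * a
          = (Real.exp (n * z.1) * Real.exp (-(2 * n))) * (8 * h) ^ (-((n : ℝ) + 2 * γ)) := by
            rw [ha]; ring
        _ ≤ 1 * ‖(θ : Eucl n) - logPolar n z‖ ^ (-((n : ℝ) + 2 * γ)) := by
            gcongr ?_ * ?_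
            · rw [← Real.exp_add, Real.exp_le_one_iff]
              have : (0 : ℝ) ≤ n := n.cast_nonneg
              nlinarith [hzmem.2]
            · exact Real.rpow_le_rpow_of_nonpos hd0 hd8 hs
        _ ≤ _ := by
            gcongr
            refine Real.one_le_exp ?_
            have : (0 : ℝ) ≤ n := n.cast_nonneg
            positivity
    · rw [Set.indicator_of_notMem hz, mul_zero]
      exact zero_le
  refine le_trans (le_of_eq ?_) (lintegral_mono hpt)
  rw [lintegral_logPolar hn (measurable_const.indicator measurableSet_ball),
    lintegral_indicator measurableSet_ball, setLIntegral_const,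
    Measure.addHaar_ball volume x0 (by positivity), hdim, ← mul_assoc, ← ENNReal.ofReal_mul ha0]

theorem toSphere_univ_ne_zero {n : ℕ} (hn : 1 ≤ n) :
    (volume : Measure (Eucl n)).toSphere Set.univ ≠ 0 := by
  have hdim : Module.finrank ℝ (Eucl n) = n := by simp
  have : Nontrivial (Eucl n) := Module.nontrivial_of_finrank_pos (R := ℝ) (by rw [hdim]; omega)
  rw [Ne, Measure.measure_univ_eq_zero]
  exact Measure.toSphere_ne_zero _

/-- The mass of the radial kernel on `(h, 2h)` is at least of order `h^(-n-2γ) h^n = h · h^(-1-2γ)`.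
By monotonicity it is at most `h` times the value at any `τ ≠ 0` with `|τ| ≤ h`. -/
theorem exists_isSingular_radKernel {n : ℕ} (hn : 1 ≤ n) {γ : ℝ} (hγ : 0 < γ) :
    ∃ c : ℝ≥0∞, c ≠ 0 ∧ c ≠ ∞ ∧ IsSingular (radKernel n γ) γ c := by
  set σ := (volume : Measure (Eucl n)).toSphere with hσ
  set a := Real.exp (-(2 * n)) * 8 ^ (-((n : ℝ) + 2 * γ)) * (1 / 2) ^ n with ha
  have ha0 : 0 < a := by positivity
  have hball : volume (Metric.ball (0 : Eucl n) 1) ≠ 0 :=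
    (Metric.measure_ball_pos volume _ one_pos).ne'
  refine ⟨ENNReal.ofReal a * volume (Metric.ball (0 : Eucl n) 1) * σ Set.univ,
    mul_ne_zero (mul_ne_zero (by simpa using ha0) hball) (toSphere_univ_ne_zero hn),
    ENNReal.mul_ne_top (ENNReal.mul_ne_top ENNReal.ofReal_ne_top measure_ball_lt_top.ne)
      (measure_ne_top _ _), fun h h0 h1 τ hτ0 hτ => ?_⟩
  have hh : ENNReal.ofReal h ≠ 0 := by simpa using h0
  have hm : Measurable ((Set.Ioo h (2 * h)).indicator (1 : ℝ → ℝ≥0∞)) :=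
    measurable_one.indicator measurableSet_Ioo
  have hup : ∫⁻ t, (Set.Ioo h (2 * h)).indicator (1 : ℝ → ℝ≥0∞) t * radKernel n γ t ≤
      ENNReal.ofReal h * radKernel n γ τ := by
    calc _ ≤ ∫⁻ t, (Set.Ioo h (2 * h)).indicator (fun _ => radKernel n γ τ) t := by
          refine lintegral_mono fun t => ?_
          by_cases ht : t ∈ Set.Ioo h (2 * h)
          · simp only [Set.indicator_of_mem ht, Pi.one_apply, one_mul]
            refine radKernel_anti hγ hτ0 (hτ.trans (ht.1.le.trans (le_abs_self _)))
          · simp [Set.indicator_of_notMem ht]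
      _ = _ := by
          rw [lintegral_indicator measurableSet_Ioo, setLIntegral_const, Real.volume_Ioo, mul_comm]
          congr 2
          ring
  have hpow : Real.exp (-(2 * n)) * (8 * h) ^ (-((n : ℝ) + 2 * γ)) * (h / 2) ^ n =
      h * (a * h ^ (-(1 + 2 * γ))) := by
    have e1 : h * h ^ (-(1 + 2 * γ)) = h ^ (-((n : ℝ) + 2 * γ)) * h ^ n := by
      rw [← Real.rpow_natCast, ← Real.rpow_add h0]
      nth_rewrite 1 [← Real.rpow_one h]
      rw [← Real.rpow_add h0]
      congr 1
      ring
    rw [Real.mul_rpow (by norm_num) h0.le, div_pow, ha, one_div, inv_pow]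
    linear_combination (-Real.exp (-(2 * n)) * 8 ^ (-((n : ℝ) + 2 * γ)) * ((2 : ℝ) ^ n)⁻¹) * e1
  have hlow : ENNReal.ofReal h * (ENNReal.ofReal a * volume (Metric.ball (0 : Eucl n) 1) *
      σ Set.univ * ENNReal.ofReal (h ^ (-(1 + 2 * γ)))) ≤
      ENNReal.ofReal h * radKernel n γ τ := by
    refine le_trans ?_ hup
    rw [lintegral_mul_radKernel n γ hm]
    calc _ = ∫⁻ _ : Sph n, ENNReal.ofReal (Real.exp (-(2 * n)) * (8 * h) ^ (-((n : ℝ) + 2 * γ)) *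
            (h / 2) ^ n) * volume (Metric.ball (0 : Eucl n) 1) ∂σ := by
          rw [lintegral_const, hpow, ENNReal.ofReal_mul h0.le, ENNReal.ofReal_mul ha0.le]
          ring
      _ ≤ _ := lintegral_mono fun θ => lintegral_kernel_annulus_ge hn hγ h0 h1 θ
  exact (ENNReal.mul_le_mul_iff_right hh ENNReal.ofReal_ne_top).1 hlow

theorem lintegral_prod_eq_gagliardo {S : Type*} [MeasurableSpace S] {σ : Measure S} [SFinite σ]
    {K : S → ℝ → S → ℝ≥0∞} (hK : Measurable fun q : (S × ℝ) × S => K q.1.1 q.1.2 q.2)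
    {H : ℝ × ℝ → ℝ≥0∞} (hH : Measurable H) :
    ∫⁻ q : (ℝ × S) × (ℝ × S), K q.1.2 (q.1.1 - q.2.1) q.2.2 * H (q.1.1, q.2.1)
        ∂(((volume : Measure ℝ).prod σ).prod ((volume : Measure ℝ).prod σ)) =
      ∫⁻ q : ℝ × ℝ, (∫⁻ θ, ∫⁻ θ', K θ (q.1 - q.2) θ' ∂σ ∂σ) * H q := by
  have hm : Measurable fun q : (ℝ × S) × (ℝ × S) =>
      K q.1.2 (q.1.1 - q.2.1) q.2.2 * H (q.1.1, q.2.1) :=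
    (hK.comp (f := fun q : (ℝ × S) × (ℝ × S) => ((q.1.2, q.1.1 - q.2.1), q.2.2))
      (by fun_prop)).mul (hH.comp (by fun_prop))
  have hK2 : Measurable fun q : S × ℝ => ∫⁻ θ', K q.1 q.2 θ' ∂σ := hK.lintegral_prod_right'
  have hk : Measurable fun t : ℝ => ∫⁻ θ, ∫⁻ θ', K θ t θ' ∂σ ∂σ := hK2.lintegral_prod_left'
  have hm2 : Measurable fun q : ℝ × ℝ => (∫⁻ θ, ∫⁻ θ', K θ (q.1 - q.2) θ' ∂σ ∂σ) * H q :=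
    (hk.comp (f := fun q : ℝ × ℝ => q.1 - q.2) (by fun_prop)).mul hH
  rw [lintegral_prod _ hm.aemeasurable, lintegral_prod _ hm.lintegral_prod_right'.aemeasurable,
    Measure.volume_eq_prod, lintegral_prod _ hm2.aemeasurable]
  refine lintegral_congr fun t => ?_
  have := lintegral_mul_lintegral_lintegral (σ := σ) (K := fun θ s θ' => K θ (t - s) θ')
    (hK.comp (f := fun q : (S × ℝ) × S => ((q.1.1, t - q.1.2), q.2)) (by fun_prop))
    (g := fun s => H (t, s)) (hH.comp (by fun_prop))
  simp_rw [mul_comm _ (H _)]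
  exact this.symm

theorem lintegral_energyDensity (n : ℕ) (γ : ℝ) {f : ℝ → ℝ} (hf : Measurable f) :
    ∫⁻ q, ENNReal.ofReal (energyDensity n γ (fun z => f z.1) q)
        ∂((cylMeasure n).prod (cylMeasure n)) = gagliardo (radKernel n γ) f := by
  have hK : Measurable fun q : (Sph n × ℝ) × Sph n =>
      ENNReal.ofReal (kernel n γ (0, q.1.1) (q.1.2, q.2)) :=
    ((measurable_kernel n γ).comp (f := fun q : (Sph n × ℝ) × Sph n =>
      (((0, q.1.1), (q.1.2, q.2)) : Cyl n × Cyl n)) (by fun_prop)).ennreal_ofReal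
  have := lintegral_prod_eq_gagliardo (σ := (volume : Measure (Eucl n)).toSphere)
    (K := fun θ t θ' => ENNReal.ofReal (kernel n γ (0, θ) (t, θ'))) hK
    (H := fun q => ‖f q.1 - f q.2‖ₑ ^ (2 : ℝ)) (by fun_prop)
  refine Eq.trans (lintegral_congr fun q => ?_) this
  rw [energyDensity, ENNReal.ofReal_mul (kernel_nonneg _ _), ← kernel_eq_of_sub]
  congr 1
  rw [← sq_abs, ENNReal.ofReal_pow (abs_nonneg _), ENNReal.rpow_two, ← Real.enorm_eq_ofReal_abs]

/-! ### A test function of finite energy -/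

/-- A Lipschitz function of compact support. -/
def hat (t : ℝ) : ℝ := max 0 (1 - |t|)

theorem continuous_hat : Continuous hat := by unfold hat; fun_prop

theorem hat_sub_sq_le (t s : ℝ) : (hat t - hat s) ^ 2 ≤ min 1 ((t - s) ^ 2) := by
  have h01 : ∀ x, 0 ≤ hat x ∧ hat x ≤ 1 := fun x =>
    ⟨le_max_left _ _, max_le zero_le_one (by linarith [abs_nonneg x])⟩
  refine le_min ?_ ?_
  · have h1 := h01 t
    have h2 := h01 s
    rw [sq_le_one_iff_abs_le_one, abs_le]
    constructor <;> linarith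
  · rw [sq_le_sq]
    have h1 : |hat t - hat s| ≤ |(1 - |t|) - (1 - |s|)| := by
      unfold hat
      have := abs_max_sub_max_le_max 0 (1 - |t|) 0 (1 - |s|)
      simpa using this
    refine h1.trans ?_
    rw [sub_sub_sub_cancel_left, abs_sub_comm]
    exact abs_abs_sub_abs_le _ _

theorem lintegral_min_mul_radKernel_ne_top {n : ℕ} (hn : 1 ≤ n) {γ : ℝ} (hγ0 : 0 < γ)
    (hγ1 : γ < 1) :
    ∫⁻ t, ENNReal.ofReal (min 1 (t ^ 2)) * radKernel n γ t ≠ ∞ := by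
  obtain ⟨C, hC, hCe⟩ := exists_lintegral_kernel_le hn hγ0 hγ1 le_rfl
    (ν := 0) (by have : (0 : ℝ) ≤ n := n.cast_nonneg
                 linarith)
  rw [lintegral_mul_radKernel n γ (g := fun t => ENNReal.ofReal (min 1 (t ^ 2))) (by fun_prop)]
  refine ne_top_of_le_ne_top (ENNReal.mul_ne_top hC
    (measure_ne_top (volume : Measure (Eucl n)).toSphere Set.univ)) ?_
  rw [← lintegral_const]
  refine lintegral_mono fun θ => le_trans (le_of_eq (lintegral_congr fun z => ?_)) (hCe θ)
  rw [← ENNReal.ofReal_mul (by positivity)]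
  simp

/-- This makes the infimum of the energy finite. The integrand is at most `w(t - s)` and vanishes
unless `t` or `s` lies in `[-1, 1]`; each case integrates to the length of the interval times `∫ w`.
-/
theorem gagliardo_hat_ne_top {k : ℝ → ℝ≥0∞} (hk : Measurable k)
    (hfin : ∫⁻ t, ENNReal.ofReal (min 1 (t ^ 2)) * k t ≠ ∞) : gagliardo k hat ≠ ∞ := by
  set I := Set.Icc (-1 : ℝ) 1 with hI
  set w : ℝ → ℝ≥0∞ := fun t => ENNReal.ofReal (min 1 (t ^ 2)) * k t with hw
  have hwm : Measurable w := by fun_prop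
  have hIm : Measurable (I.indicator (1 : ℝ → ℝ≥0∞)) := measurable_one.indicator measurableSet_Icc
  have hzero : ∀ t, t ∉ I → hat t = 0 := by
    intro t ht
    refine max_eq_left ?_
    by_contra! hcon
    exact ht (abs_le.1 (by linarith))
  have hpt : ∀ q : ℝ × ℝ, k (q.1 - q.2) * ‖hat q.1 - hat q.2‖ₑ ^ (2 : ℝ) ≤
      I.indicator 1 q.1 * w (q.1 - q.2) + I.indicator 1 q.2 * w (q.1 - q.2) := by
    intro q
    have h1 : ‖hat q.1 - hat q.2‖ₑ ^ (2 : ℝ) ≤ ENNReal.ofReal (min 1 ((q.1 - q.2) ^ 2)) := by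
      rw [Real.enorm_eq_ofReal_abs, ENNReal.rpow_two, ← ENNReal.ofReal_pow (abs_nonneg _), sq_abs]
      exact ENNReal.ofReal_le_ofReal (hat_sub_sq_le _ _)
    have h2 : k (q.1 - q.2) * ‖hat q.1 - hat q.2‖ₑ ^ (2 : ℝ) ≤ w (q.1 - q.2) := by
      rw [hw, mul_comm]
      dsimp only
      gcongr
    by_cases hq1 : q.1 ∈ I
    · refine le_add_right ?_
      rw [Set.indicator_of_mem hq1, Pi.one_apply, one_mul]
      exact h2
    by_cases hq2 : q.2 ∈ I
    · refine le_add_left ?_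
      rw [Set.indicator_of_mem hq2, Pi.one_apply, one_mul]
      exact h2
    rw [hzero _ hq1, hzero _ hq2]
    simp
  have hIv : volume I ≠ ∞ := by simp [hI]
  have hm1 : Measurable fun q : ℝ × ℝ => I.indicator 1 q.1 * w (q.1 - q.2) :=
    (hIm.comp measurable_fst).mul (by fun_prop)
  have hm2 : Measurable fun q : ℝ × ℝ => I.indicator 1 q.2 * w (q.1 - q.2) :=
    (hIm.comp measurable_snd).mul (by fun_prop)
  refine ne_top_of_le_ne_top ?_ (lintegral_mono hpt)
  have hone : ∫⁻ t, I.indicator (1 : ℝ → ℝ≥0∞) t * ∫⁻ u, w u ≠ ∞ := by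
    rw [lintegral_mul_const _ hIm, lintegral_indicator_one measurableSet_Icc]
    exact ENNReal.mul_ne_top hIv hfin
  rw [lintegral_add_left hm1, Measure.volume_eq_prod]
  refine ENNReal.add_ne_top.2 ⟨?_, ?_⟩
  · rw [lintegral_prod _ hm1.aemeasurable]
    refine ne_of_eq_of_ne (lintegral_congr fun t => ?_) hone
    refine (lintegral_const_mul (I.indicator 1 t) (f := fun s => w (t - s)) (by fun_prop)).trans ?_
    rw [lintegral_sub_left_eq_self]
  · rw [lintegral_prod_symm _ hm2.aemeasurable]
    refine ne_of_eq_of_ne (lintegral_congr fun s => ?_) hone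
    refine (lintegral_const_mul (I.indicator 1 s) (f := fun t => w (t - s)) (by fun_prop)).trans ?_
    rw [lintegral_sub_right_eq_self]

theorem lpPow_hat : lpPow 2 hat ≠ 0 ∧ lpPow 2 hat ≠ ∞ := by
  constructor
  · rw [Ne, lpPow_eq_zero_iff two_pos continuous_hat.measurable,
      continuous_hat.ae_eq_iff_eq volume continuous_zero]
    intro h
    have := congrFun h 0
    simp [hat] at this
  · have hle : ∀ t, ‖hat t‖ₑ ^ (2 : ℝ) ≤ (Set.Icc (-1 : ℝ) 1).indicator 1 t := by
      intro t
      have h0 : 0 ≤ hat t := le_max_left _ _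
      by_cases ht : t ∈ Set.Icc (-1 : ℝ) 1
      · rw [Set.indicator_of_mem ht, Pi.one_apply]
        refine ENNReal.rpow_le_one ?_ (by norm_num)
        rw [Real.enorm_of_nonneg h0, ENNReal.ofReal_le_one]
        exact max_le zero_le_one (by linarith [abs_nonneg t])
      · have : hat t = 0 := by
          refine max_eq_left ?_
          by_contra! hcon
          exact ht (abs_le.1 (by linarith))
        rw [this]
        simp
    refine ne_top_of_le_ne_top ?_ (lintegral_mono hle)
    rw [lintegral_indicator_one measurableSet_Icc]
    simp

/-! ### Positivity of the constant `κ` -/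

/-- The reflection `(t, θ) ↦ (-t, θ)` of the cylinder. -/
def cylRefl (n : ℕ) : Cyl n ≃ₜ Cyl n := (Homeomorph.neg ℝ).prodCongr (Homeomorph.refl _)

theorem measurePreserving_cylRefl (n : ℕ) :
    MeasurePreserving (cylRefl n) (cylMeasure n) (cylMeasure n) :=
  (Measure.measurePreserving_neg (volume : Measure ℝ)).prod
    (MeasurePreserving.id (volume : Measure (Eucl n)).toSphere)

/-- The reflection is the inversion `x ↦ x/|x|²`, and this is its distance identity relative to a
fixed unit vector. -/
theorem norm_sub_logPolar_cylRefl {n : ℕ} (e : Sph n) (z : Cyl n) :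
    ‖logPolar n z‖ * ‖(e : Eucl n) - logPolar n (cylRefl n z)‖ = ‖(e : Eucl n) - logPolar n z‖ := by
  have h1 := norm_sub_logPolar_sq e z
  have h2 := norm_sub_logPolar_sq e (cylRefl n z)
  have h3 : (cylRefl n z).1 = -z.1 := rfl
  have h4 : (cylRefl n z).2 = z.2 := rfl
  have h5 : Real.exp z.1 * Real.exp (-z.1) = 1 := by rw [← Real.exp_add]; simp
  rw [h3, h4, Real.cosh_neg] at h2
  refine (sq_eq_sq₀ (by positivity) (norm_nonneg _)).1 ?_
  rw [mul_pow, h1, h2, norm_logPolar]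
  linear_combination (Real.exp z.1 * (2 * Real.cosh z.1 - 2 * inner ℝ (e : Eucl n) (z.2 : Eucl n))) * h5

/-- The integrand of `κ`, with `e` in place of `e₁`. -/
def kappaIntegrand (n : ℕ) (γ α : ℝ) (e ζ : Eucl n) : ℝ :=
  (1 - ‖ζ‖ ^ (-nu n γ α)) / (‖e - ζ‖ ^ ((n : ℝ) + 2 * γ) * ‖ζ‖ ^ α)

theorem measurable_kappaIntegrand (n : ℕ) (γ α : ℝ) (e : Eucl n) :
    Measurable (kappaIntegrand n γ α e) := by
  unfold kappaIntegrand
  fun_prop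

/-- The integrand of `κ` in logarithmic polar coordinates. -/
def kappaCyl (n : ℕ) (γ α : ℝ) (e : Sph n) (z : Cyl n) : ℝ :=
  (Real.exp (nu n γ α * z.1) - 1) * kernel n γ (0, e) z

theorem measurable_kernel_left {n : ℕ} {γ : ℝ} (z : Cyl n) : Measurable (kernel n γ z) :=
  (measurable_kernel n γ).comp (measurable_const.prodMk measurable_id)

theorem measurable_kappaCyl (n : ℕ) (γ α : ℝ) (e : Sph n) : Measurable (kappaCyl n γ α e) := by
  have := measurable_kernel_left (γ := γ) ((0 : ℝ), e)
  unfold kappaCyl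
  fun_prop

/-- The exponents match because `n - α = (n + 2γ)/2 + ν`; then `e^(νt) (1 - e^(-νt)) = e^(νt) - 1`.
-/
theorem exp_mul_kappaIntegrand {n : ℕ} {γ α : ℝ} (e : Sph n) (z : Cyl n) :
    Real.exp (n * z.1) * kappaIntegrand n γ α e (logPolar n z) = kappaCyl n γ α e z := by
  have h1 : Real.exp (n * z.1) = Real.exp (((n : ℝ) + 2 * γ) / 2 * z.1) *
      Real.exp (nu n γ α * z.1) * Real.exp (z.1 * α) := by
    rw [← Real.exp_add, ← Real.exp_add, nu]
    ring_nf
  have h2 : Real.exp (nu n γ α * z.1) * Real.exp (z.1 * (-nu n γ α)) = 1 := by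
    rw [← Real.exp_add]; ring_nf; simp
  rw [kappaIntegrand, kappaCyl, kernel_eq_logPolar, norm_logPolar, ← Real.exp_mul, ← Real.exp_mul,
    Real.rpow_neg (norm_nonneg _), div_mul_eq_div_div, h1, div_eq_mul_inv (_ / _),
    div_eq_mul_inv (1 - _)]
  have h3 : Real.exp (z.1 * α) * (Real.exp (z.1 * α))⁻¹ = 1 :=
    mul_inv_cancel₀ (Real.exp_pos _).ne'
  generalize (‖(e : Eucl n) - logPolar n z‖ ^ ((n : ℝ) + 2 * γ))⁻¹ = D
  generalize Real.exp (((n : ℝ) + 2 * γ) / 2 * z.1) = B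
  linear_combination B * D * (Real.exp (nu n γ α * z.1)
    - Real.exp (nu n γ α * z.1) * Real.exp (z.1 * (-nu n γ α))) * h3 - B * D * h2

theorem setIntegral_kappaIntegrand {n : ℕ} (hn : 1 ≤ n) {γ α : ℝ} (e : Sph n) {s : Set (Eucl n)}
    (hs : MeasurableSet s) :
    ∫ ζ in s, kappaIntegrand n γ α e ζ =
      ∫ z in logPolar n ⁻¹' s, kappaCyl n γ α e z ∂cylMeasure n := by
  rw [← integral_indicator hs, integral_logPolar hn ((measurable_kappaIntegrand n γ α e).indicator hs),
    ← integral_indicator ((continuous_logPolar n).measurable hs)]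
  refine integral_congr_ae (Eventually.of_forall fun z => ?_)
  by_cases hz : logPolar n z ∈ s
  · simp only
    rw [Set.indicator_of_mem hz, Set.indicator_of_mem (show z ∈ logPolar n ⁻¹' s from hz),
      exp_mul_kappaIntegrand]
  · simp only
    rw [Set.indicator_of_notMem hz, Set.indicator_of_notMem (show z ∉ logPolar n ⁻¹' s from hz),
      mul_zero]

theorem two_mul_cosh_sub_two_le (x : ℝ) :
    Real.exp x + Real.exp (-x) - 2 ≤ x ^ 2 * Real.exp |x| := by
  wlog hx : 0 ≤ x generalizing x
  · have := this (-x) (by linarith)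
    rw [neg_neg, abs_neg, neg_sq] at this
    linarith
  rw [abs_of_nonneg hx]
  have h1 : Real.exp x * Real.exp (-x) = 1 := by rw [← Real.exp_add]; simp
  have h2 := exp_sub_one_le x
  have h3 : 0 ≤ Real.exp x - 1 := by linarith [Real.add_one_le_exp x]
  have h4 : (Real.exp x - 1) ^ 2 ≤ (x * Real.exp x) ^ 2 := by gcongr
  have h5 : Real.exp x + Real.exp (-x) - 2 = Real.exp (-x) * (Real.exp x - 1) ^ 2 := by
    linear_combination (2 - Real.exp x) * h1
  have h6 : x ^ 2 * Real.exp x = Real.exp (-x) * (x * Real.exp x) ^ 2 := by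
    linear_combination (-x ^ 2 * Real.exp x) * h1
  rw [h5, h6]
  gcongr

section

variable {n : ℕ} {γ α : ℝ}

theorem nu_pos (hα' : α < ((n : ℝ) - 2 * γ) / 2) : 0 < nu n γ α := by
  unfold nu; linarith

theorem nu_lt (hα : -2 * γ < α) : nu n γ α < ((n : ℝ) + 2 * γ) / 2 := by
  unfold nu; linarith

theorem integrable_weight_mul_kernel (hn : 1 ≤ n) (hγ0 : 0 < γ) (hγ1 : γ < 1) (hα : -2 * γ < α)
    (hα' : α < ((n : ℝ) - 2 * γ) / 2) (e : Sph n) :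
    Integrable (fun z : Cyl n => min 1 (z.1 ^ 2) * Real.exp (nu n γ α * |z.1|) *
      kernel n γ (0, e) z) (cylMeasure n) := by
  obtain ⟨C, hC, hCe⟩ := exists_lintegral_kernel_le hn hγ0 hγ1 (nu_pos hα').le (nu_lt hα)
  have hk := measurable_kernel_left (γ := γ) ((0 : ℝ), e)
  refine ⟨by fun_prop, ?_⟩
  refine lt_of_le_of_lt (le_trans (le_of_eq (lintegral_congr fun z => ?_)) (hCe e)) hC.lt_top
  refine Real.enorm_of_nonneg ?_
  have := kernel_nonneg (γ := γ) (0, e) z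
  positivity

/-- The sum of the integrand of `κ` in logarithmic polar coordinates and of its reflection. -/
def kappaSym (n : ℕ) (γ α : ℝ) (e : Sph n) (z : Cyl n) : ℝ :=
  (Real.exp (nu n γ α * z.1) + Real.exp (-(nu n γ α * z.1)) - 2) * kernel n γ (0, e) z

theorem kappaCyl_add_refl (e : Sph n) (z : Cyl n) :
    kappaCyl n γ α e z + kappaCyl n γ α e (cylRefl n z) = kappaSym n γ α e z := by
  have h : cylRefl n z = (-z.1, z.2) := rfl
  rw [kappaCyl, kappaCyl, kappaSym, h, kernel_neg]
  ring_nf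

theorem kappaSym_nonneg (e : Sph n) (z : Cyl n) : 0 ≤ kappaSym n γ α e z := by
  refine mul_nonneg ?_ (kernel_nonneg _ _)
  have := two_le_two_mul_cosh (nu n γ α * z.1)
  rw [Real.cosh_eq] at this
  linarith

/-- The first-order singularity cancels in the symmetrization: `2 cosh x - 2` is at most `x² e^|x|`
and at most `2 e^|x|`, which the weighted kernel estimate absorbs near the pole and at infinity. -/
theorem integrable_kappaSym (hn : 1 ≤ n) (hγ0 : 0 < γ) (hγ1 : γ < 1) (hα : -2 * γ < α)
    (hα' : α < ((n : ℝ) - 2 * γ) / 2) (e : Sph n) :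
    Integrable (kappaSym n γ α e) (cylMeasure n) := by
  have hk := measurable_kernel_left (γ := γ) ((0 : ℝ), e)
  have hν := nu_pos hα'
  refine ((integrable_weight_mul_kernel hn hγ0 hγ1 hα hα' e).const_mul
    (nu n γ α ^ 2 + 2)).mono' (by unfold kappaSym; fun_prop) (Eventually.of_forall fun z => ?_)
  rw [Real.norm_of_nonneg (kappaSym_nonneg e z), kappaSym, ← mul_assoc]
  refine mul_le_mul_of_nonneg_right ?_ (kernel_nonneg _ _)
  have h1 := two_mul_cosh_sub_two_le (nu n γ α * z.1)
  have habs : |nu n γ α * z.1| = nu n γ α * |z.1| := by rw [abs_mul, abs_of_pos hν]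
  rw [habs] at h1
  have hE : 0 < Real.exp (nu n γ α * |z.1|) := Real.exp_pos _
  rcases le_total 1 (z.1 ^ 2) with hz | hz
  · rw [min_eq_left hz]
    have h2 : Real.exp (nu n γ α * z.1) ≤ Real.exp (nu n γ α * |z.1|) :=
      Real.exp_le_exp.2 (by rw [← habs]; exact le_abs_self _)
    have h3 : Real.exp (-(nu n γ α * z.1)) ≤ Real.exp (nu n γ α * |z.1|) :=
      Real.exp_le_exp.2 (by rw [← habs]; exact neg_le_abs _)
    nlinarith [sq_nonneg (nu n γ α)]
  · rw [min_eq_right hz]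
    nlinarith [mul_nonneg (sq_nonneg z.1) hE.le]

theorem integral_kappaSym_pos (hn : 1 ≤ n) (hγ0 : 0 < γ) (hγ1 : γ < 1) (hα : -2 * γ < α)
    (hα' : α < ((n : ℝ) - 2 * γ) / 2) (e : Sph n) :
    0 < ∫ z, kappaSym n γ α e z ∂cylMeasure n := by
  rw [integral_pos_iff_support_of_nonneg (kappaSym_nonneg e)
    (integrable_kappaSym hn hγ0 hγ1 hα hα' e)]
  have hsub : (Set.Ioi (0 : ℝ)) ×ˢ (Set.univ : Set (Sph n)) ⊆
      Function.support (kappaSym n γ α e) := by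
    rintro z ⟨hz, -⟩
    have hz' : 0 < z.1 := hz
    have h1 : 1 < Real.cosh (nu n γ α * z.1) :=
      Real.one_lt_cosh.2 (mul_pos (nu_pos hα') hz').ne'
    have h2 : 1 < Real.cosh z.1 := Real.one_lt_cosh.2 hz'.ne'
    have h3 : 0 < kernel n γ (0, e) z := by
      rw [kernel_eq]
      refine Real.rpow_pos_of_pos ?_ _
      have := inner_sph_le_one e z.2
      simp only [zero_sub, Real.cosh_neg]
      linarith
    rw [Real.cosh_eq] at h1
    exact (mul_pos (by linarith) h3).ne'
  refine lt_of_lt_of_le ?_ (measure_mono hsub)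
  rw [cylMeasure, Measure.prod_prod, Real.volume_Ioi]
  rw [ENNReal.top_mul (toSphere_univ_ne_zero hn)]
  exact ENNReal.zero_lt_top

theorem integrableOn_kappaCyl (hn : 1 ≤ n) (hγ0 : 0 < γ) (hγ1 : γ < 1) (hα : -2 * γ < α)
    (hα' : α < ((n : ℝ) - 2 * γ) / 2) (e : Sph n) {ε : ℝ} (hε : 0 < ε) :
    IntegrableOn (kappaCyl n γ α e) (logPolar n ⁻¹' {ζ | ε < ‖(e : Eucl n) - ζ‖}) (cylMeasure n) ∧
    IntegrableOn (fun z => kappaCyl n γ α e (cylRefl n z))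
      (logPolar n ⁻¹' {ζ | ε < ‖(e : Eucl n) - ζ‖}) (cylMeasure n) := by
  set b := ((n : ℝ) + 2 * γ) / 2 with hb
  have hb0 : 0 < b := by
    have : (0 : ℝ) ≤ n := n.cast_nonneg
    linarith
  have hν := nu_pos hα'
  set ν := nu n γ α with hνdef
  have hm := (continuous_logPolar n).measurable
  have hS : MeasurableSet (logPolar n ⁻¹' {ζ | ε < ‖(e : Eucl n) - ζ‖}) :=
    hm (measurableSet_lt measurable_const (by fun_prop))
  set C := Real.exp ν * (Real.exp b * ε ^ (-(2 * b))) with hC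
  have hC0 : 0 ≤ C := by positivity
  set T : Set (Cyl n) := Set.Icc (-1 : ℝ) 1 ×ˢ Set.univ with hT
  have hTm : MeasurableSet T := measurableSet_Icc.prod MeasurableSet.univ
  have hTfin : cylMeasure n T ≠ ∞ := by
    rw [hT, cylMeasure, Measure.prod_prod]
    exact ENNReal.mul_ne_top (by simp) (measure_ne_top _ _)
  have hdom : Integrable (fun z : Cyl n => min 1 (z.1 ^ 2) * Real.exp (ν * |z.1|) *
      kernel n γ (0, e) z + T.indicator (fun _ => C) z) (cylMeasure n) :=
    (integrable_weight_mul_kernel hn hγ0 hγ1 hα hα' e).add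
      ((integrable_indicator_iff hTm).2 (integrableOn_const hTfin))
  -- The bound depends on `x` only through `|x|`, so it serves both the integrand and its
  -- reflection.
  have hbd : ∀ (x : ℝ) (z : Cyl n), |x| = |z.1| → ε < ‖(e : Eucl n) - logPolar n z‖ →
      ‖(Real.exp (ν * x) - 1) * kernel n γ (0, e) z‖ ≤
        min 1 (z.1 ^ 2) * Real.exp (ν * |z.1|) * kernel n γ (0, e) z +
          T.indicator (fun _ => C) z := by
    intro x z hx hz
    have hk0 := kernel_nonneg (γ := γ) (0, e) z
    have h1 : |Real.exp (ν * x) - 1| ≤ Real.exp (ν * |z.1|) := by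
      have h2 : Real.exp (ν * x) ≤ Real.exp (ν * |z.1|) :=
        Real.exp_le_exp.2 (by rw [← hx]; exact mul_le_mul_of_nonneg_left (le_abs_self _) hν.le)
      have h3 : 1 ≤ Real.exp (ν * |z.1|) := Real.one_le_exp (by positivity)
      rw [abs_le]
      constructor
      · linarith [Real.exp_pos (ν * x)]
      · linarith
    rw [norm_mul, Real.norm_of_nonneg hk0, Real.norm_eq_abs]
    by_cases hzT : |z.1| ≤ 1
    · have hzT' : z ∈ T := ⟨abs_le.1 hzT, Set.mem_univ _⟩
      rw [Set.indicator_of_mem hzT']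
      refine le_trans ?_ (le_add_of_nonneg_left (by positivity))
      have hk : kernel n γ (0, e) z ≤ Real.exp b * ε ^ (-(2 * b)) := by
        rw [kernel_eq_logPolar, ← hb, show (n : ℝ) + 2 * γ = 2 * b by rw [hb]; ring]
        refine mul_le_mul (Real.exp_le_exp.2 ?_)
          (Real.rpow_le_rpow_of_nonpos hε hz.le (by linarith)) (by positivity) (by positivity)
        nlinarith [le_abs_self z.1]
      calc _ ≤ Real.exp (ν * |z.1|) * (Real.exp b * ε ^ (-(2 * b))) := by gcongr
        _ ≤ C := by
          rw [hC]
          gcongr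
          nlinarith
    · have h2 : 1 ≤ z.1 ^ 2 := by
        rw [← sq_abs]
        nlinarith [not_le.1 hzT]
      rw [min_eq_left h2, one_mul]
      refine le_trans (mul_le_mul_of_nonneg_right h1 hk0) (le_add_of_nonneg_right ?_)
      exact Set.indicator_nonneg (fun _ _ => hC0) z
  constructor
  · refine hdom.integrableOn.mono' (measurable_kappaCyl n γ α e).aestronglyMeasurable ?_
    filter_upwards [ae_restrict_mem hS] with z hz
    exact hbd z.1 z rfl hz
  · refine hdom.integrableOn.mono' ((measurable_kappaCyl n γ α e).comp
      (cylRefl n).measurable).aestronglyMeasurable ?_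
    filter_upwards [ae_restrict_mem hS] with z hz
    have h : cylRefl n z = (-z.1, z.2) := rfl
    rw [kappaCyl, h, kernel_neg]
    exact hbd (-z.1) z (abs_neg _) hz

/-- Inversion does not preserve the truncation: it turns `|e - ζ| > ε` into `|e - ζ| > ε |ζ|`. The
two regions must be compared afterwards. -/
theorem preimage_cylRefl (e : Sph n) (ε : ℝ) :
    cylRefl n ⁻¹' (logPolar n ⁻¹' {ζ | ε * ‖ζ‖ < ‖(e : Eucl n) - ζ‖}) =
      logPolar n ⁻¹' {ζ | ε < ‖(e : Eucl n) - ζ‖} := by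
  ext z
  have h1 := norm_sub_logPolar_cylRefl e (cylRefl n z)
  have h2 : cylRefl n (cylRefl n z) = z := by
    ext <;> simp [cylRefl]
  have h3 : 0 < ‖logPolar n (cylRefl n z)‖ := by rw [norm_logPolar]; exact Real.exp_pos _
  rw [h2] at h1
  simp only [Set.mem_preimage, Set.mem_ofPred_eq]
  rw [← h1, mul_comm, mul_lt_mul_iff_right₀ h3]

theorem setIntegral_refl (e : Sph n) (ε : ℝ) :
    ∫ z in logPolar n ⁻¹' {ζ | ε < ‖(e : Eucl n) - ζ‖}, kappaCyl n γ α e (cylRefl n z)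
        ∂cylMeasure n =
      ∫ z in logPolar n ⁻¹' {ζ | ε * ‖ζ‖ < ‖(e : Eucl n) - ζ‖}, kappaCyl n γ α e z
        ∂cylMeasure n := by
  rw [← preimage_cylRefl]
  exact (measurePreserving_cylRefl n).setIntegral_preimage_emb
    (cylRefl n).measurableEmbedding _ _

theorem tendsto_setIntegral_kappaSym (hn : 1 ≤ n) (hγ0 : 0 < γ) (hγ1 : γ < 1) (hα : -2 * γ < α)
    (hα' : α < ((n : ℝ) - 2 * γ) / 2) (e : Sph n) :
    Tendsto (fun ε : ℝ => ∫ z in logPolar n ⁻¹' {ζ | ε < ‖(e : Eucl n) - ζ‖},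
      kappaSym n γ α e z ∂cylMeasure n) (𝓝[>] 0) (𝓝 (∫ z, kappaSym n γ α e z ∂cylMeasure n)) := by
  have hm := (continuous_logPolar n).measurable
  have hS : ∀ ε : ℝ, MeasurableSet (logPolar n ⁻¹' {ζ | ε < ‖(e : Eucl n) - ζ‖}) := fun ε =>
    hm (measurableSet_lt measurable_const (by fun_prop))
  have hint := integrable_kappaSym hn hγ0 hγ1 hα hα' e
  simp_rw [← integral_indicator (hS _)]
  refine tendsto_integral_filter_of_dominated_convergence (kappaSym n γ α e)
    (Eventually.of_forall fun ε => hint.aestronglyMeasurable.indicator (hS ε))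
    (Eventually.of_forall fun ε => Eventually.of_forall fun z => ?_) hint
    (Eventually.of_forall fun z => ?_)
  · refine (norm_indicator_le_norm_self _ _).trans (le_of_eq ?_)
    exact Real.norm_of_nonneg (kappaSym_nonneg e z)
  -- At the pole itself the indicator vanishes for every `ε > 0`, but there `t = 0` and the
  -- symmetrized integrand is zero.
  · rcases eq_or_lt_of_le (norm_nonneg ((e : Eucl n) - logPolar n z)) with h0 | h0
    · have hz : z.1 = 0 := by
        have h1 := abs_one_sub_exp_le e z
        rw [← h0, abs_nonpos_iff, sub_eq_zero] at h1
        exact Real.exp_eq_one_iff _ |>.1 h1.symm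
      have hz0 : kappaSym n γ α e z = 0 := by
        rw [kappaSym, hz]
        norm_num
      refine tendsto_const_nhds.congr fun ε => ?_
      by_cases hmem : z ∈ logPolar n ⁻¹' {ζ | ε < ‖(e : Eucl n) - ζ‖}
      · rw [Set.indicator_of_mem hmem]
      · rw [Set.indicator_of_notMem hmem, hz0]
    · refine tendsto_const_nhds.congr' ?_
      filter_upwards [nhdsWithin_le_nhds (gt_mem_nhds h0)] with ε hε
      rw [Set.indicator_of_mem (show z ∈ logPolar n ⁻¹' {ζ | ε < ‖(e : Eucl n) - ζ‖} from hε)]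

/-- The numerator vanishes to first order on `|ζ| = 1`, which gains a factor `ε` over the kernel on
the shell `|e - ζ| ≈ ε`. -/
theorem norm_kappaIntegrand_le (hγ0 : 0 < γ) (hα' : α < ((n : ℝ) - 2 * γ) / 2)
    (e : Sph n) {ε : ℝ} (hε : 0 < ε) (hε4 : ε < 1 / 4) {ζ : Eucl n}
    (h1 : ε / 2 ≤ ‖(e : Eucl n) - ζ‖) (h2 : ‖(e : Eucl n) - ζ‖ ≤ 2 * ε) :
    ‖kappaIntegrand n γ α e ζ‖ ≤
      (4 * nu n γ α * Real.exp (nu n γ α) * Real.exp |α| * (1 / 2) ^ (-((n : ℝ) + 2 * γ))) *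
        (ε * ε ^ (-((n : ℝ) + 2 * γ))) := by
  have hν := nu_pos hα'
  set ν := nu n γ α with hνdef
  set d := ‖(e : Eucl n) - ζ‖ with hd
  set r := ‖ζ‖ with hr
  have hd0 : 0 < d := by linarith
  have hrd : |1 - r| ≤ d := by
    have := abs_norm_sub_norm_le (e : Eucl n) ζ
    simpa using this
  have hrd' := abs_le.1 hrd
  have hr0 : 1 / 2 < r := by linarith
  have hrpos : 0 < r := by linarith
  have hlog : |Real.log r| ≤ 2 * d := by
    rw [abs_le]
    constructor
    · have := Real.one_sub_inv_le_log_of_pos hrpos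
      have h3 : r⁻¹ - 1 ≤ 2 * d := by
        rw [inv_eq_one_div, sub_le_iff_le_add, div_le_iff₀ hrpos]
        nlinarith
      linarith
    · linarith [Real.log_le_sub_one_of_pos hrpos]
  have hlog1 : |Real.log r| ≤ 1 := hlog.trans (by linarith)
  have hb1 : |1 - r ^ (-ν)| ≤ 4 * ν * Real.exp ν * ε := by
    have h5 : r ^ (-ν) = Real.exp (-(ν * Real.log r)) := by
      rw [Real.rpow_def_of_pos hrpos]; ring_nf
    have h6 : ∀ x : ℝ, |1 - Real.exp x| ≤ |x| * Real.exp |x| := by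
      intro x
      rcases le_total 0 x with hx | hx
      · rw [abs_of_nonneg hx, abs_sub_comm, abs_of_nonneg (by linarith [Real.add_one_le_exp x])]
        exact exp_sub_one_le x
      · have h7 := Real.add_one_le_exp x
        have h8 : Real.exp x ≤ 1 := Real.exp_le_one_iff.2 hx
        have h9 : 1 ≤ Real.exp (-x) := Real.one_le_exp (by linarith)
        rw [abs_of_nonpos hx, abs_of_nonneg (by linarith)]
        nlinarith
    have h10 : |-(ν * Real.log r)| = ν * |Real.log r| := by rw [abs_neg, abs_mul, abs_of_pos hν]
    rw [h5]
    refine (h6 _).trans ?_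
    rw [h10]
    calc ν * |Real.log r| * Real.exp (ν * |Real.log r|) ≤ ν * (4 * ε) * Real.exp (ν * 1) := by
          gcongr
          linarith
      _ = _ := by rw [mul_one]; ring
  have hb2 : (r ^ α)⁻¹ ≤ Real.exp |α| := by
    rw [← Real.rpow_neg hrpos.le, Real.rpow_def_of_pos hrpos]
    refine Real.exp_le_exp.2 ?_
    calc Real.log r * -α ≤ |Real.log r * -α| := le_abs_self _
      _ = |Real.log r| * |α| := by rw [abs_mul, abs_neg]
      _ ≤ 1 * |α| := by gcongr
      _ = |α| := one_mul _
  have hs : -((n : ℝ) + 2 * γ) ≤ 0 := by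
    have : (0 : ℝ) ≤ n := n.cast_nonneg
    linarith
  have hb3 : (d ^ ((n : ℝ) + 2 * γ))⁻¹ ≤
      (1 / 2) ^ (-((n : ℝ) + 2 * γ)) * ε ^ (-((n : ℝ) + 2 * γ)) := by
    rw [← Real.rpow_neg hd0.le, ← Real.mul_rpow (by norm_num) hε.le]
    refine Real.rpow_le_rpow_of_nonpos (by positivity) ?_ hs
    linarith
  rw [kappaIntegrand, norm_div, norm_mul, Real.norm_eq_abs, Real.norm_of_nonneg (by positivity),
    Real.norm_of_nonneg (by positivity), div_eq_mul_inv, mul_inv]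
  calc _ ≤ (4 * ν * Real.exp ν * ε) *
        (((1 / 2) ^ (-((n : ℝ) + 2 * γ)) * ε ^ (-((n : ℝ) + 2 * γ))) * Real.exp |α|) := by
        gcongr
    _ = _ := by ring

/-- The symmetric difference of the two truncations of the principal value is negligible. -/
theorem tendsto_setIntegral_sub (hn : 1 ≤ n) (hγ0 : 0 < γ) (hγ1 : γ < 1) (hα : -2 * γ < α)
    (hα' : α < ((n : ℝ) - 2 * γ) / 2) (e : Sph n) :
    Tendsto (fun ε : ℝ =>
      ∫ z in logPolar n ⁻¹' {ζ | ε < ‖(e : Eucl n) - ζ‖}, kappaCyl n γ α e z ∂cylMeasure n -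
      ∫ z in logPolar n ⁻¹' {ζ | ε * ‖ζ‖ < ‖(e : Eucl n) - ζ‖}, kappaCyl n γ α e z ∂cylMeasure n)
      (𝓝[>] 0) (𝓝 0) := by
  have hdim : Module.finrank ℝ (Eucl n) = n := by simp
  have : Nontrivial (Eucl n) := Module.nontrivial_of_finrank_pos (R := ℝ) (by rw [hdim]; omega)
  have hm := (continuous_logPolar n).measurable
  have hν := nu_pos hα'
  set ω := volume.real (Metric.ball (0 : Eucl n) 1) with hω
  set C0 := 4 * nu n γ α * Real.exp (nu n γ α) * Real.exp |α| * (1 / 2) ^ (-((n : ℝ) + 2 * γ))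
    with hC0
  have hC0' : 0 ≤ C0 := by positivity
  set C1 := 2 * n * Real.exp (2 * n) + n with hC1
  -- The two truncations differ inside a shell of volume `O(ε^(n+1))`, on which the integrand is
  -- `O(ε^(1-n-2γ))`. The product `ε^(2-2γ)` tends to zero because `γ < 1`.
  have key : ∀ ε : ℝ, 0 < ε → ε < 1 / 4 →
      |∫ z in logPolar n ⁻¹' {ζ | ε < ‖(e : Eucl n) - ζ‖}, kappaCyl n γ α e z ∂cylMeasure n -
      ∫ z in logPolar n ⁻¹' {ζ | ε * ‖ζ‖ < ‖(e : Eucl n) - ζ‖}, kappaCyl n γ α e z ∂cylMeasure n|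
      ≤ C0 * ω * C1 * ε ^ (2 - 2 * γ) := by
    intro ε hε hε4
    set A : Set (Eucl n) := {ζ | ε < ‖(e : Eucl n) - ζ‖} with hA
    set A' : Set (Eucl n) := {ζ | ε * ‖ζ‖ < ‖(e : Eucl n) - ζ‖} with hA'
    have hAm : MeasurableSet A := measurableSet_lt measurable_const (by fun_prop)
    have hAm' : MeasurableSet A' := measurableSet_lt (by fun_prop) (by fun_prop)
    obtain ⟨i1, i2⟩ := integrableOn_kappaCyl hn hγ0 hγ1 hα hα' e hε
    have i2' : IntegrableOn (kappaCyl n γ α e) (logPolar n ⁻¹' A') (cylMeasure n) := by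
      rw [← (measurePreserving_cylRefl n).integrableOn_comp_preimage
        (cylRefl n).measurableEmbedding, preimage_cylRefl]
      exact i2
    set D : Eucl n → ℝ := fun ζ => A.indicator (kappaIntegrand n γ α e) ζ -
      A'.indicator (kappaIntegrand n γ α e) ζ with hD
    have hDm : Measurable D := ((measurable_kappaIntegrand n γ α e).indicator hAm).sub
      ((measurable_kappaIntegrand n γ α e).indicator hAm')
    have hdiff : ∫ z in logPolar n ⁻¹' A, kappaCyl n γ α e z ∂cylMeasure n -
        ∫ z in logPolar n ⁻¹' A', kappaCyl n γ α e z ∂cylMeasure n = ∫ ζ, D ζ := by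
      rw [integral_logPolar hn hDm, ← integral_indicator (hm hAm), ← integral_indicator (hm hAm'),
        ← integral_sub ((integrable_indicator_iff (hm hAm)).2 i1)
          ((integrable_indicator_iff (hm hAm')).2 i2')]
      refine integral_congr_ae (Eventually.of_forall fun z => ?_)
      have hind : ∀ B : Set (Eucl n), (logPolar n ⁻¹' B).indicator (kappaCyl n γ α e) z =
          Real.exp (n * z.1) * B.indicator (kappaIntegrand n γ α e) (logPolar n z) := by
        intro B
        by_cases hz : logPolar n z ∈ B
        · rw [Set.indicator_of_mem hz, Set.indicator_of_mem (show z ∈ logPolar n ⁻¹' B from hz),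
            exp_mul_kappaIntegrand]
        · rw [Set.indicator_of_notMem hz,
            Set.indicator_of_notMem (show z ∉ logPolar n ⁻¹' B from hz), mul_zero]
      simp only [hD, hind]
      ring
    -- Since `||ζ| - 1| ≤ |e - ζ|`, a point where the truncations disagree satisfies either `ε (1 -
    -- ε) < |e - ζ| ≤ ε` or `ε < |e - ζ| ≤ ε/(1 - ε) ≤ ε (1 + 2ε)`.
    set ρ1 := ε * (1 - ε) with hρ1
    set ρ2 := ε * (1 + 2 * ε) with hρ2
    have hρ10 : 0 ≤ ρ1 := mul_nonneg hε.le (by linarith)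
    have hρ20 : 0 ≤ ρ2 := by positivity
    have hρ12 : ρ1 ≤ ρ2 := mul_le_mul_of_nonneg_left (by linarith) hε.le
    set R : Set (Eucl n) := Metric.closedBall (e : Eucl n) ρ2 \ Metric.closedBall (e : Eucl n) ρ1
      with hR
    have hRm : MeasurableSet R := MeasurableSet.diff measurableSet_closedBall measurableSet_closedBall
    have hbd : ∀ ζ, ‖D ζ‖ ≤ R.indicator (fun _ => C0 * (ε * ε ^ (-((n : ℝ) + 2 * γ)))) ζ := by
      intro ζ
      have hζ := abs_norm_sub_norm_le (e : Eucl n) ζ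
      have he1 : ‖(e : Eucl n)‖ = 1 := by simp
      rw [he1, abs_le] at hζ
      have hmem : ζ ∈ R ↔ ρ1 < ‖(e : Eucl n) - ζ‖ ∧ ‖(e : Eucl n) - ζ‖ ≤ ρ2 := by
        rw [hR, Set.mem_sdiff, Metric.mem_closedBall, Metric.mem_closedBall, dist_comm,
          dist_eq_norm, not_le, and_comm]
      have hval : ζ ∈ R → ‖kappaIntegrand n γ α e ζ‖ ≤
          R.indicator (fun _ => C0 * (ε * ε ^ (-((n : ℝ) + 2 * γ)))) ζ := by
        intro hζR
        rw [Set.indicator_of_mem hζR]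
        obtain ⟨h1, h2⟩ := hmem.1 hζR
        refine norm_kappaIntegrand_le hγ0 hα' e hε hε4 ?_ ?_
        · nlinarith
        · nlinarith
      have hnn : 0 ≤ R.indicator (fun _ => C0 * (ε * ε ^ (-((n : ℝ) + 2 * γ)))) ζ :=
        Set.indicator_nonneg (fun _ _ => by positivity) ζ
      simp only [hD]
      by_cases h1 : ζ ∈ A <;> by_cases h2 : ζ ∈ A'
      · rw [Set.indicator_of_mem h1, Set.indicator_of_mem h2]; simpa using hnn
      · rw [Set.indicator_of_mem h1, Set.indicator_of_notMem h2, sub_zero]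
        refine hval (hmem.2 ?_)
        have h1' : ε < ‖(e : Eucl n) - ζ‖ := h1
        have h2' : ‖(e : Eucl n) - ζ‖ ≤ ε * ‖ζ‖ := not_lt.1 h2
        constructor
        · nlinarith
        · nlinarith
      · rw [Set.indicator_of_notMem h1, Set.indicator_of_mem h2, zero_sub, norm_neg]
        refine hval (hmem.2 ?_)
        have h1' : ‖(e : Eucl n) - ζ‖ ≤ ε := not_lt.1 h1
        have h2' : ε * ‖ζ‖ < ‖(e : Eucl n) - ζ‖ := h2
        constructor
        · nlinarith
        · nlinarith
      · rw [Set.indicator_of_notMem h1, Set.indicator_of_notMem h2]; simpa using hnn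
    have hRtop : volume R ≠ ∞ :=
      ne_top_of_le_ne_top measure_closedBall_lt_top.ne (measure_mono Set.sdiff_subset)
    have hball : ∀ ρ : ℝ, 0 ≤ ρ → volume.real (Metric.closedBall (e : Eucl n) ρ) = ρ ^ n * ω := by
      intro ρ hρ
      rw [measureReal_def, Measure.addHaar_closedBall volume (e : Eucl n) hρ, hdim,
        ENNReal.toReal_mul, ENNReal.toReal_ofReal (by positivity), hω, measureReal_def]
    have hvol : volume.real R = (ρ2 ^ n - ρ1 ^ n) * ω := by
      rw [hR, measureReal_sdiff (Metric.closedBall_subset_closedBall hρ12) measurableSet_closedBall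
        measure_closedBall_lt_top.ne, hball _ hρ20, hball _ hρ10]
      ring
    have hω0 : 0 ≤ ω := measureReal_nonneg
    have hann : ρ2 ^ n - ρ1 ^ n ≤ ε ^ n * (C1 * ε) := by
      rw [hρ1, hρ2, mul_pow, mul_pow, ← mul_sub]
      gcongr
      have hb1 : 1 + (n : ℝ) * (-ε) ≤ (1 + -ε) ^ n :=
        one_add_mul_le_pow (by linarith) n
      have hb2 : (1 + 2 * ε) ^ n ≤ Real.exp (n * (2 * ε)) := by
        rw [Real.exp_nat_mul]
        gcongr
        linarith [Real.add_one_le_exp (2 * ε)]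
      have hb3 := exp_sub_one_le (n * (2 * ε))
      have hn0 : (0 : ℝ) ≤ n := n.cast_nonneg
      have hb4 : Real.exp (n * (2 * ε)) ≤ Real.exp (2 * n) := Real.exp_le_exp.2 (by nlinarith)
      have hb5 : n * (2 * ε) * Real.exp (n * (2 * ε)) ≤ n * (2 * ε) * Real.exp (2 * n) := by gcongr
      rw [← sub_eq_add_neg] at hb1
      rw [hC1]
      linarith
    have hpow : ε * ε ^ (-((n : ℝ) + 2 * γ)) * (ε ^ n * ε) = ε ^ (2 - 2 * γ) := by
      have e1 : ε ^ (2 - 2 * γ) = ε ^ (1 : ℝ) * ε ^ (-((n : ℝ) + 2 * γ)) * (ε ^ (n : ℝ) * ε ^ (1 : ℝ)) := by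
        rw [← Real.rpow_add hε, ← Real.rpow_add hε, ← Real.rpow_add hε]
        congr 1
        ring
      rw [e1, Real.rpow_one, Real.rpow_natCast]
    rw [hdiff, ← Real.norm_eq_abs]
    refine (norm_integral_le_of_norm_le ((integrable_indicator_iff hRm).2
      (integrableOn_const hRtop)) (Eventually.of_forall hbd)).trans ?_
    rw [integral_indicator hRm, setIntegral_const, hvol, smul_eq_mul]
    calc (ρ2 ^ n - ρ1 ^ n) * ω * (C0 * (ε * ε ^ (-((n : ℝ) + 2 * γ))))
        ≤ (ε ^ n * (C1 * ε)) * ω * (C0 * (ε * ε ^ (-((n : ℝ) + 2 * γ)))) := by gcongr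
      _ = C0 * ω * C1 * (ε * ε ^ (-((n : ℝ) + 2 * γ)) * (ε ^ n * ε)) := by ring
      _ = _ := by rw [hpow]
  have hlim : Tendsto (fun ε : ℝ => C0 * ω * C1 * ε ^ (2 - 2 * γ)) (𝓝[>] 0) (𝓝 0) := by
    have h1 : Tendsto (fun ε : ℝ => ε ^ (2 - 2 * γ)) (𝓝[>] 0) (𝓝 0) := by
      have := (Real.continuousAt_rpow_const 0 (2 - 2 * γ) (Or.inr (by linarith))).tendsto
      rw [Real.zero_rpow (by linarith)] at this
      exact this.mono_left nhdsWithin_le_nhds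
    simpa using h1.const_mul (C0 * ω * C1)
  refine squeeze_zero_norm' ?_ hlim
  filter_upwards [self_mem_nhdsWithin, nhdsWithin_le_nhds (gt_mem_nhds
    (by norm_num : (0 : ℝ) < 1 / 4))] with ε h0 h4
  exact key ε h0 h4

/-- The principal value in the definition of `κ`, after symmetrization under inversion. -/
theorem tendsto_kappa (hn : 1 ≤ n) (hγ0 : 0 < γ) (hγ1 : γ < 1) (hα : -2 * γ < α)
    (hα' : α < ((n : ℝ) - 2 * γ) / 2) (e : Sph n) :
    Tendsto (fun ε : ℝ => ∫ ζ in {ζ | ε < ‖(e : Eucl n) - ζ‖}, kappaIntegrand n γ α e ζ) (𝓝[>] 0)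
      (𝓝 ((∫ z, kappaSym n γ α e z ∂cylMeasure n) / 2)) := by
  -- The symmetrized integral is the sum of the integrals over the two truncations. Adding their
  -- difference gives twice the truncated integral in the definition of `κ`.
  have h1 := (tendsto_setIntegral_kappaSym hn hγ0 hγ1 hα hα' e).add
    (tendsto_setIntegral_sub hn hγ0 hγ1 hα hα' e)
  rw [add_zero] at h1
  refine (h1.div_const 2).congr' ?_
  filter_upwards [self_mem_nhdsWithin] with ε hε
  obtain ⟨i1, i2⟩ := integrableOn_kappaCyl hn hγ0 hγ1 hα hα' e hε
  simp_rw [← kappaCyl_add_refl]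
  rw [integral_add i1 i2, setIntegral_refl, setIntegral_kappaIntegrand hn e
    (measurableSet_lt measurable_const (by fun_prop))]
  ring

theorem norm_e₁ (hn : 1 ≤ n) : ‖e₁ n‖ = 1 := by
  obtain ⟨m, rfl⟩ := Nat.exists_eq_add_of_le' hn
  simp [EuclideanSpace.norm_eq, e₁]

/-- The truncated integrals converge, so the `limUnder` in `kappa` is their actual limit, half the
integral of `kappaSym`, and not a default value. -/
theorem kappa_pos (hn : 1 ≤ n) (hγ0 : 0 < γ) (hγ1 : γ < 1) (hα : -2 * γ < α)
    (hα' : α < ((n : ℝ) - 2 * γ) / 2) : 0 < kappa n γ α := by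
  have he : e₁ n ∈ Metric.sphere (0 : Eucl n) 1 := by simp [norm_e₁ hn]
  have h : kappa n γ α = _ := (tendsto_kappa hn hγ0 hγ1 hα hα' ⟨e₁ n, he⟩).limUnder_eq
  rw [h]
  exact half_pos (integral_kappaSym_pos hn hγ0 hγ1 hα hα' _)

end

/-! ### Reduction of the functional to the line -/

theorem energyDensity_ae_eq {n : ℕ} {v : Cyl n → ℝ} {f : ℝ → ℝ}
    (hv : ∀ᵐ z ∂cylMeasure n, v z = f z.1) (γ : ℝ) :
    energyDensity n γ v =ᵐ[(cylMeasure n).prod (cylMeasure n)]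
      energyDensity n γ fun z => f z.1 := by
  have h1 := (Measure.quasiMeasurePreserving_fst (μ := cylMeasure n) (ν := cylMeasure n)).ae hv
  have h2 := (Measure.quasiMeasurePreserving_snd (μ := cylMeasure n) (ν := cylMeasure n)).ae hv
  filter_upwards [h1, h2] with q hq1 hq2
  rw [energyDensity, energyDensity, hq1, hq2]

theorem lintegral_cyl_rpow (n : ℕ) {f : ℝ → ℝ} (hf : Measurable f) (p : ℝ) :
    ∫⁻ z, ‖f z.1‖ₑ ^ p ∂cylMeasure n =
      (volume : Measure (Eucl n)).toSphere Set.univ * lpPow p f := by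
  have h2 := lintegral_prod_mul (μ := (volume : Measure ℝ))
    (ν := (volume : Measure (Eucl n)).toSphere) (f := fun t => ‖f t‖ₑ ^ p) (g := fun _ => 1)
    (by fun_prop) aemeasurable_const
  simp only [mul_one, lintegral_const, one_mul] at h2
  rw [mul_comm]
  exact h2

theorem measurable_energyDensity (n : ℕ) (γ : ℝ) {f : ℝ → ℝ} (hf : Measurable f) :
    Measurable (energyDensity n γ fun z => f z.1) := by
  have := measurable_kernel n γ
  unfold energyDensity
  fun_prop

theorem energyDensity_nonneg {n : ℕ} {γ : ℝ} (v : Cyl n → ℝ) (q : Cyl n × Cyl n) :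
    0 ≤ energyDensity n γ v q :=
  mul_nonneg (kernel_nonneg _ _) (sq_nonneg _)

theorem integrable_energyDensity_iff {n : ℕ} {γ : ℝ} {v : Cyl n → ℝ} {f : ℝ → ℝ}
    (hf : Measurable f) (hv : ∀ᵐ z ∂cylMeasure n, v z = f z.1) :
    Integrable (energyDensity n γ v) ((cylMeasure n).prod (cylMeasure n)) ↔
      gagliardo (radKernel n γ) f ≠ ∞ := by
  rw [integrable_congr (energyDensity_ae_eq hv γ), ← lintegral_energyDensity n γ hf,
    ← lt_top_iff_ne_top, ← hasFiniteIntegral_iff_ofReal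
      (Eventually.of_forall (energyDensity_nonneg _))]
  exact ⟨fun h => h.2, fun h => ⟨(measurable_energyDensity n γ hf).aestronglyMeasurable, h⟩⟩

/-- The coefficient of the `L²` norm in the energy on the line. -/
def massCoeff (n : ℕ) (γ α : ℝ) : ℝ≥0∞ :=
  ENNReal.ofReal (2 * kappa n γ α) * (volume : Measure (Eucl n)).toSphere Set.univ

/-- Finite energy guarantees that the Bochner integrals in the numerator agree with the extended
ones. The measure of the sphere is divided out of the numerator except inside `massCoeff` and
`radKernel`, and enters the denominator as a fixed factor. -/
theorem F_eq {n : ℕ} {γ α β : ℝ} (hp : 0 ≤ pExp n γ α β) (hκ : 0 < kappa n γ α) {v : Cyl n → ℝ} {f : ℝ → ℝ}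
    (hf : Measurable f) (hv : ∀ᵐ z ∂cylMeasure n, v z = f z.1)
    (hE : gagliardo (radKernel n γ) f ≠ ∞) (h2 : lpPow 2 f ≠ ∞) :
    F n γ α β v = (energy (radKernel n γ) (massCoeff n γ α) f).toReal /
      ((volume : Measure (Eucl n)).toSphere.real Set.univ * (lpPow (pExp n γ α β) f).toReal) ^
        (2 / pExp n γ α β) := by
  set σ := (volume : Measure (Eucl n)).toSphere with hσ
  have hfm : Measurable fun z : Cyl n => f z.1 := hf.comp measurable_fst
  have i1 : ∫ q, energyDensity n γ v q ∂((cylMeasure n).prod (cylMeasure n)) =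
      (gagliardo (radKernel n γ) f).toReal := by
    rw [integral_congr_ae (energyDensity_ae_eq hv γ),
      integral_eq_lintegral_of_nonneg_ae (Eventually.of_forall (energyDensity_nonneg _))
        (measurable_energyDensity n γ hf).aestronglyMeasurable, lintegral_energyDensity n γ hf]
  have i2 : ∫ z, v z ^ 2 ∂cylMeasure n = (σ Set.univ * lpPow 2 f).toReal := by
    have : ∫ z, v z ^ 2 ∂cylMeasure n = ∫ z, f z.1 ^ 2 ∂cylMeasure n := by
      refine integral_congr_ae ?_
      filter_upwards [hv] with z hz
      rw [hz]
    rw [this, integral_eq_lintegral_of_nonneg_ae (Eventually.of_forall fun z => sq_nonneg _)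
      (hfm.pow_const 2).aestronglyMeasurable, ← lintegral_cyl_rpow n hf]
    congr 1
    refine lintegral_congr fun z => ?_
    rw [← sq_abs, ENNReal.ofReal_pow (abs_nonneg _), ENNReal.rpow_two, ← Real.enorm_eq_ofReal_abs]
  have i3 : ∫ z, |v z| ^ pExp n γ α β ∂cylMeasure n =
      σ.real Set.univ * (lpPow (pExp n γ α β) f).toReal := by
    have : ∫ z, |v z| ^ pExp n γ α β ∂cylMeasure n =
        ∫ z, (‖f z.1‖ₑ ^ pExp n γ α β).toReal ∂cylMeasure n := by
      refine integral_congr_ae ?_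
      filter_upwards [hv] with z hz
      rw [hz, ← ENNReal.toReal_rpow, toReal_enorm, Real.norm_eq_abs]
    rw [this, measureReal_def, ← ENNReal.toReal_mul, ← lintegral_cyl_rpow n hf]
    refine integral_toReal (by fun_prop) (Eventually.of_forall fun z => ?_)
    exact ENNReal.rpow_lt_top_of_nonneg hp enorm_ne_top
  have hσtop : σ Set.univ ≠ ∞ := measure_ne_top _ _
  rw [F, i1, i2, i3, energy, massCoeff, ENNReal.toReal_add hE (ENNReal.mul_ne_top
    (ENNReal.mul_ne_top ENNReal.ofReal_ne_top hσtop) h2), mul_assoc (ENNReal.ofReal _),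
    ENNReal.toReal_mul (a := ENNReal.ofReal _), ENNReal.toReal_ofReal (by positivity)]

/-- The functional `F` attains its infimum over the nonzero radially symmetric functions. -/
theorem exists_radial_minimizer (n : ℕ) (hn : 2 ≤ n) (γ α β : ℝ) (hγ0 : 0 < γ) (hγ1 : γ < 1)
    (hα : -2 * γ < α) (hα' : α < ((n : ℝ) - 2 * γ) / 2) (hβ : α ≤ β) (hβ' : β < α + γ) :
    (∀ w ∈ DspaceRad n γ,
      MemLp w (ENNReal.ofReal (pExp n γ α β)) (cylMeasure n)) ∧
    ∃ v ∈ DspaceRad n γ, v ≠ 0 ∧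
      ∀ w ∈ DspaceRad n γ, w ≠ 0 → F n γ α β v ≤ F n γ α β w := by
  have hn1 : 1 ≤ n := by omega
  have hn2 : (2 : ℝ) ≤ n := by exact_mod_cast hn
  have hden : 0 < (n : ℝ) - 2 * γ + 2 * (β - α) := by linarith
  have hp : 2 < pExp n γ α β := by
    rw [pExp, lt_div_iff₀ hden]
    linarith
  have hp0 : 0 < pExp n γ α β := by linarith
  -- Subcriticality on the line: the Sobolev gap is `(γ - (β - α))/n`, at most `γ/n`, and `n ≥ 2`.
  have hpγ : 1 / 2 - 1 / pExp n γ α β < γ := by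
    have h1 : 1 / 2 - 1 / pExp n γ α β = (γ - (β - α)) / n := by
      rw [pExp]
      field_simp
      ring
    rw [h1, div_lt_iff₀ (by linarith)]
    nlinarith
  have hκ := kappa_pos (α := α) hn1 hγ0 hγ1 hα hα'
  obtain ⟨c, hc0, hc, hk⟩ := exists_isSingular_radKernel (n := n) hn1 hγ0
  have hkm := measurable_radKernel n γ
  set σ := (volume : Measure (Eucl n)).toSphere with hσ
  have hσ0 : σ Set.univ ≠ 0 := toSphere_univ_ne_zero hn1
  have hσtop : σ Set.univ ≠ ∞ := measure_ne_top _ _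
  have hΛ0 : massCoeff n γ α ≠ 0 := mul_ne_zero (by simpa using hκ) hσ0
  have hΛ : massCoeff n γ α ≠ ∞ := ENNReal.mul_ne_top ENNReal.ofReal_ne_top hσtop
  set p := pExp n γ α β with hpdef
  -- radial elements correspond to functions on the line
  have hrad : ∀ w ∈ DspaceRad n γ, ∃ f : ℝ → ℝ, Measurable f ∧
      (∀ᵐ z ∂cylMeasure n, w z = f z.1) ∧ gagliardo (radKernel n γ) f ≠ ∞ ∧ lpPow 2 f ≠ ∞ := by
    rintro w ⟨hwD, f, hf, hwf⟩
    refine ⟨f, hf, hwf, (integrable_energyDensity_iff hf hwf).1 hwD, fun h => ?_⟩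
    have h1 := (Lp.memLp w).2
    rw [eLpNorm_two_eq, lintegral_congr_ae (g := fun z => ‖f z.1‖ₑ ^ (2 : ℝ))
      (by filter_upwards [hwf] with z hz; rw [hz]), lintegral_cyl_rpow n hf, h,
      ENNReal.mul_top hσ0] at h1
    simp at h1
  refine ⟨fun w hw => ?_, ?_⟩
  · obtain ⟨f, hf, hwf, hE, h2⟩ := hrad w hw
    have hNp := lpPow_ne_top hγ0 hk hc0 hc hkm hp hpγ hf h2 hE
    refine ⟨(Lp.memLp w).1, ?_⟩
    rw [eLpNorm_eq_lintegral_rpow_enorm_toReal (by simpa using hp0) ENNReal.ofReal_ne_top,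
      ENNReal.toReal_ofReal hp0.le, lintegral_congr_ae (g := fun z => ‖f z.1‖ₑ ^ p)
      (by filter_upwards [hwf] with z hz; rw [hz]), lintegral_cyl_rpow n hf]
    exact ENNReal.rpow_lt_top_of_nonneg (by positivity) (ENNReal.mul_ne_top hσtop hNp)
  · obtain ⟨f, hf, hf0, hfE, hmin⟩ := exists_minimizer hγ0 hk hc0 hc hkm hp hpγ hΛ0 hΛ
      ⟨hat, continuous_hat.measurable, lpPow_hat.1, ENNReal.add_ne_top.2
        ⟨gagliardo_hat_ne_top hkm (lintegral_min_mul_radKernel_ne_top hn1 hγ0 hγ1),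
          ENNReal.mul_ne_top hΛ lpPow_hat.2⟩⟩
    have hfE' := ENNReal.add_ne_top.1 hfE
    have hf2 : lpPow 2 f ≠ ∞ := fun h => hfE'.2 (by rw [h]; exact ENNReal.mul_top hΛ0)
    have hmem : MemLp (fun z : Cyl n => f z.1) 2 (cylMeasure n) := by
      refine ⟨(hf.comp measurable_fst).aestronglyMeasurable, ?_⟩
      rw [eLpNorm_two_eq, lintegral_cyl_rpow n hf]
      exact ENNReal.rpow_lt_top_of_nonneg (by norm_num) (ENNReal.mul_ne_top hσtop hf2)
    have hvf : ∀ᵐ z ∂cylMeasure n, hmem.toLp _ z = f z.1 := hmem.coeFn_toLp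
    have hpos : ∀ {g : ℝ → ℝ}, Measurable g → lpPow 2 g ≠ 0 → lpPow p g ≠ 0 := by
      intro g hg h
      rwa [Ne, lpPow_eq_zero_iff hp0 hg, ← lpPow_eq_zero_iff two_pos hg]
    refine ⟨hmem.toLp _, ⟨(integrable_energyDensity_iff hf hvf).2 hfE'.1, f, hf, hvf⟩,
      fun h => hf0 ?_, fun w hw hw0 => ?_⟩
    · have h1 : eLpNorm (fun z : Cyl n => f z.1) 2 (cylMeasure n) = 0 := by
        rw [← Lp.enorm_toLp hmem, h, enorm_zero]
      rw [eLpNorm_two_eq, lintegral_cyl_rpow n hf, ENNReal.rpow_eq_zero_iff_of_pos (by norm_num)] at h1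
      exact (mul_eq_zero.1 h1).resolve_left hσ0
    · obtain ⟨g, hg, hwg, hgE, hg2⟩ := hrad w hw
      have hg0 : lpPow 2 g ≠ 0 := by
        intro h
        refine hw0 ((Lp.eq_zero_iff_ae_eq_zero).2 ?_)
        have h1 : ∫⁻ z : Cyl n, ‖g z.1‖ₑ ^ (2 : ℝ) ∂cylMeasure n = 0 := by
          rw [lintegral_cyl_rpow n hg, h, mul_zero]
        rw [lintegral_eq_zero_iff (by fun_prop)] at h1
        filter_upwards [h1, hwg] with z hz hz'
        rw [hz']
        simpa using hz
      have hgEn : energy (radKernel n γ) (massCoeff n γ α) g ≠ ∞ :=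
        ENNReal.add_ne_top.2 ⟨hgE, ENNReal.mul_ne_top hΛ hg2⟩
      have hNf := lpPow_ne_top hγ0 hk hc0 hc hkm hp hpγ hf hf2 hfE'.1
      have hNg := lpPow_ne_top hγ0 hk hc0 hc hkm hp hpγ hg hg2 hgE
      have hNf0 := ENNReal.toReal_pos (hpos hf hf0) hNf
      have hNg0 := ENNReal.toReal_pos (hpos hg hg0) hNg
      have hσr : 0 < σ.real Set.univ := ENNReal.toReal_pos hσ0 hσtop
      have hineq := ENNReal.toReal_mono (ENNReal.mul_ne_top hgEn
        (ENNReal.rpow_ne_top_of_nonneg (by positivity) hNf)) (hmin g hg)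
      rw [ENNReal.toReal_mul, ENNReal.toReal_mul, ← ENNReal.toReal_rpow,
        ← ENNReal.toReal_rpow] at hineq
      rw [F_eq hp0.le hκ hf hvf hfE'.1 hf2, F_eq hp0.le hκ hg hwg hgE hg2, ← hpdef,
        div_le_div_iff₀ (by positivity) (by positivity), Real.mul_rpow hσr.le hNg0.le,
        Real.mul_rpow hσr.le hNf0.le]
      -- The power of the sphere's measure is common to both denominators, so it multiplies both
      -- sides of the inequality on the line.
      have hs : 0 ≤ σ.real Set.univ ^ (2 / p) := by positivity
      linarith [mul_le_mul_of_nonneg_left hineq hs]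

end FracCKN

end

theorem proposition3p7 (n : ℕ) (hn : 2 ≤ n) (γ α β : ℝ) (hγ0 : 0 < γ) (hγ1 : γ < 1)
    (hα : -2 * γ < α) (hα' : α < ((n : ℝ) - 2 * γ) / 2) (hβ : α ≤ β) (hβ' : β < α + γ) :
    (∀ w ∈ FracCKN.DspaceRad n γ,
      MemLp w (ENNReal.ofReal (FracCKN.pExp n γ α β)) (FracCKN.cylMeasure n)) ∧
    ∃ v ∈ FracCKN.DspaceRad n γ, v ≠ 0 ∧
      ∀ w ∈ FracCKN.DspaceRad n γ, w ≠ 0 → FracCKN.F n γ α β v ≤ FracCKN.F n γ α β w :=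
  FracCKN.exists_radial_minimizer n hn γ α β hγ0 hγ1 hα hα' hβ hβ'
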